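/- **Notation.** Fix $1<\alpha\le\beta\le2$, $\nu,\mu>0$, $r>0$, $c_1,c_2>0$. For a function $g$ on $\mathbb R^n$ put $$\|g\|_{\dot C^\beta}=\max_{|\gamma|=\lfloor\beta\rfloor}\sup_{x\ne x'}\frac{|\partial^\gamma g(x)-\partial^\gamma g(x')|}{|x-x'|^{\beta-\lfloor\beta\rfloor}},\qquad \|g\|_{C^\beta}=\max_{|\gamma|\le\lfloor\beta\rfloor}\sup|\partial^\gamma g|+\|g\|_{\dot C^\beta},$$ and call $g$ of class $C^\beta$ if it is $\lfloor\beta\rfloor$ times continuously differentiable and the relevant (semi)norm is finite. *Cartoon-like images.* Let $STAR^\alpha(\nu,r)$ be the set of all $B\subset[0,1]^3$ of the form $B=\{x_0+tu:\ |u|=1,\ 0\le t\le\rho(u)\}$, where $r\le\rho\le\rho_0$ on the unit sphere for some $\rho_0<1$, and where, in every system of spherical coordinates (that is, for every choice of orthonormal axes), $\rho$ is, as a function of the angles $(\theta_1,\theta_2)\in\mathbb R^2$, of class $C^\alpha$ with $\|\rho\|_{\dot C^\alpha}\le\nu$. Let $f=f_0+\chi_Bf_1$ with $B\in STAR^\alpha(\nu,r)$,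 $f_0,f_1:\mathbb R^3\to\mathbb C$ of class $C^\beta$, $\|f_i\|_{C^\beta}\le\mu$, $\operatorname{supp}f_0\subset[0,1]^3$. *Shearlets.* Let $\psi\in L^2(\mathbb R^3)$ be compactly supported, and suppose that there are constants $K$, $\delta>8$, $\gamma\ge4$ and a function $h\in L^1(\mathbb R)$ such that, with $\hat\psi(\xi)=\int\psi(x)e^{-2\pi i\langle\xi,x\rangle}dx$, 1. $|\hat\psi(\xi)|\le K\min\{1,|\xi_1|^\delta\}\min\{1,|\xi_1|^{-\gamma}\}\min\{1,|\xi_2|^{-\gamma}\}\min\{1,|\xi_3|^{-\gamma}\}$ for all $\xi$ (where $\min\{1,|0|^{-\gamma}\}=1$); 2. $|\partial_{\xi_i}\hat\psi(\xi)|\le|h(\xi_1)|\,(1+|\xi_2|/|\xi_1|)^{-\gamma}(1+|\xi_3|/|\xi_1|)^{-\gamma}$ for $i=2,3$ and all $\xi$ with $\xi_1\ne0$. For $j\in\mathbb N_0$, $k\in\mathbb Z^2$ with $|k_1|,|k_2|\le\lceil2^{j(\alpha-1)/2}\rceil$ and $m\in\operatorname{diag}(c_1,c_2,c_2)\mathbb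 Z^3$ let $\psi_\lambda=\psi_{j,k,m}=2^{j(\alpha+2)/4}\psi(S_kA_{2^j}\cdot-m)$, where $$A_{2^j}=\operatorname{diag}(2^{j\alpha/2},2^{j/2},2^{j/2}),\qquad S_k=\begin{pmatrix}1&k_1&k_2\\0&1&0\\0&0&1\end{pmatrix}.$$ For $p\in\mathbb Z^3$ let $\mathcal Q_{j,p}=[-2^{-j/2},2^{-j/2}]^3+2^{-j/2}\,2p$. **Theorem.** There is a constant $C>0$, depending only on $\alpha,\beta,\nu,\mu,r,c_1,c_2$ and $\psi$, such that the following holds for all such $B$ and $f$, all $j\ge0$ and $p\in\mathbb Z^3$, all such $\lambda=(j,k,m)$, and every $\hat x\in\operatorname{int}(\mathcal Q_{j,p})\cap\operatorname{int}(\operatorname{supp}\psi_\lambda)\cap\partial B$. Let $H$ be the tangent plane to $\partial B$ at $\hat x$. (i) If $H$ has normal vector $(-1,s_1,s_2)$ with $|s_1|\le3$ and $|s_2|\le3$, then $$|\langle f,\psi_\lambda\rangle|\le C\min_{i=1,2}\left\{\frac{2^{-j(\alpha/4+1/2)}}{|k_i+2^{j(\alpha-1)/2}s_i|^{\alpha+1}}\right\},$$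 where a term with zero denominator is read as $+\infty$. (ii) If $H$ has normal vector $(-1,s_1,s_2)$ with $|s_1|\ge3/2$ or $|s_2|\ge3/2$, then $$|\langle f,\psi_\lambda\rangle|\le C\,2^{-j(\alpha/2+1/4)\alpha}.$$ (iii) If $H$ has normal vector $(0,s_1,s_2)\neq0$, then the estimate of (ii) holds. -/

import Mathlib

open MeasureTheory Filter Topology Asymptotics
open scoped ENNReal FourierTransform ComplexConjugate

noncomputable section

/-- Euclidean 3-space. -/
abbrev E3 := EuclideanSpace ℝ (Fin 3)

/-! ### Hölder (semi)norms -/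

/-- The partial derivative `∂_{i 0} ⋯ ∂_{i (m-1)} f`. As `i` runs over all maps `Fin m → Fin n`,
these are the derivatives `∂^γ f` over all multi-indices with `|γ| = m`. -/
def partialDeriv {n m : ℕ} {F : Type*} [NormedAddCommGroup F] [NormedSpace ℝ F]
    (i : Fin m → Fin n) (f : EuclideanSpace ℝ (Fin n) → F) (x : EuclideanSpace ℝ (Fin n)) : F :=
  iteratedFDeriv ℝ m f x (fun l => EuclideanSpace.single (i l) (1 : ℝ))

/-- The homogeneous Hölder seminorm
`max_{|γ| = ⌊β⌋} sup_{x,x'} |∂^γ f(x) - ∂^γ f(x')| / |x - x'|^{β - ⌊β⌋}`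
(the diagonal `x = x'` contributes `0`). -/
def holderSeminorm {n : ℕ} {F : Type*} [NormedAddCommGroup F] [NormedSpace ℝ F]
    (β : ℝ) (f : EuclideanSpace ℝ (Fin n) → F) : ℝ≥0∞ :=
  ⨆ i : Fin ⌊β⌋₊ → Fin n, ⨆ x, ⨆ x',
    ‖partialDeriv i f x - partialDeriv i f x'‖ₑ / ‖x - x'‖ₑ ^ (β - (⌊β⌋₊ : ℝ))

/-- The Hölder norm `max_{|γ| ≤ ⌊β⌋} sup |∂^γ f| + (seminorm of f)`. -/
def holderNorm {n : ℕ} {F : Type*} [NormedAddCommGroup F] [NormedSpace ℝ F]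
    (β : ℝ) (f : EuclideanSpace ℝ (Fin n) → F) : ℝ≥0∞ :=
  (⨆ m : ℕ, ⨆ _ : m ≤ ⌊β⌋₊, ⨆ i : Fin m → Fin n, ⨆ x, ‖partialDeriv i f x‖ₑ)
    + holderSeminorm β f

/-! ### Star-shaped sets and cartoon-like images -/

/-- The unit vector with spherical angles `(θ₁, θ₂)`. -/
def sphericalDir (θ : EuclideanSpace ℝ (Fin 2)) : E3 :=
  !₂[Real.cos (θ 0) * Real.sin (θ 1), Real.sin (θ 0) * Real.sin (θ 1), Real.cos (θ 1)]

/-- The set that is star-shaped about `x₀` with radius `ρ u` in the direction `u`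
(only the values of `ρ` at unit vectors matter). -/
def starBody (x₀ : E3) (ρ : E3 → ℝ) : Set E3 :=
  {x | ∃ u : E3, ‖u‖ = 1 ∧ ∃ t : ℝ, 0 ≤ t ∧ t ≤ ρ u ∧ x = x₀ + t • u}

/-- The closed unit cube `[0,1]³`. -/
def unitCube : Set E3 := {x | ∀ i, 0 ≤ x i ∧ x i ≤ 1}

/-- Star-shaped sets in `[0,1]³` whose boundary is a closed `C^α` surface: the radius is bounded
below by `r` and above by some `ρ₀ < 1`, and, as a function of the spherical angles, it is
`C^α` with homogeneous Hölder seminorm at most `ν`. The last condition is imposed for every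
choice `O` of the axes of the spherical coordinates, since one system of spherical coordinates
does not control the surface near its own poles. -/
def STAR (α ν r : ℝ) : Set (Set E3) :=
  {B | B ⊆ unitCube ∧ ∃ (x₀ : E3) (ρ : E3 → ℝ), B = starBody x₀ ρ ∧
    (∀ u : E3, ‖u‖ = 1 → r ≤ ρ u) ∧
    (∃ ρ₀ : ℝ, ρ₀ < 1 ∧ ∀ u : E3, ‖u‖ = 1 → ρ u ≤ ρ₀) ∧
    ∀ O : E3 ≃ₗᵢ[ℝ] E3,
      ContDiff ℝ ⌊α⌋₊ (fun θ => ρ (O (sphericalDir θ))) ∧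
      holderSeminorm α (fun θ => ρ (O (sphericalDir θ))) ≤ ENNReal.ofReal ν}

/-- `f = f₀ + f₁ χ_B` is a cartoon-like image with discontinuity surface `∂B`. -/
def IsCartoon (α β ν μ r : ℝ) (B : Set E3) (f : E3 → ℂ) : Prop :=
  B ∈ STAR α ν r ∧ ∃ f₀ f₁ : E3 → ℂ,
    f = f₀ + B.indicator f₁ ∧ tsupport f₀ ⊆ unitCube ∧
    (ContDiff ℝ ⌊β⌋₊ f₀ ∧ holderNorm β f₀ ≤ ENNReal.ofReal μ) ∧
    (ContDiff ℝ ⌊β⌋₊ f₁ ∧ holderNorm β f₁ ≤ ENNReal.ofReal μ)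

/-- The plane through `x` with normal vector `n` is the tangent plane of `S` at `x`: the distance
of `y ∈ S` from it is `o(|y - x|)`. -/
def IsTangentPlaneNormal (S : Set E3) (x n : E3) : Prop :=
  x ∈ S ∧ n ≠ 0 ∧ (fun y : E3 => inner ℝ (y - x) n) =o[𝓝[S] x] (fun y : E3 => y - x)

/-! ### Shearlets -/

/-- The scaling matrix `A_{2^j}`. -/
def scalingMatrix (α : ℝ) (j : ℕ) : Matrix (Fin 3) (Fin 3) ℝ :=
  Matrix.diagonal ![(2 : ℝ) ^ ((j : ℝ) * α / 2), (2 : ℝ) ^ ((j : ℝ) / 2), (2 : ℝ) ^ ((j : ℝ) / 2)]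

/-- The shear matrix `S_k`. -/
def shearMatrix (k : Fin 2 → ℤ) : Matrix (Fin 3) (Fin 3) ℝ :=
  !![1, (k 0 : ℝ), (k 1 : ℝ); 0, 1, 0; 0, 0, 1]

/-- The lattice point `M_c z`, where `M_c = diag(c₁, c₂, c₂)`. -/
def latticePoint (c₁ c₂ : ℝ) (z : Fin 3 → ℤ) : E3 :=
  !₂[c₁ * (z 0 : ℝ), c₂ * (z 1 : ℝ), c₂ * (z 2 : ℝ)]

/-- The shearlet `ψ_{j,k,m} = 2^{j(α+2)/4} ψ(S_k A_{2^j} · - m)`. -/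
def shearlet (α : ℝ) (ψ : E3 → ℂ) (j : ℕ) (k : Fin 2 → ℤ) (m : E3) (x : E3) : ℂ :=
  (((2 : ℝ) ^ ((j : ℝ) * (α + 2) / 4) : ℝ) : ℂ) *
    ψ (WithLp.toLp 2 (Matrix.mulVec (shearMatrix k * scalingMatrix α j) (WithLp.ofLp x)) - m)

/-- The shearlet coefficient `⟨f, g⟩ = ∫ f \bar g`. -/
def coeff (f g : E3 → ℂ) : ℂ := ∫ x, f x * conj (g x)

/-- The dyadic cube `[-2^{-j/2}, 2^{-j/2}]³ + 2^{-j/2} 2p`. -/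
def dyadicCube (j : ℕ) (p : Fin 3 → ℤ) : Set E3 :=
  {x | ∀ i, |x i - (2 : ℝ) ^ (-((j : ℝ) / 2)) * (2 * (p i : ℝ))| ≤ (2 : ℝ) ^ (-((j : ℝ) / 2))}

/-- `min {1, |t|^{-γ}}`, which is `1` at `t = 0`. -/
def decayFactor (γ t : ℝ) : ℝ := (max 1 |t|) ^ (-γ)

/-- The decay conditions on the Fourier transform of the generator:
(i) on `ψ̂` and (ii) on its derivatives in the second and third variable. -/
def DecayConditions (ψ : E3 → ℂ) : Prop :=
  ∃ (K δ γ : ℝ) (h : ℝ → ℝ), 8 < δ ∧ 4 ≤ γ ∧ Integrable h ∧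
    (∀ ξ : E3, ‖𝓕 ψ ξ‖ ≤
      K * min 1 (|ξ 0| ^ δ) * decayFactor γ (ξ 0) * decayFactor γ (ξ 1) * decayFactor γ (ξ 2)) ∧
    (∀ ξ : E3, ξ 0 ≠ 0 → ∀ i : Fin 3, i ≠ 0 →
      ‖fderiv ℝ (𝓕 ψ) ξ (EuclideanSpace.single i (1 : ℝ))‖ ≤
        |h (ξ 0)| * (1 + |ξ 1| / |ξ 0|) ^ (-γ) * (1 + |ξ 2| / |ξ 0|) ^ (-γ))

end

/-! Put `D = 2^{-j/2}` and `T = 2^{j(α-1)/2}`, so that `D^{α-1} = 1/T`. The substitution `y = S_k A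
x - m` turns the coefficient into `2^{-j(α/4+1/2)}` times the integral of `f(x̂ + X(y - y₀))`
against `conj ψ`, over a box that does not depend on the scale (`norm_coeff_eq`). Here `X = (S_k
A)⁻¹` sends the first axis to a vector of length `D/T` and the other two to sheared vectors of
length about `D`. It remains to bound this integral by a multiple of `ε^{α+1}`
(`exists_norm_rescaled_integral_le`), where `ε = min(1, 1/|k_i + T s_i|)` in (i) and `ε = 1/T` in
(ii) and (iii).

Geometry. The set `B` has a defining function `φ` near `x̂` whose gradient is `(α-1)`-Hölder and has
norm at least 1 at `x̂` (`exists_isDefiningFunction`). In the variable `y` its derivative is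
`O(D/T)` along the first axis and at least of order `D/(Tε)` along axis `i + 1`. In planes spanned
by these two directions the boundary is therefore a graph of slope `O(ε)`. Moving along its tangent
displaces `x` by `O(εD)`, so the graph leaves its tangent by at most `O((εD)^α / (D/(Tε))) =
O(ε^{α+1})`. Each slice of `B` is thus a half plane up to a strip of admissible area
(`exists_halfPlane`).

Cancellation. The half plane is a union of lines of slope `O(ε)`. Because `ψ̂` vanishes to high
order at `ξ₁ = 0`, the moments of `ψ` along such lines are `O(ε³)` in order zero and `O(ε)` in order
one (`FourierDecay.line_moments`). A Taylor expansion of the smooth part along the line then gives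
`ε³ + εD·ε + (εD)^β` (`norm_line_integral_le`), and every term is `O(ε^{α+1})`
(`IsScale.line_bound`).

When `ε` is bounded below the claim is the trivial bound by the `L¹` norm of the generator. -/

noncomputable section

/-! ### Coordinates adapted to one of the two shear directions -/

/-- The point with coordinate `t` along the first axis, `v` along the axis `i + 1` and `s` along
the remaining axis. -/
def axisPoint (i : Fin 2) (t v s : ℝ) : E3 :=
  t • EuclideanSpace.single 0 (1 : ℝ) + v • EuclideanSpace.single i.succ (1 : ℝ) +
    s • EuclideanSpace.single i.rev.succ (1 : ℝ)

lemma axisPoint_zero_coord (i : Fin 2) (t v s : ℝ) : axisPoint i t v s 0 = t := by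
  fin_cases i <;> simp [axisPoint, Fin.rev]

lemma axisPoint_succ_coord (i : Fin 2) (t v s : ℝ) : axisPoint i t v s i.succ = v := by
  fin_cases i <;> simp [axisPoint, Fin.rev]

lemma axisPoint_rev_coord (i : Fin 2) (t v s : ℝ) : axisPoint i t v s i.rev.succ = s := by
  fin_cases i <;> simp [axisPoint, Fin.rev]

lemma axisPoint_surj (i : Fin 2) (x : E3) : axisPoint i (x 0) (x i.succ) (x i.rev.succ) = x := by
  ext l
  fin_cases i <;> fin_cases l <;> simp [axisPoint, Fin.rev]

lemma continuous_axisPoint (i : Fin 2) :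
    Continuous fun q : ℝ × (ℝ × ℝ) => axisPoint i q.1 q.2.1 q.2.2 := by
  unfold axisPoint; fun_prop

lemma axisPoint_injective (i : Fin 2) :
    Function.Injective fun q : ℝ × (ℝ × ℝ) => axisPoint i q.1 q.2.1 q.2.2 := by
  rintro ⟨t, v, s⟩ ⟨t', v', s'⟩ h
  have h : axisPoint i t v s = axisPoint i t' v' s' := h
  have h0 := congrArg (fun x : E3 => x 0) h
  have h1 := congrArg (fun x : E3 => x i.succ) h
  have h2 := congrArg (fun x : E3 => x i.rev.succ) h
  simp only [axisPoint_zero_coord, axisPoint_succ_coord, axisPoint_rev_coord] at h0 h1 h2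
  simp [h0, h1, h2]

lemma measurableEmbedding_axisPoint (i : Fin 2) :
    MeasurableEmbedding fun q : ℝ × (ℝ × ℝ) => axisPoint i q.1 q.2.1 q.2.2 :=
  (continuous_axisPoint i).measurableEmbedding (axisPoint_injective i)

/-- Inserting `s` at position `i.rev.succ` leaves the positions `0` and `i.succ`, in this order, for
`t` and `v`; the map is a composition of coordinate rearrangements. -/
lemma measurePreserving_axisPoint (i : Fin 2) :
    MeasurePreserving (fun q : ℝ × (ℝ × ℝ) => axisPoint i q.1 q.2.1 q.2.2) := by
  have h1 := (volume_preserving_piFinSuccAbove (fun _ : Fin 3 => ℝ) i.rev.succ).symm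
  have h2 := (volume_preserving_finTwoArrow ℝ).symm
  have h3 : MeasurePreserving (Prod.map (id : ℝ → ℝ) (MeasurableEquiv.finTwoArrow (α := ℝ)).symm) :=
    (MeasurePreserving.id (volume : Measure ℝ)).prod h2
  have h4 := (PiLp.volume_preserving_toLp (Fin 3)).comp (h1.comp h3)
  have h5 : MeasurePreserving (fun q : ℝ × (ℝ × ℝ) => (q.2.2, (q.1, q.2.1))) := by
    have h6 : MeasurePreserving (Prod.swap : (ℝ × ℝ) × ℝ → ℝ × (ℝ × ℝ)) :=
      Measure.measurePreserving_swap
    exact h6.comp (volume_preserving_prodAssoc (α₁ := ℝ) (β₁ := ℝ) (γ₁ := ℝ)).symm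
  convert h4.comp h5 using 1
  ext q l
  obtain ⟨t, v, s⟩ := q
  fin_cases i <;> fin_cases l <;> simp [axisPoint, Fin.rev, Fin.insertNth, Fin.succAboveCases, MeasurableEquiv.finTwoArrow, MeasurableEquiv.piFinSuccAbove,Fin.insertNthEquiv]

lemma integral_axisPoint {F : Type*} [NormedAddCommGroup F] [NormedSpace ℝ F] (i : Fin 2)
    (f : E3 → F) : ∫ q : ℝ × (ℝ × ℝ), f (axisPoint i q.1 q.2.1 q.2.2) = ∫ x, f x :=
  (measurePreserving_axisPoint i).integral_comp (measurableEmbedding_axisPoint i) f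

lemma integrable_axisPoint {F : Type*} [NormedAddCommGroup F] (i : Fin 2)
    {f : E3 → F} : Integrable (fun q : ℝ × (ℝ × ℝ) => f (axisPoint i q.1 q.2.1 q.2.2)) ↔
      Integrable f :=
  (measurePreserving_axisPoint i).integrable_comp_emb (measurableEmbedding_axisPoint i)

lemma inner_axisPoint (i : Fin 2) (t v s t' v' s' : ℝ) :
    inner ℝ (axisPoint i t v s) (axisPoint i t' v' s') = t * t' + v * v' + s * s' := by
  rw [PiLp.inner_apply, Fin.sum_univ_three]
  fin_cases i <;> simp [axisPoint, Fin.rev] <;> ring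
end

noncomputable section

/-! ### Moments along lines of a function with prescribed Fourier decay -/

/-- Decay along the axes, with a zero of order four in the first variable. -/
def FourierDecay (i : Fin 2) (K : ℝ) (G : E3 → ℂ) : Prop :=
  ∀ t v s : ℝ, ‖G (axisPoint i t v s)‖ ≤
    K * min (t ^ 4) (1 + t ^ 2)⁻¹ * (((1 + |v|) ^ 4)⁻¹ * ((1 + |s|) ^ 4)⁻¹)

lemma inv_one_add_abs_pow_four_le (t : ℝ) : ((1 + |t|) ^ 4)⁻¹ ≤ (1 + t ^ 2)⁻¹ := by
  apply inv_anti₀ (by positivity)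
  have h := abs_nonneg t
  have h2 := sq_abs t
  nlinarith [pow_nonneg h 2, pow_nonneg h 3, pow_nonneg h 4]

lemma integrable_inv_one_add_abs_pow_four : Integrable fun t : ℝ => ((1 + |t|) ^ 4)⁻¹ := by
  refine integrable_inv_one_add_sq.mono' (by fun_prop (disch := intros; positivity)) ?_
  filter_upwards with t
  rw [Real.norm_of_nonneg (by positivity)]
  exact inv_one_add_abs_pow_four_le t

lemma integral_inv_one_add_abs_pow_four_le : ∫ t : ℝ, ((1 + |t|) ^ 4)⁻¹ ≤ 4 := by
  calc ∫ t : ℝ, ((1 + |t|) ^ 4)⁻¹ ≤ ∫ t : ℝ, (1 + t ^ 2)⁻¹ :=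
        integral_mono integrable_inv_one_add_abs_pow_four integrable_inv_one_add_sq
          inv_one_add_abs_pow_four_le
    _ = Real.pi := integral_univ_inv_one_add_sq
    _ ≤ 4 := Real.pi_le_four

lemma norm_exp_I_sub_le (x : ℝ) : ‖Complex.exp (x * Complex.I) - 1 - x * Complex.I‖ ≤
    3 * x ^ 2 := by
  have hn : ‖(x : ℂ) * Complex.I‖ = |x| := by simp
  rcases le_total |x| 1 with h | h
  · refine (Complex.norm_exp_sub_one_sub_id_le (by rwa [hn])).trans ?_
    rw [hn, sq_abs]
    nlinarith [sq_nonneg x]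
  · calc ‖Complex.exp (x * Complex.I) - 1 - x * Complex.I‖
        ≤ ‖Complex.exp (x * Complex.I)‖ + ‖(1 : ℂ)‖ + ‖(x : ℂ) * Complex.I‖ :=
          (norm_sub_le _ _).trans (by gcongr; exact norm_sub_le _ _)
      _ = 2 + |x| := by rw [hn, Complex.norm_exp_ofReal_mul_I, norm_one]; ring
      _ ≤ 3 * x ^ 2 := by rw [← sq_abs]; nlinarith

/-- In terms of `u = ε(1 + |w|)` the left side is `ε⁴ · min(…) · u⁻⁴`. The zero of order four
handles `u ≤ 1` and boundedness handles `u ≥ 1`. The profile on the right has width `1/ε`, so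
integrating over `w` costs one power of `ε` and leaves `ε³`. -/
lemma min_pow_four_mul_le {ε t w : ℝ} (hε : 0 < ε) (ht : |t| ≤ ε * (1 + |w|)) :
    min (t ^ 4) (1 + t ^ 2)⁻¹ * ((1 + |w|) ^ 4)⁻¹ ≤ 2 * ε ^ 4 * (1 + (ε * w) ^ 2)⁻¹ := by
  set u := ε * (1 + |w|) with hu
  have hw : 0 < 1 + |w| := by positivity
  have hu0 : 0 < u := by positivity
  have h1 : min (t ^ 4) (1 + t ^ 2)⁻¹ ≤ u ^ 4 := by
    refine (min_le_left _ _).trans ?_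
    rw [← Even.pow_abs (by decide)]
    gcongr
  have h2 : min (t ^ 4) (1 + t ^ 2)⁻¹ ≤ 1 :=
    (min_le_right _ _).trans (inv_le_one_of_one_le₀ (by nlinarith [sq_nonneg t]))
  have h3 : ((1 + |w|) ^ 4)⁻¹ = ε ^ 4 * (u ^ 4)⁻¹ := by
    rw [hu]; field_simp
  have h4 : (ε * w) ^ 2 ≤ u ^ 2 := by
    rw [hu, mul_pow, mul_pow, ← sq_abs w]
    gcongr
    linarith [abs_nonneg w]
  have h5 : min (t ^ 4) (1 + t ^ 2)⁻¹ * (u ^ 4)⁻¹ ≤ 2 * (1 + u ^ 2)⁻¹ := by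
    rw [← div_eq_mul_inv, ← div_eq_mul_inv, div_le_div_iff₀ (by positivity) (by positivity)]
    rcases le_total u 1 with h | h
    · nlinarith [pow_le_one₀ hu0.le h (n := 2), pow_pos hu0 4]
    · nlinarith [one_le_pow₀ h (n := 2), sq_nonneg (u ^ 2 - 1)]
  calc min (t ^ 4) (1 + t ^ 2)⁻¹ * ((1 + |w|) ^ 4)⁻¹
      = ε ^ 4 * (min (t ^ 4) (1 + t ^ 2)⁻¹ * (u ^ 4)⁻¹) := by rw [h3]; ring
    _ ≤ ε ^ 4 * (2 * (1 + u ^ 2)⁻¹) := by gcongr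
    _ ≤ ε ^ 4 * (2 * (1 + (ε * w) ^ 2)⁻¹) := by gcongr
    _ = _ := by ring

lemma integrable_inv_one_add_mul_sq {ε : ℝ} (hε : 0 < ε) :
    Integrable fun w : ℝ => (1 + (ε * w) ^ 2)⁻¹ :=
  integrable_inv_one_add_sq.comp_mul_left' hε.ne'

lemma integral_inv_one_add_mul_sq {ε : ℝ} (hε : 0 < ε) :
    ∫ w : ℝ, (1 + (ε * w) ^ 2)⁻¹ = Real.pi / ε := by
  rw [Measure.integral_comp_mul_left (fun w => (1 + w ^ 2)⁻¹) ε, integral_univ_inv_one_add_sq,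
    abs_of_pos (inv_pos.2 hε), smul_eq_mul]
  field_simp

lemma FourierDecay.integrable {i : Fin 2} {K : ℝ} {G : E3 → ℂ} (hG : FourierDecay i K G)
    (hc : Continuous G) : Integrable G := by
  rw [← integrable_axisPoint i]
  have h1 := (integrable_inv_one_add_sq.const_mul K).mul_prod
    (integrable_inv_one_add_abs_pow_four.mul_prod integrable_inv_one_add_abs_pow_four)
  refine h1.mono' (hc.comp (continuous_axisPoint i)).aestronglyMeasurable ?_
  filter_upwards with ⟨t, v, s⟩
  have hK : 0 ≤ K := by
    have := (norm_nonneg _).trans (hG 1 0 0)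
    norm_num at this
    linarith
  refine (hG t v s).trans ?_
  dsimp only
  gcongr
  exact min_le_right _ _

/-- Integration of `G` over the planes `ξ₁ = τ - a ξ_{i+1}` against a character. -/
def planeTransform (i : Fin 2) (G : E3 → ℂ) (a v s τ : ℝ) : ℂ :=
  ∫ q : ℝ × ℝ, (𝐞 (q.1 * v + q.2 * s) : ℂ) * G (axisPoint i (τ - a * q.1) q.1 q.2)

lemma measurePreserving_shear (i : Fin 2) (a : ℝ) :
    MeasurePreserving (fun p : (ℝ × ℝ) × ℝ => axisPoint i (p.2 - a * p.1.1) p.1.1 p.1.2) := by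
  have h1 : MeasurePreserving (fun p : (ℝ × ℝ) × ℝ => ((p.1, p.2 - a * p.1.1) : (ℝ × ℝ) × ℝ)) := by
    refine (MeasurePreserving.id (volume : Measure (ℝ × ℝ))).skew_product
      (g := fun q τ => τ - a * q.1) (by fun_prop) ?_
    filter_upwards with q
    exact (measurePreserving_sub_right (volume : Measure ℝ) (a * q.1)).map_eq
  have h2 : MeasurePreserving (Prod.swap : (ℝ × ℝ) × ℝ → ℝ × (ℝ × ℝ)) :=
    Measure.measurePreserving_swap
  exact (measurePreserving_axisPoint i).comp (h2.comp h1)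

lemma measurableEmbedding_shear (i : Fin 2) (a : ℝ) :
    MeasurableEmbedding
      (fun p : (ℝ × ℝ) × ℝ => axisPoint i (p.2 - a * p.1.1) p.1.1 p.1.2) := by
  refine Continuous.measurableEmbedding ?_ ?_
  · exact (continuous_axisPoint i).comp
      (g := fun q : ℝ × (ℝ × ℝ) => axisPoint i q.1 q.2.1 q.2.2)
      (f := fun p : (ℝ × ℝ) × ℝ => (p.2 - a * p.1.1, p.1.1, p.1.2)) (by fun_prop)
  · rintro ⟨⟨v, s⟩, t⟩ ⟨⟨v', s'⟩, t'⟩ h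
    have := axisPoint_injective i (a₁ := (t - a * v, v, s)) (a₂ := (t' - a * v', v', s')) h
    simp only [Prod.mk.injEq] at this ⊢
    obtain ⟨h1, rfl, rfl⟩ := this
    exact ⟨⟨rfl, rfl⟩, by linarith⟩

lemma norm_character_mul (x : ℝ) (z : ℂ) : ‖(𝐞 x : ℂ) * z‖ = ‖z‖ := by
  rw [norm_mul, Circle.norm_coe, one_mul]

lemma integrable_planeTransform_integrand {i : Fin 2} {G : E3 → ℂ}
    (hi : Integrable G) (a v s : ℝ) :
    Integrable (fun p : (ℝ × ℝ) × ℝ => (𝐞 (p.1.1 * v + p.1.2 * s) : ℂ) *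
      G (axisPoint i (p.2 - a * p.1.1) p.1.1 p.1.2)) := by
  have h := ((measurePreserving_shear i a).integrable_comp_emb
    (measurableEmbedding_shear i a)).2 hi
  refine h.norm.mono' ?_ ?_
  · refine AEStronglyMeasurable.mul ?_ h.aestronglyMeasurable
    refine Continuous.aestronglyMeasurable ?_
    have := Real.continuous_fourierChar
    fun_prop
  · filter_upwards with p
    rw [norm_character_mul]; rfl

/-- Slice theorem: restricting to a line of slope `a` corresponds to integrating the transform over
sheared planes. The shear `τ - a q` in frequency cancels the term `a t` of the line in the phase. -/
lemma fourierInv_line_eq {i : Fin 2} {G : E3 → ℂ} (hi : Integrable G) (a v s t : ℝ) :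
    𝓕⁻ G (axisPoint i t (v + a * t) s) = 𝓕⁻ (planeTransform i G a v s) t := by
  have h0 := integrable_planeTransform_integrand (i := i) hi a v s
  rw [Real.fourierInv_eq, Real.fourierInv_eq]
  rw [← (measurePreserving_shear i a).integral_comp (measurableEmbedding_shear i a)]
  have h1 : ∀ p : (ℝ × ℝ) × ℝ,
      𝐞 (inner ℝ (axisPoint i (p.2 - a * p.1.1) p.1.1 p.1.2) (axisPoint i t (v + a * t) s)) •
        G (axisPoint i (p.2 - a * p.1.1) p.1.1 p.1.2) =
      (𝐞 (p.2 * t) : ℂ) * ((𝐞 (p.1.1 * v + p.1.2 * s) : ℂ) *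
        G (axisPoint i (p.2 - a * p.1.1) p.1.1 p.1.2)) := by
    intro p
    rw [inner_axisPoint, Circle.smul_def, smul_eq_mul, ← mul_assoc, ← Circle.coe_mul,
      ← AddChar.map_add_eq_mul]
    congr 3
    ring
  simp_rw [h1]
  have h2 : Integrable (fun p : (ℝ × ℝ) × ℝ => (𝐞 (p.2 * t) : ℂ) *
      ((𝐞 (p.1.1 * v + p.1.2 * s) : ℂ) *
        G (axisPoint i (p.2 - a * p.1.1) p.1.1 p.1.2))) := by
    refine h0.norm.mono' ?_ ?_
    · refine AEStronglyMeasurable.mul ?_ h0.aestronglyMeasurable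
      refine Continuous.aestronglyMeasurable ?_
      have := Real.continuous_fourierChar
      fun_prop
    · filter_upwards with p
      rw [norm_character_mul]
  rw [Measure.volume_eq_prod, integral_prod_symm _ h2]
  refine integral_congr_ae ?_
  filter_upwards with τ
  rw [integral_const_mul, Circle.smul_def, smul_eq_mul, planeTransform]
  simp [mul_comm]

lemma FourierDecay.nonneg {i : Fin 2} {K : ℝ} {G : E3 → ℂ} (hG : FourierDecay i K G) : 0 ≤ K := by
  have := (norm_nonneg _).trans (hG 1 0 0)
  norm_num at this
  linarith

lemma FourierDecay.continuous_planeTransform {i : Fin 2} {K : ℝ} {G : E3 → ℂ}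
    (hG : FourierDecay i K G) (hc : Continuous G) (a v s : ℝ) :
    Continuous (planeTransform i G a v s) := by
  have hK := hG.nonneg
  have hch := Real.continuous_fourierChar
  have hcont : ∀ {X : Type} [TopologicalSpace X] (f g h : X → ℝ), Continuous f → Continuous g →
      Continuous h → Continuous fun x => G (axisPoint i (f x) (g x) (h x)) := by
    intro X _ f g h hf hg hh
    exact hc.comp ((continuous_axisPoint i).comp (hf.prodMk (hg.prodMk hh)))
  refine continuous_of_dominated
    (bound := fun q : ℝ × ℝ => K * (((1 + |q.1|) ^ 4)⁻¹ * ((1 + |q.2|) ^ 4)⁻¹)) ?_ ?_ ?_ ?_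
  · intro τ
    refine Continuous.aestronglyMeasurable (Continuous.mul (by fun_prop) ?_)
    exact hcont _ _ _ (by fun_prop) (by fun_prop) (by fun_prop)
  · intro τ
    filter_upwards with q
    rw [norm_character_mul]
    refine (hG _ _ _).trans ?_
    have : K * min ((τ - a * q.1) ^ 4) (1 + (τ - a * q.1) ^ 2)⁻¹ ≤ K * 1 := by
      gcongr
      exact (min_le_right _ _).trans
        (inv_le_one_of_one_le₀ (by nlinarith [sq_nonneg (τ - a * q.1)]))
    rw [mul_one] at this
    gcongr
  · exact (integrable_inv_one_add_abs_pow_four.mul_prod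
      integrable_inv_one_add_abs_pow_four).const_mul K
  · filter_upwards with q
    exact continuous_const.mul (hcont _ _ _ (by fun_prop) (by fun_prop) (by fun_prop))

/-- On the plane the first frequency is `τ - a q`, of size at most `ε(1 + |q|)`, so `G` is evaluated
close to its zero set wherever its decay in `q` has not yet set in. -/
lemma FourierDecay.norm_planeTransform_le {i : Fin 2} {K : ℝ} {G : E3 → ℂ}
    (hG : FourierDecay i K G) {ε a τ : ℝ} (hε : 0 < ε) (ha : |a| ≤ ε) (hτ : |τ| ≤ ε) (v s : ℝ) :
    ‖planeTransform i G a v s τ‖ ≤ 32 * K * ε ^ 3 := by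
  have hK := hG.nonneg
  have hint := ((integrable_inv_one_add_mul_sq hε).const_mul (K * (2 * ε ^ 4))).mul_prod
      integrable_inv_one_add_abs_pow_four
  calc ‖planeTransform i G a v s τ‖
      ≤ ∫ q : ℝ × ℝ, (K * (2 * ε ^ 4) * (1 + (ε * q.1) ^ 2)⁻¹) * ((1 + |q.2|) ^ 4)⁻¹ := by
        refine norm_integral_le_of_norm_le hint ?_
        filter_upwards with q
        rw [norm_character_mul]
        refine (hG _ _ _).trans ?_
        have h1 : |τ - a * q.1| ≤ ε * (1 + |q.1|) := by
          calc |τ - a * q.1| ≤ |τ| + |a * q.1| := abs_sub _ _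
            _ = |τ| + |a| * |q.1| := by rw [abs_mul]
            _ ≤ ε + ε * |q.1| := by gcongr
            _ = _ := by ring
        have h2 := min_pow_four_mul_le hε h1
        calc _ = K * (min ((τ - a * q.1) ^ 4) (1 + (τ - a * q.1) ^ 2)⁻¹ * ((1 + |q.1|) ^ 4)⁻¹) *
                ((1 + |q.2|) ^ 4)⁻¹ := by ring
          _ ≤ K * (2 * ε ^ 4 * (1 + (ε * q.1) ^ 2)⁻¹) * ((1 + |q.2|) ^ 4)⁻¹ := by gcongr
          _ = _ := by ring
    _ = (K * (2 * ε ^ 4) * (Real.pi / ε)) * ∫ t : ℝ, ((1 + |t|) ^ 4)⁻¹ := by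
        rw [Measure.volume_eq_prod, integral_prod_mul (fun x : ℝ => K * (2 * ε ^ 4) * (1 + (ε * x) ^ 2)⁻¹)
          (fun x : ℝ => ((1 + |x|) ^ 4)⁻¹), integral_const_mul, integral_inv_one_add_mul_sq hε]
    _ ≤ (K * (2 * ε ^ 4) * (4 / ε)) * 4 := by
        gcongr
        · exact Real.pi_le_four
        · exact integral_inv_one_add_abs_pow_four_le
    _ = 32 * K * ε ^ 3 := by field_simp; ring

/-- If `𝓕⁻ G` vanishes for `|x₀| > R`, its zeroth and first moments along the lines
`t ↦ (t, v + a t, s)` are small when the slope `a` is small. -/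
lemma FourierDecay.line_moments {i : Fin 2} {K R : ℝ} {G : E3 → ℂ} (hG : FourierDecay i K G)
    (hc : Continuous G) (hR : 0 ≤ R) (hη : ∀ x : E3, R < |x 0| → 𝓕⁻ G x = 0) :
    ∃ C : ℝ, 0 ≤ C ∧ ∀ ε a v s : ℝ, 0 < ε → ε ≤ 1 → |a| ≤ ε →
      ‖∫ t, 𝓕⁻ G (axisPoint i t (v + a * t) s)‖ ≤ C * ε ^ 3 ∧
      ‖∫ t : ℝ, (t : ℂ) * 𝓕⁻ G (axisPoint i t (v + a * t) s)‖ ≤ C * ε := by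
  have hK := hG.nonneg
  have hi := hG.integrable hc
  obtain ⟨N, hN0, hN⟩ : ∃ N : ℝ, 0 ≤ N ∧ ∀ x, ‖𝓕⁻ G x‖ ≤ N := by
    refine ⟨∫ x, ‖G x‖, integral_nonneg fun _ => norm_nonneg _, fun x => ?_⟩
    rw [Real.fourierInv_eq]
    refine (norm_integral_le_integral_norm _).trans (le_of_eq ?_)
    simp
  have hηc : Continuous (𝓕⁻ G) := by
    have : 𝓕⁻ G = fun x => 𝓕 G (-x) := by
      ext x; exact Real.fourierInv_eq_fourier_neg G x
    rw [this]
    have h := VectorFourier.fourierIntegral_continuous (e := 𝐞) Real.continuous_fourierChar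
      (L := innerₗ E3) (by exact continuous_inner) hi
    exact h.comp continuous_neg
  have hpi := Real.pi_pos
  refine ⟨64 * K + 24 * Real.pi * N * R ^ 3 * Real.pi + 1, by positivity, ?_⟩
  intro ε a v s hε hε1 ha
  set u : ℝ → ℂ := fun t => 𝓕⁻ G (axisPoint i t (v + a * t) s) with hu
  set Φ := planeTransform i G a v s with hΦ
  have huΦ : u = 𝓕⁻ Φ := by
    ext t; exact fourierInv_line_eq hi a v s t
  have huc : Continuous u :=
    hηc.comp ((continuous_axisPoint i).comp (f := fun t : ℝ => (t, v + a * t, s)) (by fun_prop))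
  have hu0 : ∀ t, R < |t| → u t = 0 := fun t ht =>
    hη _ (by rwa [axisPoint_zero_coord])
  have hsupp : HasCompactSupport u := by
    refine HasCompactSupport.intro (isCompact_Icc (a := -R) (b := R)) fun t ht => hu0 t ?_
    by_contra! h
    exact ht (abs_le.1 h)
  have hui : Integrable u := huc.integrable_of_hasCompactSupport hsupp
  have hΦc : Continuous Φ := hG.continuous_planeTransform hc a v s
  have hΦi : Integrable Φ := by
    exact (integrable_planeTransform_integrand (i := i) hi a v s).integral_prod_right
  -- `𝓕 Φ` is the reflection of the compactly supported `u`. This integrability lets one-dimensional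
  -- inversion return `Φ` as the transform of `u`.
  have hFΦ : Integrable (𝓕 Φ) := by
    have : 𝓕 Φ = fun w => u (-w) := by
      ext w; rw [huΦ, Real.fourierInv_eq_fourier_neg, neg_neg]
    rw [this]; exact hui.comp_neg
  have hFu : 𝓕 u = Φ := by
    rw [huΦ]; exact hΦc.fourier_fourierInv_eq hΦi hFΦ
  have hΦle : ∀ τ : ℝ, |τ| ≤ ε → ‖Φ τ‖ ≤ 32 * K * ε ^ 3 := fun τ hτ =>
    hG.norm_planeTransform_le hε ha hτ v s
  have h0 : ∫ t, u t = Φ 0 := by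
    rw [← hFu, Real.fourier_real_eq]; simp
  have hε3 : ε ^ 3 ≤ ε ^ 2 := pow_le_pow_of_le_one hε.le hε1 (by norm_num)
  constructor
  · rw [h0]
    refine (hΦle 0 (by simpa using hε.le)).trans ?_
    gcongr
    have : 0 ≤ 24 * Real.pi * N * R ^ 3 * Real.pi := by positivity
    linarith
  · have h1 : ∫ t : ℝ, (Complex.exp (↑(-2 * Real.pi * t * ε) * Complex.I)) * u t = Φ ε := by
      rw [← hFu, Real.fourier_real_eq_integral_exp_smul]; rfl
    have hti : Integrable fun t : ℝ => (t : ℂ) * u t :=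
      (Complex.continuous_ofReal.mul huc).integrable_of_hasCompactSupport hsupp.mul_left
    have hei : Integrable fun t : ℝ => Complex.exp (↑(-2 * Real.pi * t * ε) * Complex.I) * u t :=
      Continuous.integrable_of_hasCompactSupport (by fun_prop) hsupp.mul_left
    -- The first moment comes from a difference quotient of `Φ` with step `ε`: both values of `Φ`
    -- are `O(ε³)`, and replacing the exponential by its linear part costs `O(ε²)`. Dividing by `ε`
    -- leaves `O(ε)`.
    have h2 : (2 * Real.pi * ε * Complex.I : ℂ) * ∫ t : ℝ, (t : ℂ) * u t = (Φ 0 - Φ ε) +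
        ∫ t : ℝ, (Complex.exp (↑(-2 * Real.pi * t * ε) * Complex.I) - 1
          - ↑(-2 * Real.pi * t * ε) * Complex.I) * u t := by
      rw [← h0, ← h1, ← integral_const_mul, ← integral_sub hui hei, ← integral_add]
      · refine integral_congr_ae (Eventually.of_forall fun t => ?_); simp only; push_cast; ring
      · exact hui.sub hei
      · refine Continuous.integrable_of_hasCompactSupport (by fun_prop) hsupp.mul_left
    have h3 : ‖∫ t : ℝ, (Complex.exp (↑(-2 * Real.pi * t * ε) * Complex.I) - 1
          - ↑(-2 * Real.pi * t * ε) * Complex.I) * u t‖ ≤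
          (3 * (2 * Real.pi * R * ε) ^ 2 * N) * (2 * R) := by
      have h4 : ∫ t : ℝ, (Complex.exp (↑(-2 * Real.pi * t * ε) * Complex.I) - 1
          - ↑(-2 * Real.pi * t * ε) * Complex.I) * u t =
          ∫ t in Set.Icc (-R) R, (Complex.exp (↑(-2 * Real.pi * t * ε) * Complex.I) - 1
          - ↑(-2 * Real.pi * t * ε) * Complex.I) * u t := by
        rw [setIntegral_eq_integral_of_forall_compl_eq_zero]
        intro t ht
        rw [hu0 t, mul_zero]
        by_contra! h
        exact ht (abs_le.1 h)
      rw [h4]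
      refine (norm_setIntegral_le_of_norm_le_const (C := 3 * (2 * Real.pi * R * ε) ^ 2 * N)
        (by simp) ?_).trans ?_
      · intro t ht
        rw [norm_mul]
        have ht' : |t| ≤ R := abs_le.2 ht
        gcongr
        · refine (norm_exp_I_sub_le _).trans ?_
          rw [← sq_abs, abs_mul, abs_mul, abs_mul, abs_neg, abs_of_pos Real.pi_pos, abs_of_pos hε, abs_two]
          gcongr
        · exact hN _
      · simp [Measure.real, two_mul, hR]
    have h5 : ‖(2 * Real.pi * ε * Complex.I : ℂ)‖ = 2 * Real.pi * ε := by
      simp [abs_of_pos hε, abs_of_pos Real.pi_pos]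
    have h6 : 2 * Real.pi * ε * ‖∫ t : ℝ, (t : ℂ) * u t‖ ≤
        32 * K * ε ^ 3 + 32 * K * ε ^ 3 + (3 * (2 * Real.pi * R * ε) ^ 2 * N) * (2 * R) := by
      rw [← h5, ← norm_mul, h2]
      refine (norm_add_le _ _).trans (add_le_add ((norm_sub_le _ _).trans ?_) h3)
      exact add_le_add (hΦle 0 (by simpa using hε.le)) (hΦle ε (by rw [abs_of_pos hε]))
    have h7 : 2 * Real.pi * ε * ‖∫ t : ℝ, (t : ℂ) * u t‖ ≤ 2 * Real.pi * ε *
        ((64 * K + 24 * Real.pi * N * R ^ 3 * Real.pi + 1) * ε) := by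
      refine h6.trans ?_
      have hp := Real.pi_gt_three
      have e1 : 32 * K * ε ^ 3 ≤ 32 * K * ε ^ 2 := by gcongr
      have e2 : 64 * K * ε ^ 2 ≤ 2 * Real.pi * (64 * K * ε ^ 2) := by
        have : 0 ≤ 64 * K * ε ^ 2 := by positivity
        nlinarith
      have e3 : 3 * (2 * Real.pi * R * ε) ^ 2 * N * (2 * R) ≤
          2 * Real.pi * ε * (24 * Real.pi * N * R ^ 3 * Real.pi * ε) := by
        have : 0 ≤ (Real.pi ^ 2 * R ^ 3 * ε ^ 2 * N) := by positivity
        nlinarith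
      have e4 : 0 ≤ Real.pi * ε * ε := by positivity
      nlinarith
    exact le_of_mul_le_mul_left h7 (by positivity)

end

noncomputable section

/-! ### Fourier inversion almost everywhere -/

lemma continuous_fourier_of_integrable {f : E3 → ℂ} (hf : Integrable f) : Continuous (𝓕 f) :=
  VectorFourier.fourierIntegral_continuous (e := 𝐞) Real.continuous_fourierChar
      (L := innerₗ E3) (by exact continuous_inner) hf

lemma continuous_fourierInv_of_integrable {f : E3 → ℂ} (hf : Integrable f) :
    Continuous (𝓕⁻ f) := by
  have : 𝓕⁻ f = fun x => 𝓕 f (-x) := by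
    ext x; exact Real.fourierInv_eq_fourier_neg f x
  rw [this]
  exact (continuous_fourier_of_integrable hf).comp continuous_neg

lemma integral_fourier_mul_eq_flip {f g : E3 → ℂ} (hf : Integrable f) (hg : Integrable g) :
    ∫ x, 𝓕 f x * g x = ∫ x, f x * 𝓕 g x := by
  simpa using! VectorFourier.integral_fourierIntegral_smul_eq_flip (L := innerₗ E3)
    Real.continuous_fourierChar continuous_inner hf hg

lemma integral_fourierInv_mul_eq_flip {f g : E3 → ℂ} (hf : Integrable f) (hg : Integrable g) :
    ∫ x, 𝓕⁻ f x * g x = ∫ x, f x * 𝓕⁻ g x := by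
  rw [Real.fourierInv_eq_fourier_comp_neg g, ← integral_fourier_mul_eq_flip hf hg.comp_neg,
    ← integral_neg_eq_self]
  simp_rw [Real.fourierInv_eq_fourier_neg, neg_neg]

/-- The generator need not be continuous, so inversion holds only almost everywhere. It is tested
against smooth compactly supported functions: both transforms are moved to the test function, where
Schwartz inversion applies. -/
lemma fourierInv_fourier_ae_eq {ψ : E3 → ℂ} (hψ : Integrable ψ) (hF : Integrable (𝓕 ψ)) :
    𝓕⁻ (𝓕 ψ) =ᵐ[volume] ψ := by
  refine ae_eq_of_integral_contDiff_smul_eq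
    (continuous_fourierInv_of_integrable hF).locallyIntegrable hψ.locallyIntegrable ?_
  intro g hg hgs
  have hgc : HasCompactSupport (fun x => (g x : ℂ)) := hgs.comp_left Complex.ofReal_zero
  have hgd : ContDiff ℝ ((⊤ : ℕ∞) : WithTop ℕ∞) (fun x => (g x : ℂ)) := Complex.ofRealCLM.contDiff.comp hg
  let S : SchwartzMap E3 ℂ := hgc.toSchwartzMap hgd
  have hS : (S : E3 → ℂ) = fun x => (g x : ℂ) := rfl
  have h1 : ∫ x, 𝓕⁻ (𝓕 ψ) x * S x = ∫ x, 𝓕 ψ x * (𝓕⁻ S) x := by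
    rw [integral_fourierInv_mul_eq_flip hF S.integrable, SchwartzMap.fourierInv_coe]
  have h2 : ∫ x, 𝓕 ψ x * (𝓕⁻ S) x = ∫ x, ψ x * S x := by
    rw [integral_fourier_mul_eq_flip hψ (𝓕⁻ S).integrable, ← SchwartzMap.fourier_coe,
      FourierTransform.fourier_fourierInv_eq]
  have h3 := h1.trans h2
  rw [hS] at h3
  simp_rw [Complex.real_smul]
  simpa [mul_comm] using h3

/-! ### The continuous representative of the generator -/

/-- A continuous, compactly supported function whose zeroth and first moments along the lines
`t ↦ (t, v + a t, s)` are small when the slope `a` is small. -/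
structure IsGenerator (R N : ℝ) (η : E3 → ℂ) : Prop where
  continuous : Continuous η
  norm_le : ∀ x, ‖η x‖ ≤ N
  eq_zero : ∀ x l, R < |x l| → η x = 0
  moment_zero : ∀ (i : Fin 2) (ε a v s : ℝ), 0 < ε → ε ≤ 1 → |a| ≤ ε →
    ‖∫ t, η (axisPoint i t (v + a * t) s)‖ ≤ N * ε ^ 3
  moment_one : ∀ (i : Fin 2) (ε a v s : ℝ), 0 < ε → ε ≤ 1 → |a| ≤ ε →
    ‖∫ t : ℝ, (t : ℂ) * η (axisPoint i t (v + a * t) s)‖ ≤ N * ε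

lemma decayFactor_le {γ : ℝ} (hγ : 4 ≤ γ) (t : ℝ) : decayFactor γ t ≤ (max 1 |t| ^ 4)⁻¹ := by
  have h1 : (1 : ℝ) ≤ max 1 |t| := le_max_left _ _
  calc decayFactor γ t ≤ (max 1 |t|) ^ (-(4 : ℝ)) :=
        Real.rpow_le_rpow_of_exponent_le h1 (by linarith)
    _ = _ := by rw [Real.rpow_neg (by positivity)]; norm_cast

lemma decayFactor_le_inv_pow {γ : ℝ} (hγ : 4 ≤ γ) (t : ℝ) :
    decayFactor γ t ≤ 16 * ((1 + |t|) ^ 4)⁻¹ := by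
  refine (decayFactor_le hγ t).trans ?_
  have h1 : (1 : ℝ) ≤ max 1 |t| := le_max_left _ _
  have h2 : |t| ≤ max 1 |t| := le_max_right _ _
  have h3 : (1 + |t|) ^ 4 ≤ (2 * max 1 |t|) ^ 4 := by
    gcongr; linarith
  rw [mul_pow] at h3
  rw [← div_eq_mul_inv, inv_eq_one_div, div_le_div_iff₀ (by positivity) (by positivity)]
  linarith

/-- Order four at zero and quadratic decay suffice: the target `ε^{α+1}` has exponent at most 3, and
one power of `ε` is lost in the plane integral. -/
lemma min_rpow_mul_decayFactor_le {δ γ : ℝ} (hδ : 8 < δ) (hγ : 4 ≤ γ) (t : ℝ) :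
    min 1 (|t| ^ δ) * decayFactor γ t ≤ 2 * min (t ^ 4) (1 + t ^ 2)⁻¹ := by
  have hd := decayFactor_le hγ t
  have h1 : (1 : ℝ) ≤ max 1 |t| := le_max_left _ _
  have h2 : |t| ≤ max 1 |t| := le_max_right _ _
  have hd0 : 0 ≤ decayFactor γ t := Real.rpow_nonneg (by positivity) _
  have hd1 : decayFactor γ t ≤ 1 := hd.trans (inv_le_one_of_one_le₀ (one_le_pow₀ h1))
  have ht0 := abs_nonneg t
  have hm0 : 0 ≤ min 1 (|t| ^ δ) := le_min zero_le_one (Real.rpow_nonneg ht0 _)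
  have hm1 : min 1 (|t| ^ δ) ≤ t ^ 4 := by
    rw [← Even.pow_abs (by decide)]
    rcases le_total |t| 1 with h | h
    · refine (min_le_right _ _).trans ?_
      rw [← Real.rpow_natCast]
      rcases ht0.eq_or_lt with h0 | h0
      · rw [← h0, Real.zero_rpow (by linarith), Real.zero_rpow (by norm_num)]
      · exact Real.rpow_le_rpow_of_exponent_ge h0 h (by norm_num; linarith)
    · exact (min_le_left _ _).trans (one_le_pow₀ h)
  have hq : (max 1 |t| ^ 4)⁻¹ ≤ 2 * (1 + t ^ 2)⁻¹ := by
    rw [← div_eq_mul_inv, inv_eq_one_div, div_le_div_iff₀ (by positivity) (by positivity), ← sq_abs]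
    have e1 : 1 ≤ max 1 |t| ^ 4 := one_le_pow₀ h1
    have e2 : |t| ^ 2 ≤ max 1 |t| ^ 2 := by gcongr
    have e3 : max 1 |t| ^ 2 ≤ max 1 |t| ^ 4 := pow_le_pow_right₀ h1 (by norm_num)
    linarith
  rw [mul_min_of_nonneg _ _ (by norm_num)]
  refine le_min ?_ ?_
  · calc _ ≤ t ^ 4 * 1 := by gcongr
      _ ≤ _ := by linarith [show 0 ≤ t ^ 4 by positivity]
  · calc _ ≤ 1 * (2 * (1 + t ^ 2)⁻¹) := by
          gcongr
          · exact min_le_left _ _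
          · exact hd.trans hq
      _ = _ := one_mul _

lemma DecayConditions.fourierDecay {ψ : E3 → ℂ} (hψ : DecayConditions ψ) :
    ∃ K, ∀ i, FourierDecay i K (𝓕 ψ) := by
  obtain ⟨K, δ, γ, h, hδ, hγ, -, hK, -⟩ := hψ
  -- `512 = 2 · 16 · 16`: one factor from the first variable, one from each of the others.
  refine ⟨|K| * 512, fun i t v s => ?_⟩
  have hd0 : ∀ x, 0 ≤ decayFactor γ x := fun x => Real.rpow_nonneg (by positivity) _
  have key := hK (axisPoint i t v s)
  have hm0 : 0 ≤ min 1 (|t| ^ δ) := le_min zero_le_one (Real.rpow_nonneg (abs_nonneg t) _)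
  have hprod : decayFactor γ (axisPoint i t v s 1) * decayFactor γ (axisPoint i t v s 2) =
      decayFactor γ v * decayFactor γ s := by
    have h1 := axisPoint_succ_coord i t v s
    have h2 := axisPoint_rev_coord i t v s
    fin_cases i
    · simp only [Fin.zero_eta, Fin.succ_zero_eq_one] at h1
      have h2 : axisPoint 0 t v s 2 = s := h2
      simp [h1, h2]
    · have h1 : axisPoint 1 t v s 2 = v := h1
      have h2 : axisPoint 1 t v s 1 = s := h2
      simp [h1, h2, mul_comm]
  rw [mul_assoc, hprod, axisPoint_zero_coord] at key
  calc ‖𝓕 ψ (axisPoint i t v s)‖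
      ≤ K * min 1 (|t| ^ δ) * decayFactor γ t * (decayFactor γ v * decayFactor γ s) := key
    _ ≤ |K| * (min 1 (|t| ^ δ) * decayFactor γ t) * (decayFactor γ v * decayFactor γ s) := by
        rw [mul_assoc K]
        gcongr
        · exact mul_nonneg (hd0 _) (hd0 _)
        · exact mul_nonneg hm0 (hd0 _)
        · exact le_abs_self K
    _ ≤ |K| * (2 * min (t ^ 4) (1 + t ^ 2)⁻¹) *
          ((16 * ((1 + |v|) ^ 4)⁻¹) * (16 * ((1 + |s|) ^ 4)⁻¹)) := by
        have hm := min_rpow_mul_decayFactor_le hδ hγ t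
        exact mul_le_mul (mul_le_mul_of_nonneg_left hm (abs_nonneg K))
          (mul_le_mul (decayFactor_le_inv_pow hγ v) (decayFactor_le_inv_pow hγ s) (hd0 s)
            (by positivity))
          (mul_nonneg (hd0 v) (hd0 s)) (mul_nonneg (abs_nonneg K)
            ((mul_nonneg hm0 (hd0 t)).trans hm))
    _ = _ := by ring

/-- Moments along individual lines see null sets, so `ψ` is replaced by its continuous
representative `𝓕⁻ (𝓕 ψ)`. The conjugate is taken because the coefficient pairs `f` with `conj ψ`.
-/
lemma exists_isGenerator {ψ : E3 → ℂ} (hψL2 : MemLp ψ 2 volume) (hψs : HasCompactSupport ψ)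
    (hψ : DecayConditions ψ) :
    ∃ (R N : ℝ) (η : E3 → ℂ), 0 < R ∧ 0 < N ∧ IsGenerator R N η ∧
      (∀ x ∈ tsupport ψ, ∀ l, |x l| ≤ R) ∧ (fun x => conj (ψ x)) =ᵐ[volume] η := by
  obtain ⟨K, hK⟩ := hψ.fourierDecay
  have hψi : Integrable ψ := by
    have hon : IntegrableOn ψ (tsupport ψ) := by
      have : IsFiniteMeasure (volume.restrict (tsupport ψ)) :=
        ⟨by simpa using hψs.measure_lt_top⟩
      exact (hψL2.restrict (tsupport ψ)).integrable (by norm_num)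
    exact (integrableOn_iff_integrable_of_support_subset (subset_tsupport ψ)).1 hon
  have hGc := continuous_fourier_of_integrable hψi
  have hGi := (hK 0).integrable hGc
  obtain ⟨R, hR⟩ := hψs.isBounded.subset_closedBall (0 : E3)
  have hcoord : ∀ x ∈ tsupport ψ, ∀ l, |x l| ≤ max R 1 := fun x hx l =>
    (PiLp.norm_apply_le x l).trans ((mem_closedBall_zero_iff.1 (hR hx)).trans (le_max_left _ _))
  have hR1 : 0 < max R 1 := lt_max_of_lt_right one_pos
  set ψ' := 𝓕⁻ (𝓕 ψ) with hψ'
  have hc : Continuous ψ' := continuous_fourierInv_of_integrable hGi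
  have hae : ψ' =ᵐ[volume] ψ := fourierInv_fourier_ae_eq hψi hGi
  have hzero : ∀ x l, max R 1 < |x l| → ψ' x = 0 := by
    intro x l hx
    have hmem : x ∈ (tsupport ψ)ᶜ := fun h => absurd (hcoord x h l) (not_le.2 hx)
    -- A continuous function vanishing almost everywhere on an open set vanishes on all of it.
    have : Set.EqOn ψ' (fun _ => 0) (tsupport ψ)ᶜ := by
      refine Measure.eqOn_open_of_ae_eq (μ := volume) ?_
        (isClosed_tsupport ψ).isOpen_compl hc.continuousOn continuousOn_const
      rw [Filter.EventuallyEq, ae_restrict_iff' (isClosed_tsupport ψ).isOpen_compl.measurableSet]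
      filter_upwards [hae] with y hy hy'
      rw [hy, image_eq_zero_of_notMem_tsupport hy']
    exact this hmem
  obtain ⟨N, hN⟩ : ∃ N : ℝ, ∀ x, ‖ψ' x‖ ≤ N := by
    refine ⟨∫ x, ‖𝓕 ψ x‖, fun x => ?_⟩
    rw [hψ', Real.fourierInv_eq]
    refine (norm_integral_le_integral_norm _).trans (le_of_eq ?_)
    simp
  choose C hC0 hC using fun i => (hK i).line_moments hGc hR1.le (fun x => hzero x 0)
  set N' := max (max N 1) (max (C 0) (C 1)) with hN'
  have hCN : ∀ i, C i ≤ N' := by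
    intro i
    fin_cases i
    · exact (le_max_left _ _).trans (le_max_right _ _)
    · exact (le_max_right _ _).trans (le_max_right _ _)
  refine ⟨max R 1, N', fun x => conj (ψ' x), hR1,
    one_pos.trans_le ((le_max_right _ _).trans (le_max_left _ _)), ⟨?_, ?_, ?_, ?_, ?_⟩, hcoord, ?_⟩
  · exact Complex.continuous_conj.comp hc
  · intro x
    rw [RCLike.norm_conj]
    exact (hN x).trans ((le_max_left _ _).trans (le_max_left _ _))
  · intro x l hx
    rw [hzero x l hx, map_zero]
  · intro i ε a v s h1 h2 h3
    rw [integral_conj, RCLike.norm_conj]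
    refine (hC i ε a v s h1 h2 h3).1.trans ?_
    gcongr
    exact hCN i
  · intro i ε a v s h1 h2 h3
    have : ∀ t : ℝ, (t : ℂ) * conj (ψ' (axisPoint i t (v + a * t) s)) =
        conj ((t : ℂ) * ψ' (axisPoint i t (v + a * t) s)) := by
      intro t; rw [map_mul, Complex.conj_ofReal]
    simp_rw [this]
    rw [integral_conj, RCLike.norm_conj]
    refine (hC i ε a v s h1 h2 h3).2.trans ?_
    gcongr
    exact hCN i
  · filter_upwards [hae] with x hx
    rw [hx]

end

noncomputable section

/-! ### Hölder continuity of the gradient -/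

/-- `f` is `C¹` with gradient bounded by `M` and `a`-Hölder continuous with constant `M`. -/
structure GradHolder {E F : Type*} [NormedAddCommGroup E] [NormedSpace ℝ E]
    [NormedAddCommGroup F] [NormedSpace ℝ F] (a M : ℝ) (f : E → F) : Prop where
  contDiff : ContDiff ℝ 1 f
  norm_fderiv_le : ∀ x, ‖fderiv ℝ f x‖ ≤ M
  norm_fderiv_sub_le : ∀ x y, ‖fderiv ℝ f x - fderiv ℝ f y‖ ≤ M * ‖x - y‖ ^ a

section

variable {n : ℕ} {F : Type*} [NormedAddCommGroup F] [NormedSpace ℝ F]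

lemma norm_le_of_forall_single {L : EuclideanSpace ℝ (Fin n) →L[ℝ] F} {c : ℝ} (hc : 0 ≤ c)
    (h : ∀ l, ‖L (EuclideanSpace.single l (1 : ℝ))‖ ≤ c) : ‖L‖ ≤ n * c := by
  refine L.opNorm_le_bound (by positivity) fun x => ?_
  have hx : x = ∑ l, x l • EuclideanSpace.single l (1 : ℝ) := by
    ext k
    simp [Finset.sum_apply, Pi.single_apply]
  calc ‖L x‖ = ‖∑ l, x l • L (EuclideanSpace.single l (1 : ℝ))‖ := by
        conv_lhs => rw [hx]
        simp [map_sum]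
    _ ≤ ∑ l : Fin n, ‖x‖ * c := by
        refine (norm_sum_le _ _).trans (Finset.sum_le_sum fun l _ => ?_)
        rw [norm_smul]
        gcongr
        · exact PiLp.norm_apply_le x l
        · exact h l
    _ = n * c * ‖x‖ := by simp; ring

lemma norm_partialDeriv_sub_le {β ν : ℝ} {m : ℕ} (hm : ⌊β⌋₊ = m) (hν : 0 ≤ ν)
    {f : EuclideanSpace ℝ (Fin n) → F} (h : holderSeminorm β f ≤ ENNReal.ofReal ν)
    (i : Fin m → Fin n) (x y : EuclideanSpace ℝ (Fin n)) :
    ‖partialDeriv i f x - partialDeriv i f y‖ ≤ ν * ‖x - y‖ ^ (β - m) := by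
  subst hm
  rcases eq_or_ne x y with rfl | hxy
  · simp only [sub_self, norm_zero]; positivity
  have h1 : ‖partialDeriv i f x - partialDeriv i f y‖ₑ / ‖x - y‖ₑ ^ (β - (⌊β⌋₊ : ℝ)) ≤
      ENNReal.ofReal ν := by
    simp only [holderSeminorm, iSup_le_iff] at h
    exact h i x y
  have hpos : 0 < ‖x - y‖ := norm_sub_pos_iff.2 hxy
  have h2 : ‖x - y‖ₑ ^ (β - (⌊β⌋₊ : ℝ)) = ENNReal.ofReal (‖x - y‖ ^ (β - (⌊β⌋₊ : ℝ))) := by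
    rw [← ofReal_norm, ENNReal.ofReal_rpow_of_pos hpos]
  have h3 : 0 < ‖x - y‖ ^ (β - (⌊β⌋₊ : ℝ)) := Real.rpow_pos_of_pos hpos _
  rw [h2, ENNReal.div_le_iff (by simpa using h3) ENNReal.ofReal_ne_top,
    ← ENNReal.ofReal_mul hν, ← ofReal_norm,
    ENNReal.ofReal_le_ofReal_iff (by positivity)] at h1
  exact h1

lemma norm_partialDeriv_le {β μ : ℝ} {m : ℕ} (hm : m ≤ ⌊β⌋₊) (hμ : 0 ≤ μ)
    {f : EuclideanSpace ℝ (Fin n) → F} (h : holderNorm β f ≤ ENNReal.ofReal μ)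
    (i : Fin m → Fin n) (x : EuclideanSpace ℝ (Fin n)) : ‖partialDeriv i f x‖ ≤ μ := by
  have h1 : ‖partialDeriv i f x‖ₑ ≤ ENNReal.ofReal μ := by
    refine le_trans ?_ (le_self_add.trans h)
    exact le_iSup_of_le m (le_iSup_of_le hm (le_iSup_of_le i (le_iSup_of_le x le_rfl)))
  rwa [← ofReal_norm, ENNReal.ofReal_le_ofReal_iff hμ] at h1

lemma partialDeriv_one (l : Fin n) (f : EuclideanSpace ℝ (Fin n) → F)
    (x : EuclideanSpace ℝ (Fin n)) :
    partialDeriv (fun _ : Fin 1 => l) f x = fderiv ℝ f x (EuclideanSpace.single l (1 : ℝ)) := by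
  simp [partialDeriv, iteratedFDeriv_one_apply]

lemma partialDeriv_two (l l' : Fin n) (f : EuclideanSpace ℝ (Fin n) → F)
    (x : EuclideanSpace ℝ (Fin n)) :
    partialDeriv ![l, l'] f x = fderiv ℝ (fderiv ℝ f) x (EuclideanSpace.single l (1 : ℝ))
      (EuclideanSpace.single l' (1 : ℝ)) := by
  simp [partialDeriv, iteratedFDeriv_two_apply]

lemma norm_fderiv_sub_le_of_partialDeriv_two {c : ℝ} (hc : 0 ≤ c)
    {f : EuclideanSpace ℝ (Fin n) → F} (hf : ContDiff ℝ 2 f)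
    (h : ∀ l l' x, ‖partialDeriv ![l, l'] f x‖ ≤ c) (x y : EuclideanSpace ℝ (Fin n)) :
    ‖fderiv ℝ f x - fderiv ℝ f y‖ ≤ n * (n * c) * ‖x - y‖ := by
  have hd : Differentiable ℝ (fderiv ℝ f) :=
    (hf.fderiv_right (m := 1) (by norm_num)).differentiable (by norm_num)
  refine Convex.norm_image_sub_le_of_norm_fderiv_le (s := Set.univ) (fun z _ => hd z) ?_
    convex_univ trivial trivial
  intro z _
  refine norm_le_of_forall_single (by positivity) fun l => norm_le_of_forall_single hc fun l' => ?_
  rw [← partialDeriv_two]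
  exact h l l' z

lemma natFloor_eq_one {β : ℝ} (h1 : 1 < β) (h2 : β < 2) : ⌊β⌋₊ = 1 := by
  rw [Nat.floor_eq_iff (by linarith)]
  norm_num
  exact ⟨h1.le, h2⟩

/-- For `β < 2` the seminorm is the Hölder constant of the first derivatives. At `β = 2` the integer
part jumps to 2 and the Lipschitz bound for the gradient comes from the sup bound on second
derivatives. -/
lemma gradHolder_of_holderNorm_le {β μ : ℝ} (h1 : 1 < β) (h2 : β ≤ 2) (hμ : 0 ≤ μ)
    {f : EuclideanSpace ℝ (Fin n) → F} (hf : ContDiff ℝ ⌊β⌋₊ f)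
    (h : holderNorm β f ≤ ENNReal.ofReal μ) :
    (∀ x, ‖f x‖ ≤ μ) ∧ GradHolder (β - 1) (n * (n * μ)) f := by
  have hfl : 1 ≤ ⌊β⌋₊ := by rw [Nat.one_le_floor_iff]; exact h1.le
  have hs : holderSeminorm β f ≤ ENNReal.ofReal μ := le_add_self.trans h
  have hn : (n : ℝ) * μ ≤ n * (n * μ) := by
    rcases Nat.eq_zero_or_pos n with rfl | hn
    · simp
    · have : (1 : ℝ) ≤ n := by exact_mod_cast hn
      gcongr
      exact le_mul_of_one_le_left hμ this
  refine ⟨fun x => ?_, hf.of_le (by exact_mod_cast hfl), fun x => ?_, fun x y => ?_⟩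
  · simpa [partialDeriv] using norm_partialDeriv_le (Nat.zero_le _) hμ h Fin.elim0 x
  · refine (norm_le_of_forall_single hμ fun l => ?_).trans hn
    rw [← partialDeriv_one]
    exact norm_partialDeriv_le hfl hμ h _ x
  · rcases h2.lt_or_eq with h2 | rfl
    · have hm := natFloor_eq_one h1 h2
      have : ‖fderiv ℝ f x - fderiv ℝ f y‖ ≤ n * (μ * ‖x - y‖ ^ (β - 1)) := by
        refine norm_le_of_forall_single (by positivity) fun l => ?_
        rw [_root_.sub_apply, ← partialDeriv_one, ← partialDeriv_one]
        simpa using norm_partialDeriv_sub_le hm hμ hs (fun _ => l) x y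
      refine this.trans ?_
      rw [← mul_assoc]
      gcongr
    · have hm : ⌊(2 : ℝ)⌋₊ = 2 := by simp
      rw [hm] at hf
      have := norm_fderiv_sub_le_of_partialDeriv_two hμ (by exact_mod_cast hf)
        (fun l l' x => norm_partialDeriv_le hm.ge hμ h _ x) x y
      convert this using 2
      norm_num

lemma exists_line_deriv_eq_zero {P : ℝ} (hP : 0 < P) {f : EuclideanSpace ℝ (Fin n) → ℝ}
    (hf : Differentiable ℝ f) (x e : EuclideanSpace ℝ (Fin n)) (hper : f (x + P • e) = f x) :
    ∃ t, 0 < t ∧ t < P ∧ fderiv ℝ f (x + t • e) e = 0 := by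
  have hd : ∀ t : ℝ, HasDerivAt (fun t : ℝ => f (x + t • e)) (fderiv ℝ f (x + t • e) e) t := by
    intro t
    have h1 : HasDerivAt (fun t : ℝ => x + t • e) e t := by
      simpa using ((hasDerivAt_id t).smul_const e).const_add x
    exact (hf (x + t • e)).hasFDerivAt.comp_hasDerivAt t h1
  obtain ⟨t, ht, h⟩ := exists_hasDerivAt_eq_zero hP
    (continuous_iff_continuousAt.2 fun t => (hd t).continuousAt).continuousOn
    (by simpa using hper.symm) (fun t _ => hd t)
  exact ⟨t, ht.1, ht.2, h⟩

/-- Only the homogeneous seminorm is controlled, yet the gradient is bounded: by periodicity and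
Rolle each partial derivative vanishes within one period, and its Hölder modulus bounds it from
there. -/
lemma gradHolder_of_periodic {α ν P : ℝ} (h1 : 1 < α) (h2 : α ≤ 2) (hν : 0 ≤ ν) (hP : 0 < P)
    {f : EuclideanSpace ℝ (Fin n) → ℝ} (hf : ContDiff ℝ ⌊α⌋₊ f)
    (h : holderSeminorm α f ≤ ENNReal.ofReal ν)
    (hper : ∀ x l, f (x + P • EuclideanSpace.single l (1 : ℝ)) = f x) :
    GradHolder (α - 1) (n * (n * ν) * (1 + n * P ^ (α - 1))) f := by
  have hfl : 1 ≤ ⌊α⌋₊ := by rw [Nat.one_le_floor_iff]; exact h1.le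
  have hf1 : ContDiff ℝ 1 f := hf.of_le (by exact_mod_cast hfl)
  have hd : Differentiable ℝ f := hf1.differentiable (by norm_num)
  set M : ℝ := n * (n * ν) with hM
  have hM0 : 0 ≤ M := by positivity
  have hn : (n : ℝ) * ν ≤ M := by
    rcases Nat.eq_zero_or_pos n with rfl | hn
    · simp [hM]
    · have : (1 : ℝ) ≤ n := by exact_mod_cast hn
      rw [hM]
      gcongr
      exact le_mul_of_one_le_left hν this
  have hPα : 0 < P ^ (α - 1) := Real.rpow_pos_of_pos hP _
  have key : ∀ x y, ‖fderiv ℝ f x - fderiv ℝ f y‖ ≤ M * ‖x - y‖ ^ (α - 1) := by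
    intro x y
    rcases h2.lt_or_eq with h2 | rfl
    · have hm := natFloor_eq_one h1 h2
      have : ‖fderiv ℝ f x - fderiv ℝ f y‖ ≤ n * (ν * ‖x - y‖ ^ (α - 1)) := by
        refine norm_le_of_forall_single (by positivity) fun l => ?_
        rw [_root_.sub_apply, ← partialDeriv_one, ← partialDeriv_one]
        simpa using norm_partialDeriv_sub_le hm hν h (fun _ => l) x y
      refine this.trans ?_
      rw [← mul_assoc]
      gcongr
    · have hm : ⌊(2 : ℝ)⌋₊ = 2 := by simp
      rw [hm] at hf
      have hf : ContDiff ℝ 2 f := by exact_mod_cast hf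
      have hper' : ∀ x l, fderiv ℝ f (x + P • EuclideanSpace.single l (1 : ℝ)) = fderiv ℝ f x := by
        intro x l
        rw [← fderiv_comp_add_right]
        simp_rw [hper]
      have hb : ∀ l l' x, ‖partialDeriv ![l, l'] f x‖ ≤ ν := by
        intro l l' x
        have hdd : Differentiable ℝ (fderiv ℝ f) :=
          (hf.fderiv_right (m := 1) (by norm_num)).differentiable (by norm_num)
        -- At `α = 2` the seminorm, with exponent 0, bounds the oscillation of the second
        -- derivatives by `ν`. Rolle applied to a periodic first derivative supplies a zero, so the
        -- oscillation bounds the size.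
        obtain ⟨t, -, -, ht⟩ := exists_line_deriv_eq_zero hP
          (f := fun x => fderiv ℝ f x (EuclideanSpace.single l' (1 : ℝ)))
          (fun z => (hdd z).clm_apply (differentiableAt_const _)) x
          (EuclideanSpace.single l (1 : ℝ)) (by rw [hper'])
        rw [fderiv_clm_apply (hdd _) (differentiableAt_const _)] at ht
        have h3 : partialDeriv ![l, l'] f (x + t • EuclideanSpace.single l (1 : ℝ)) = 0 := by
          rw [partialDeriv_two]
          simpa using ht
        have := norm_partialDeriv_sub_le hm hν h ![l, l'] x
          (x + t • EuclideanSpace.single l (1 : ℝ))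
        rw [h3] at this
        simpa using this
      have := norm_fderiv_sub_le_of_partialDeriv_two hν hf hb x y
      convert this using 2
      norm_num
  have hle : M ≤ M * (1 + n * P ^ (α - 1)) :=
    le_mul_of_one_le_right hM0 (by linarith [mul_nonneg n.cast_nonneg hPα.le])
  refine ⟨hf1, fun x => ?_, fun x y => (key x y).trans (by gcongr)⟩
  have : ‖fderiv ℝ f x‖ ≤ n * (M * P ^ (α - 1)) := by
    refine norm_le_of_forall_single (by positivity) fun l => ?_
    obtain ⟨t, ht0, htP, ht⟩ := exists_line_deriv_eq_zero hP hd x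
      (EuclideanSpace.single l (1 : ℝ)) (hper x l)
    set y := x + t • EuclideanSpace.single l (1 : ℝ) with hy
    have h3 : ‖x - y‖ ≤ P := by
      rw [hy]
      simp [norm_smul, abs_of_pos ht0, htP.le]
    calc ‖fderiv ℝ f x (EuclideanSpace.single l (1 : ℝ))‖
        = ‖(fderiv ℝ f x - fderiv ℝ f y) (EuclideanSpace.single l (1 : ℝ))‖ := by
          rw [_root_.sub_apply, ht, sub_zero]
      _ ≤ ‖fderiv ℝ f x - fderiv ℝ f y‖ * ‖EuclideanSpace.single l (1 : ℝ)‖ :=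
          ContinuousLinearMap.le_opNorm _ _
      _ ≤ (M * ‖x - y‖ ^ (α - 1)) * 1 := by
          gcongr
          · exact key x y
          · simp
      _ ≤ M * P ^ (α - 1) := by
          rw [mul_one]
          gcongr
  refine this.trans ?_
  rw [mul_add, mul_one]
  nlinarith

end

end

noncomputable section

/-! ### Spherical coordinates near the equator -/

/-- The spherical angles of a point with positive first coordinate. -/
def sphericalAngles (z : E3) : EuclideanSpace ℝ (Fin 2) :=
  !₂[Real.arctan (z 1 / z 0), Real.arccos (z 2 / ‖z‖)]

lemma norm_sq_eq_sum_three (z : E3) : ‖z‖ ^ 2 = z 0 ^ 2 + z 1 ^ 2 + z 2 ^ 2 := by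
  rw [EuclideanSpace.norm_sq_eq, Fin.sum_univ_three]; simp

lemma sphericalDir_sphericalAngles {z : E3} (hz : 0 < z 0) :
    sphericalDir (sphericalAngles z) = ‖z‖⁻¹ • z := by
  have hn := norm_sq_eq_sum_three z
  have hpos : 0 < ‖z‖ := by
    rw [norm_pos_iff]; rintro rfl; simp at hz
  have hle : |z 2 / ‖z‖| ≤ 1 := by
    rw [abs_div, abs_norm, div_le_one hpos]; exact PiLp.norm_apply_le z 2
  set w := Real.sqrt (z 0 ^ 2 + z 1 ^ 2) with hw
  have hwpos : 0 < w := Real.sqrt_pos.2 (by positivity)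
  have hw2 : w ^ 2 = z 0 ^ 2 + z 1 ^ 2 := Real.sq_sqrt (by positivity)
  have h1 : Real.sqrt (1 + (z 1 / z 0) ^ 2) = w / z 0 := by
    rw [Real.sqrt_eq_iff_mul_self_eq (by positivity) (by positivity)]
    field_simp
    linarith
  have h2 : Real.sqrt (1 - (z 2 / ‖z‖) ^ 2) = w / ‖z‖ := by
    rw [Real.sqrt_eq_iff_mul_self_eq _ (by positivity)]
    · field_simp
      linarith
    · rw [sub_nonneg, sq_le_one_iff_abs_le_one]; exact hle
  have hcos : Real.cos (Real.arctan (z 1 / z 0)) = z 0 / w := by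
    rw [Real.cos_arctan, h1]; field_simp
  have hsin : Real.sin (Real.arctan (z 1 / z 0)) = z 1 / w := by
    rw [Real.sin_arctan, h1]; field_simp
  have hs : Real.sin (Real.arccos (z 2 / ‖z‖)) = w / ‖z‖ := by
    rw [Real.sin_arccos, h2]
  have hc : Real.cos (Real.arccos (z 2 / ‖z‖)) = z 2 / ‖z‖ :=
    Real.cos_arccos (abs_le.1 hle).1 (abs_le.1 hle).2
  ext l
  fin_cases l
  · simp only [sphericalDir, sphericalAngles]
    simp only [PiLp.smul_apply, smul_eq_mul]
    change Real.cos (Real.arctan (z 1 / z 0)) * Real.sin (Real.arccos (z 2 / ‖z‖)) = ‖z‖⁻¹ * z 0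
    rw [hcos, hs]; field_simp
  · change Real.sin (Real.arctan (z 1 / z 0)) * Real.sin (Real.arccos (z 2 / ‖z‖)) = ‖z‖⁻¹ * z 1
    rw [hsin, hs]; field_simp
  · change Real.cos (Real.arccos (z 2 / ‖z‖)) = ‖z‖⁻¹ * z 2
    rw [hc]; field_simp

lemma isOpen_pos_coord : IsOpen {z : E3 | 0 < z 0} :=
  isOpen_lt continuous_const (by fun_prop)

lemma ne_zero_of_pos_coord {z : E3} (hz : 0 < z 0) : z ≠ 0 := by
  rintro rfl; simp at hz

/-- Positivity of the first coordinate keeps away from the poles, where `arccos` is singular, and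
from the jump of `arctan (z 1 / z 0)`. -/
lemma contDiffOn_sphericalAngles : ContDiffOn ℝ 2 sphericalAngles {z : E3 | 0 < z 0} := by
  intro z hz
  have hz : 0 < z 0 := hz
  have hz0 := ne_zero_of_pos_coord hz
  have hpos : 0 < ‖z‖ := norm_pos_iff.2 hz0
  apply ContDiffAt.contDiffWithinAt
  have hco : ∀ l : Fin 3, ContDiffAt ℝ 2 (fun z : E3 => z l) z := fun l =>
    (EuclideanSpace.proj (𝕜 := ℝ) l).contDiff.contDiffAt
  have hnorm : ContDiffAt ℝ 2 (fun z : E3 => ‖z‖) z := contDiffAt_norm ℝ hz0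
  have hlt : (z 2 / ‖z‖) ^ 2 < 1 := by
    rw [div_pow, div_lt_one (by positivity), norm_sq_eq_sum_three]
    nlinarith [sq_nonneg (z 1), pow_pos hz 2]
  have hlt' := abs_lt.1 ((sq_lt_one_iff_abs_lt_one _).1 hlt)
  rw [contDiffAt_euclidean]
  intro l
  fin_cases l
  · change ContDiffAt ℝ 2 (fun z : E3 => Real.arctan (z 1 / z 0)) z
    exact Real.contDiff_arctan.contDiffAt.comp z ((hco 1).div (hco 0) hz.ne')
  · change ContDiffAt ℝ 2 (fun z : E3 => Real.arccos (z 2 / ‖z‖)) z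
    exact (Real.contDiffAt_arccos hlt'.1.ne' hlt'.2.ne).comp (g := Real.arccos) z
      ((hco 2).div hnorm hpos.ne')

lemma sphericalDir_periodic (θ : EuclideanSpace ℝ (Fin 2)) (l : Fin 2) :
    sphericalDir (θ + (2 * Real.pi) • EuclideanSpace.single l (1 : ℝ)) = sphericalDir θ := by
  fin_cases l <;> simp [sphericalDir]

/-! ### Composition of Hölder and smooth functions on a compact convex set -/

lemma exists_norm_bound_of_contDiffOn_zero {E G : Type*} [NormedAddCommGroup E] [NormedSpace ℝ E]
    [NormedAddCommGroup G] [NormedSpace ℝ G] {F : E → G} {U Q : Set E}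
    (hF : ContDiffOn ℝ 0 F U) (hQ : IsCompact Q) (hQU : Q ⊆ U) :
    ∃ L : ℝ, ∀ x ∈ Q, ‖F x‖ ≤ L :=
  hQ.exists_bound_of_continuousOn (hF.continuousOn.mono hQU)

lemma exists_bound_of_contDiffOn {E G : Type*} [NormedAddCommGroup E] [NormedSpace ℝ E]
    [NormedAddCommGroup G] [NormedSpace ℝ G] {F : E → G} {U Q : Set E} (hU : IsOpen U) (hF : ContDiffOn ℝ 2 F U) (hQ : IsCompact Q)
    (hQc : Convex ℝ Q) (hQU : Q ⊆ U) :
    ∃ L : ℝ, 0 ≤ L ∧ (∀ x ∈ Q, ‖fderiv ℝ F x‖ ≤ L) ∧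
      (∀ x ∈ Q, ∀ y ∈ Q, ‖F x - F y‖ ≤ L * ‖x - y‖) ∧
      ∀ x ∈ Q, ∀ y ∈ Q, ‖fderiv ℝ F x - fderiv ℝ F y‖ ≤ L * ‖x - y‖ := by
  have h1 : ContDiffOn ℝ 1 (fderiv ℝ F) U := hF.fderiv_of_isOpen hU (by norm_num)
  have h2 : ContDiffOn ℝ 0 (fderiv ℝ (fderiv ℝ F)) U := h1.fderiv_of_isOpen hU (by norm_num)
  obtain ⟨L1, hL1⟩ := hQ.exists_bound_of_continuousOn (h1.continuousOn.mono hQU)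
  obtain ⟨L2, hL2⟩ := exists_norm_bound_of_contDiffOn_zero h2 hQ hQU
  refine ⟨max 0 (max L1 L2), le_max_left _ _, fun x hx => ?_, fun x hx y hy => ?_,
    fun x hx y hy => ?_⟩
  · exact (hL1 x hx).trans ((le_max_left _ _).trans (le_max_right _ _))
  · refine hQc.norm_image_sub_le_of_norm_fderiv_le (𝕜 := ℝ) (f := F) (fun z hz => ?_) (fun z hz => ?_) hy hx
    · exact (hF.differentiableOn (by norm_num)).differentiableAt (hU.mem_nhds (hQU hz))
    · exact (hL1 z hz).trans ((le_max_left _ _).trans (le_max_right _ _))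
  · refine hQc.norm_image_sub_le_of_norm_fderiv_le (𝕜 := ℝ) (f := fderiv ℝ F) (fun z hz => ?_)
      (fun z hz => ?_) hy hx
    · exact (h1.differentiableOn (by norm_num)).differentiableAt (hU.mem_nhds (hQU hz))
    · exact (hL2 z hz).trans ((le_max_right _ _).trans (le_max_right _ _))

/-- Points with first coordinate at least `r / 2`, in a fixed ball. -/
def chartRegion (r : ℝ) : Set E3 := {z | r / 2 ≤ z 0} ∩ Metric.closedBall 0 2

lemma isCompact_chartRegion (r : ℝ) : IsCompact (chartRegion r) :=
  (isCompact_closedBall 0 2).inter_left (isClosed_le continuous_const (by fun_prop))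

lemma convex_chartRegion (r : ℝ) : Convex ℝ (chartRegion r) := by
  refine Convex.inter ?_ (convex_closedBall 0 2)
  exact convex_halfSpace_ge (f := fun z : E3 => z 0) ⟨fun _ _ => rfl, fun _ _ => rfl⟩ (r / 2)

/-- The constant depends only on `r`, `a`, `M`, not on `g`: the chart has fixed `C²` bounds on a
compact convex region. The restriction `‖x - y‖ ≤ 1` lets Lipschitz terms be absorbed into the
`a`-Hölder bound. -/
lemma exists_chart_bounds {r : ℝ} (hr : 0 < r) (a M : ℝ) (ha0 : 0 ≤ a) (ha1 : a ≤ 1) (hM : 0 ≤ M) :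
    ∃ M' : ℝ, 1 ≤ M' ∧ ∀ g : EuclideanSpace ℝ (Fin 2) → ℝ, GradHolder a M g →
      (∀ x ∈ {z : E3 | 0 < z 0}, DifferentiableAt ℝ (fun z => g (sphericalAngles z) - ‖z‖) x) ∧
      (∀ x ∈ chartRegion r, ‖fderiv ℝ (fun z => g (sphericalAngles z) - ‖z‖) x‖ ≤ M') ∧
      ∀ x ∈ chartRegion r, ∀ y ∈ chartRegion r, ‖x - y‖ ≤ 1 →
        ‖fderiv ℝ (fun z => g (sphericalAngles z) - ‖z‖) x -
          fderiv ℝ (fun z => g (sphericalAngles z) - ‖z‖) y‖ ≤ M' * ‖x - y‖ ^ a := by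
  have hQU : chartRegion r ⊆ {z : E3 | 0 < z 0} := by
    rintro z ⟨hz, -⟩
    have : r / 2 ≤ z 0 := hz
    change 0 < z 0
    linarith
  have hnorm : ContDiffOn ℝ 2 (fun z : E3 => ‖z‖) {z : E3 | 0 < z 0} := fun z hz =>
    (contDiffAt_norm ℝ (ne_zero_of_pos_coord hz)).contDiffWithinAt
  obtain ⟨L, hL0, hL1, hL2, hL3⟩ := exists_bound_of_contDiffOn isOpen_pos_coord
    contDiffOn_sphericalAngles (isCompact_chartRegion r) (convex_chartRegion r) hQU
  obtain ⟨N, hN0, hN1, -, hN3⟩ := exists_bound_of_contDiffOn isOpen_pos_coord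
    hnorm (isCompact_chartRegion r) (convex_chartRegion r) hQU
  refine ⟨1 + (M * L + M * L ^ a * L + N), by
    have : 0 ≤ L ^ a := Real.rpow_nonneg hL0 _
    have : 0 ≤ M * L + M * L ^ a * L + N := by positivity
    linarith, fun g hg => ?_⟩
  have hdA : ∀ x ∈ {z : E3 | 0 < z 0}, DifferentiableAt ℝ sphericalAngles x := fun x hx =>
    (contDiffOn_sphericalAngles.differentiableOn (by norm_num)).differentiableAt
      (isOpen_pos_coord.mem_nhds hx)
  have hdN : ∀ x ∈ {z : E3 | 0 < z 0}, DifferentiableAt ℝ (fun z : E3 => ‖z‖) x := fun x hx =>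
    (hnorm.differentiableOn (by norm_num)).differentiableAt (isOpen_pos_coord.mem_nhds hx)
  have hdg : Differentiable ℝ g := hg.contDiff.differentiable (by norm_num)
  have hfd : ∀ x ∈ {z : E3 | 0 < z 0}, fderiv ℝ (fun z => g (sphericalAngles z) - ‖z‖) x =
      (fderiv ℝ g (sphericalAngles x)).comp (fderiv ℝ sphericalAngles x) -
        fderiv ℝ (fun z : E3 => ‖z‖) x := by
    intro x hx
    rw [fderiv_fun_sub (by exact (hdg _).comp x (hdA x hx)) (hdN x hx)]
    congr 1
    exact fderiv_comp x (hdg _) (hdA x hx)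
  have hLa : 0 ≤ L ^ a := Real.rpow_nonneg hL0 _
  refine ⟨fun x hx => ((hdg _).comp x (hdA x hx)).sub (hdN x hx), fun x hx => ?_,
    fun x hx y hy hxy => ?_⟩
  · rw [hfd x (hQU hx)]
    calc _ ≤ ‖fderiv ℝ g (sphericalAngles x)‖ * ‖fderiv ℝ sphericalAngles x‖ +
          ‖fderiv ℝ (fun z : E3 => ‖z‖) x‖ :=
          (norm_sub_le _ _).trans (by gcongr; exact ContinuousLinearMap.opNorm_comp_le _ _)
      _ ≤ M * L + N := by
          gcongr
          · exact hg.norm_fderiv_le _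
          · exact hL1 x hx
          · exact hN1 x hx
      _ ≤ _ := by
          have : 0 ≤ M * L ^ a * L := by positivity
          linarith
  · rw [hfd x (hQU hx), hfd y (hQU hy)]
    have hd0 : 0 ≤ ‖x - y‖ := norm_nonneg _
    have hd : ‖x - y‖ ≤ ‖x - y‖ ^ a := Real.self_le_rpow_of_le_one hd0 hxy ha1
    set A := fderiv ℝ sphericalAngles
    set g' := fderiv ℝ g
    have e : (g' (sphericalAngles x)).comp (A x) - fderiv ℝ (fun z : E3 => ‖z‖) x -
        ((g' (sphericalAngles y)).comp (A y) - fderiv ℝ (fun z : E3 => ‖z‖) y) =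
        (g' (sphericalAngles x)).comp (A x - A y) +
        (g' (sphericalAngles x) - g' (sphericalAngles y)).comp (A y) -
        (fderiv ℝ (fun z : E3 => ‖z‖) x - fderiv ℝ (fun z : E3 => ‖z‖) y) := by
      rw [ContinuousLinearMap.comp_sub, ContinuousLinearMap.sub_comp]
      abel
    rw [e]
    have hA : ‖sphericalAngles x - sphericalAngles y‖ ^ a ≤ L ^ a * ‖x - y‖ ^ a := by
      rw [← Real.mul_rpow hL0 hd0]
      exact Real.rpow_le_rpow (norm_nonneg _) (hL2 x hx y hy) ha0
    calc _ ≤ ‖g' (sphericalAngles x)‖ * ‖A x - A y‖ +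
          ‖g' (sphericalAngles x) - g' (sphericalAngles y)‖ * ‖A y‖ +
          ‖fderiv ℝ (fun z : E3 => ‖z‖) x - fderiv ℝ (fun z : E3 => ‖z‖) y‖ := by
          refine (norm_sub_le _ _).trans ?_
          gcongr
          refine (norm_add_le _ _).trans ?_
          gcongr <;> exact ContinuousLinearMap.opNorm_comp_le _ _
      _ ≤ M * (L * ‖x - y‖) + (M * (L ^ a * ‖x - y‖ ^ a)) * L + N * ‖x - y‖ := by
          gcongr
          · exact hg.norm_fderiv_le _
          · exact hL3 x hx y hy
          · exact (hg.norm_fderiv_sub_le _ _).trans (by gcongr)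
          · exact hL1 y hy
          · exact hN3 x hx y hy
      _ ≤ M * (L * ‖x - y‖ ^ a) + (M * (L ^ a * ‖x - y‖ ^ a)) * L + N * ‖x - y‖ ^ a := by
          gcongr
      _ ≤ _ := by
          have : 0 ≤ ‖x - y‖ ^ a := Real.rpow_nonneg hd0 _
          linarith

end

noncomputable section

/-! ### A defining function for star-shaped bodies -/

/-- The radius function in the direction of `x` minus the distance of `x` to the centre. -/
def radialDefect (x₀ : E3) (ρ : E3 → ℝ) (x : E3) : ℝ :=
  ρ (‖x - x₀‖⁻¹ • (x - x₀)) - ‖x - x₀‖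

/-- The reflection in the bisecting plane of two vectors of equal length exchanges them. It provides
spherical coordinates in which a given point lies on the equator. -/
lemma exists_isometry_single_zero (w : E3) :
    ∃ O : E3 ≃ₗᵢ[ℝ] E3, O.symm w = ‖w‖ • EuclideanSpace.single 0 (1 : ℝ) := by
  set e : E3 := ‖w‖ • EuclideanSpace.single 0 (1 : ℝ) with he
  have hn : ‖e‖ = ‖w‖ := by simp [he, norm_smul]
  refine ⟨((ℝ ∙ (e - w))ᗮ).reflection, ?_⟩
  rw [LinearIsometryEquiv.symm_apply_eq]
  exact (Submodule.reflection_sub hn).symm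

lemma norm_inv_norm_smul {w : E3} (hw : w ≠ 0) : ‖‖w‖⁻¹ • w‖ = 1 := by
  rw [norm_smul, norm_inv, norm_norm, inv_mul_cancel₀ (norm_ne_zero_iff.2 hw)]

lemma mem_starBody_iff {x₀ : E3} {ρ : E3 → ℝ} {x : E3} (hx : x ≠ x₀) :
    x ∈ starBody x₀ ρ ↔ 0 ≤ radialDefect x₀ ρ x := by
  have hw : x - x₀ ≠ 0 := sub_ne_zero.2 hx
  constructor
  · rintro ⟨u, hu, t, ht0, htρ, rfl⟩
    rw [add_sub_cancel_left] at hw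
    have ht : 0 < t := ht0.lt_of_ne (by rintro rfl; simp at hw)
    rw [radialDefect, add_sub_cancel_left, norm_smul, hu, mul_one, Real.norm_of_nonneg ht0,
      smul_smul, inv_mul_cancel₀ ht.ne', one_smul]
    linarith
  · intro h
    refine ⟨‖x - x₀‖⁻¹ • (x - x₀), norm_inv_norm_smul hw, ‖x - x₀‖, norm_nonneg _, ?_, ?_⟩
    · rw [radialDefect] at h; linarith
    · rw [smul_smul, mul_inv_cancel₀ (norm_ne_zero_iff.2 hw), one_smul]; abel

lemma radialDefect_eq_chart {x₀ : E3} {ρ : E3 → ℝ} (O : E3 ≃ₗᵢ[ℝ] E3) {x : E3}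
    (hx : 0 < (O.symm (x - x₀)) 0) :
    radialDefect x₀ ρ x =
      ρ (O (sphericalDir (sphericalAngles (O.symm (x - x₀))))) - ‖O.symm (x - x₀)‖ := by
  rw [sphericalDir_sphericalAngles hx, radialDefect, map_smul, LinearIsometryEquiv.apply_symm_apply,
    LinearIsometryEquiv.norm_map]

section

variable {x₀ : E3} {ρ : E3 → ℝ} {a M r : ℝ}

lemma mem_starBody_of_norm_sub_le (hr : 0 < r) (hρ : ∀ u, ‖u‖ = 1 → r ≤ ρ u) {x : E3}
    (hx : ‖x - x₀‖ ≤ r) : x ∈ starBody x₀ ρ := by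
  rcases eq_or_ne x x₀ with rfl | h
  · have h1 : ‖(EuclideanSpace.single 0 (1 : ℝ) : E3)‖ = 1 := by simp
    exact ⟨_, h1, 0, le_rfl, hr.le.trans (hρ _ h1), by simp⟩
  · rw [mem_starBody_iff h, radialDefect]
    linarith [hρ _ (norm_inv_norm_smul (sub_ne_zero.2 h))]

lemma hasFDerivAt_radialDefect (hg : ∀ O : E3 ≃ₗᵢ[ℝ] E3,
      GradHolder a M (fun θ => ρ (O (sphericalDir θ)))) (O : E3 ≃ₗᵢ[ℝ] E3) {x : E3}
    (hx : 0 < (O.symm (x - x₀)) 0) :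
    HasFDerivAt (radialDefect x₀ ρ)
      ((fderiv ℝ (fun z => ρ (O (sphericalDir (sphericalAngles z))) - ‖z‖) (O.symm (x - x₀))).comp
        (O.symm.toContinuousLinearEquiv : E3 →L[ℝ] E3)) x := by
  have hdg : Differentiable ℝ (fun θ => ρ (O (sphericalDir θ))) :=
    (hg O).contDiff.differentiable (by norm_num)
  have hA : DifferentiableAt ℝ sphericalAngles (O.symm (x - x₀)) :=
    (contDiffOn_sphericalAngles.differentiableOn (by norm_num)).differentiableAt
      (isOpen_pos_coord.mem_nhds hx)
  have hN : DifferentiableAt ℝ (fun z : E3 => ‖z‖) (O.symm (x - x₀)) :=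
    (contDiffAt_norm ℝ (n := 1) (ne_zero_of_pos_coord hx)).differentiableAt (by norm_num)
  have hd : DifferentiableAt ℝ (fun z => ρ (O (sphericalDir (sphericalAngles z))) - ‖z‖)
      (O.symm (x - x₀)) := ((hdg _).comp _ hA).sub hN
  have hl : HasFDerivAt (fun x => O.symm (x - x₀))
      (O.symm.toContinuousLinearEquiv : E3 →L[ℝ] E3) x := by
    have h1 : HasFDerivAt (fun z => O.symm z) (O.symm.toContinuousLinearEquiv : E3 →L[ℝ] E3)
        (x - x₀) := O.symm.toContinuousLinearEquiv.hasFDerivAt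
    exact h1.comp x ((hasFDerivAt_id x).sub_const x₀)
  refine (hd.hasFDerivAt.comp x hl).congr_of_eventuallyEq ?_
  have hopen : IsOpen {x : E3 | 0 < (O.symm (x - x₀)) 0} :=
    isOpen_pos_coord.preimage (O.symm.continuous.comp (continuous_sub_right x₀))
  filter_upwards [hopen.mem_nhds hx] with y hy
  exact radialDefect_eq_chart O hy

lemma exists_chart_at {x : E3} (hx : x ≠ x₀) : ∃ O : E3 ≃ₗᵢ[ℝ] E3,
    O.symm (x - x₀) = ‖x - x₀‖ • EuclideanSpace.single 0 (1 : ℝ) ∧ 0 < (O.symm (x - x₀)) 0 := by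
  obtain ⟨O, hO⟩ := exists_isometry_single_zero (x - x₀)
  refine ⟨O, hO, ?_⟩
  rw [hO]
  simpa using sub_ne_zero.2 hx

lemma continuousAt_radialDefect (hg : ∀ O : E3 ≃ₗᵢ[ℝ] E3,
      GradHolder a M (fun θ => ρ (O (sphericalDir θ)))) {x : E3} (hx : x ≠ x₀) :
    ContinuousAt (radialDefect x₀ ρ) x := by
  obtain ⟨O, -, hO⟩ := exists_chart_at hx
  exact (hasFDerivAt_radialDefect hg O hO).continuousAt

lemma isClosed_starBody (hr : 0 < r) (hρ : ∀ u, ‖u‖ = 1 → r ≤ ρ u)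
    (hg : ∀ O : E3 ≃ₗᵢ[ℝ] E3, GradHolder a M (fun θ => ρ (O (sphericalDir θ)))) :
    IsClosed (starBody x₀ ρ) := by
  rw [← isOpen_compl_iff, isOpen_iff_mem_nhds]
  intro x hx
  have hne : x ≠ x₀ := by
    rintro rfl
    exact hx (mem_starBody_of_norm_sub_le hr hρ (by simpa using hr.le))
  have hlt : radialDefect x₀ ρ x < 0 := by
    rw [Set.mem_compl_iff, mem_starBody_iff hne] at hx
    exact not_le.1 hx
  filter_upwards [(continuousAt_radialDefect hg hne).eventually_lt_const hlt,
    isOpen_ne.mem_nhds hne] with y hy hy'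
  rw [Set.mem_compl_iff, mem_starBody_iff hy']
  exact not_le.2 hy

lemma frontier_starBody (hr : 0 < r) (hρ : ∀ u, ‖u‖ = 1 → r ≤ ρ u)
    (hg : ∀ O : E3 ≃ₗᵢ[ℝ] E3, GradHolder a M (fun θ => ρ (O (sphericalDir θ)))) {x : E3}
    (hx : x ∈ frontier (starBody x₀ ρ)) : x ≠ x₀ ∧ radialDefect x₀ ρ x = 0 := by
  have hcl := isClosed_starBody (x₀ := x₀) hr hρ hg
  rw [hcl.frontier_eq] at hx
  have hne : x ≠ x₀ := by
    rintro rfl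
    refine hx.2 (mem_interior_iff_mem_nhds.2 ?_)
    filter_upwards [Metric.closedBall_mem_nhds x hr] with y hy
    exact mem_starBody_of_norm_sub_le hr hρ (by simpa [dist_eq_norm] using hy)
  refine ⟨hne, le_antisymm ?_ ((mem_starBody_iff hne).1 hx.1)⟩
  by_contra! hpos
  refine hx.2 (mem_interior_iff_mem_nhds.2 ?_)
  filter_upwards [(continuousAt_radialDefect hg hne).eventually_const_lt hpos,
    isOpen_ne.mem_nhds hne] with y hy hy'
  exact (mem_starBody_iff hy').2 hy.le

lemma radialDefect_add_smul {w : E3} {t : ℝ} (ht : 0 < t) :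
    radialDefect x₀ ρ (x₀ + t • w) = ρ (‖w‖⁻¹ • w) - t * ‖w‖ := by
  rw [radialDefect, add_sub_cancel_left, norm_smul, Real.norm_of_nonneg ht.le, smul_smul, mul_inv,
    mul_right_comm, inv_mul_cancel₀ ht.ne', one_mul]

lemma mem_frontier_starBody (hr : 0 < r) (hρ : ∀ u, ‖u‖ = 1 → r ≤ ρ u)
    (hg : ∀ O : E3 ≃ₗᵢ[ℝ] E3, GradHolder a M (fun θ => ρ (O (sphericalDir θ)))) {w : E3}
    (hw : w ≠ 0) :
    x₀ + (ρ (‖w‖⁻¹ • w) / ‖w‖) • w ∈ frontier (starBody x₀ ρ) := by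
  have hcl := isClosed_starBody (x₀ := x₀) hr hρ hg
  have hn : 0 < ‖w‖ := norm_pos_iff.2 hw
  have hρ0 : 0 < ρ (‖w‖⁻¹ • w) := hr.trans_le (hρ _ (norm_inv_norm_smul hw))
  set s := ρ (‖w‖⁻¹ • w) / ‖w‖ with hs
  have hs0 : 0 < s := by positivity
  have hne : ∀ t : ℝ, 0 < t → x₀ + t • w ≠ x₀ := by
    intro t ht h
    rw [add_eq_left, smul_eq_zero] at h
    rcases h with h | h
    · exact ht.ne' h
    · exact hw h
  rw [hcl.frontier_eq]
  refine ⟨?_, fun hint => ?_⟩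
  · rw [mem_starBody_iff (hne s hs0), radialDefect_add_smul hs0, hs]
    field_simp
    simp
  · have hcont : ContinuousAt (fun t : ℝ => x₀ + t • w) s := by fun_prop
    have h1 : ∀ᶠ t in 𝓝 s, x₀ + t • w ∈ starBody x₀ ρ :=
      hcont.eventually (mem_interior_iff_mem_nhds.1 hint)
    have h2 : ∀ᶠ t in 𝓝[>] s, x₀ + t • w ∈ starBody x₀ ρ := h1.filter_mono nhdsWithin_le_nhds
    obtain ⟨t, ht, hts⟩ := (h2.and self_mem_nhdsWithin).exists
    have hts : s < t := hts
    have ht0 := hs0.trans hts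
    rw [mem_starBody_iff (hne t ht0), radialDefect_add_smul ht0] at ht
    rw [hs, div_lt_iff₀ hn] at hts
    linarith

/-- Every vector annihilated by the derivative of the radial defect is orthogonal to the normal of
the tangent plane. -/
lemma inner_eq_zero_of_isTangentPlaneNormal (hr : 0 < r) (hρ : ∀ u, ‖u‖ = 1 → r ≤ ρ u)
    (hg : ∀ O : E3 ≃ₗᵢ[ℝ] E3, GradHolder a M (fun θ => ρ (O (sphericalDir θ)))) {x n τ : E3}
    (hx : x ∈ frontier (starBody x₀ ρ)) {L : E3 →L[ℝ] ℝ} (hL : HasFDerivAt (radialDefect x₀ ρ) L x)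
    (hn : IsTangentPlaneNormal (frontier (starBody x₀ ρ)) x n) (hτ : L τ = 0) :
    inner ℝ τ n = 0 := by
  obtain ⟨hne, h0⟩ := frontier_starBody hr hρ hg hx
  set w := x - x₀ with hw
  have hw0 : w ≠ 0 := sub_ne_zero.2 hne
  have hline : HasDerivAt (fun t : ℝ => x + t • τ) τ 0 := by
    simpa using ((hasDerivAt_id (0 : ℝ)).smul_const τ).const_add x
  have hline' : HasDerivAt (fun t : ℝ => w + t • τ) τ 0 := by
    simpa using ((hasDerivAt_id (0 : ℝ)).smul_const τ).const_add w
  have hφ : HasDerivAt (fun t : ℝ => radialDefect x₀ ρ (x + t • τ)) 0 0 := by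
    have : HasFDerivAt (radialDefect x₀ ρ) L (x + (0 : ℝ) • τ) := by simpa using hL
    exact (this.comp_hasDerivAt (0 : ℝ) hline).congr_deriv hτ
  have hnrm : DifferentiableAt ℝ (fun t : ℝ => ‖w + t • τ‖) 0 :=
    hline'.differentiableAt.norm ℝ (by simpa using hw0)
  have hq : HasDerivAt (fun t : ℝ => radialDefect x₀ ρ (x + t • τ) / ‖w + t • τ‖) 0 0 := by
    exact (hφ.div hnrm.hasDerivAt (by simpa using hw0)).congr_deriv (by simp [h0])
  have hy : HasDerivAt (fun t : ℝ => (w + t • τ) +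
      (radialDefect x₀ ρ (x + t • τ) / ‖w + t • τ‖) • (w + t • τ)) τ 0 := by
    exact (hline'.add (hq.smul hline')).congr_deriv (by simp [h0])
  -- This is the radial projection of `x + t τ` onto the boundary, since `1 + (defect)/‖w + t τ‖`
  -- equals `ρ/‖w + t τ‖`. The defect vanishes to first order along `τ`, so the boundary curve has
  -- velocity `τ` at `t = 0`.
  set y : ℝ → E3 := fun t => x₀ + ((w + t • τ) +
      (radialDefect x₀ ρ (x + t • τ) / ‖w + t • τ‖) • (w + t • τ)) with hydef
  have hyd : HasDerivAt y τ 0 := hy.const_add x₀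
  have hy0 : y 0 = x := by simp [hydef, h0, hw]
  have hne' : ∀ᶠ t in 𝓝 (0 : ℝ), w + t • τ ≠ 0 := by
    have := hline'.continuousAt.eventually_ne (y := (0 : E3)) (by simpa using hw0)
    exact this
  have hmem : ∀ᶠ t in 𝓝 (0 : ℝ), y t ∈ frontier (starBody x₀ ρ) := by
    filter_upwards [hne'] with t ht
    have := mem_frontier_starBody (x₀ := x₀) hr hρ hg ht
    convert this using 1
    have e : x + t • τ - x₀ = w + t • τ := by rw [hw]; abel
    have hn0 : ‖w + t • τ‖ ≠ 0 := norm_ne_zero_iff.2 ht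
    rw [hydef]
    simp only
    rw [radialDefect, e, sub_div, div_self hn0, sub_smul, one_smul]
    abel
  have htend : Tendsto y (𝓝 0) (𝓝[frontier (starBody x₀ ρ)] x) := by
    refine tendsto_nhdsWithin_iff.2 ⟨?_, hmem⟩
    have := hyd.continuousAt.tendsto
    rwa [hy0] at this
  have ho := hn.2.2.comp_tendsto htend
  have hO : (fun t : ℝ => y t - x) =O[𝓝 0] fun t : ℝ => t := by
    have := hyd.differentiableAt.isBigO_sub
    simpa [hy0] using this
  have ho' : (fun t : ℝ => inner ℝ (y t - x) n) =o[𝓝 0] fun t : ℝ => t := ho.trans_isBigO hO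
  have hd1 : HasDerivAt (fun t : ℝ => inner ℝ (y t - x) n) 0 0 := by
    rw [hasDerivAt_iff_isLittleO]
    simpa [hy0] using ho'
  have hd2 : HasDerivAt (fun t : ℝ => inner ℝ (y t - x) n) (inner ℝ τ n) 0 := by
    have := (hyd.sub_const x).inner ℝ (hasDerivAt_const (0 : ℝ) n)
    simpa using this
  exact hd2.unique hd1

end

end

/-! ### Local defining functions of star-shaped bodies with uniform constants -/

noncomputable section

/-- `φ` is a defining function of `B` near the boundary point `x`, with derivative `φ'` that is
bounded and Hölder continuous and does not vanish at `x`. -/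
structure IsDefiningFunction (a M δ : ℝ) (B : Set E3) (x : E3) (φ : E3 → ℝ)
    (φ' : E3 → E3 →L[ℝ] ℝ) : Prop where
  mem_iff : ∀ y ∈ Metric.ball x δ, (y ∈ B ↔ 0 ≤ φ y)
  hasFDerivAt : ∀ y ∈ Metric.ball x δ, HasFDerivAt φ (φ' y) y
  norm_le : ∀ y ∈ Metric.ball x δ, ‖φ' y‖ ≤ M
  norm_sub_le : ∀ y ∈ Metric.ball x δ, ∀ z ∈ Metric.ball x δ,
    ‖φ' y - φ' z‖ ≤ M * ‖y - z‖ ^ a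
  one_le_norm : 1 ≤ ‖φ' x‖
  normal : ∀ n, IsTangentPlaneNormal (frontier B) x n → ∃ c, ∀ h, φ' x h = c * inner ℝ h n

/-- The defining function is `radialDefect`, read in spherical axes chosen so that `x` lies on the
equator. This choice is what makes `M` and the radius `r/2` independent of the body and of the
boundary point. -/
lemma exists_isDefiningFunction {α ν r : ℝ} (h1 : 1 < α) (h2 : α ≤ 2) (hν : 0 ≤ ν) (hr : 0 < r) :
    ∃ M : ℝ, 1 ≤ M ∧ ∀ B ∈ STAR α ν r, IsClosed B ∧ ∀ x ∈ frontier B,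
      ∃ φ φ', IsDefiningFunction (α - 1) M (r / 2) B x φ φ' := by
  set M₀ : ℝ := (2 : ℕ) * ((2 : ℕ) * ν) * (1 + (2 : ℕ) * (2 * Real.pi) ^ (α - 1)) with hM₀
  have hM₀0 : 0 ≤ M₀ := by positivity
  obtain ⟨M, hM1, hM⟩ := exists_chart_bounds hr (α - 1) M₀ (by linarith) (by linarith) hM₀0
  refine ⟨M, hM1, ?_⟩
  rintro B ⟨-, x₀, ρ, rfl, hρr, ⟨ρ₀, hρ₀, hρle⟩, hO⟩
  have hg : ∀ O : E3 ≃ₗᵢ[ℝ] E3, GradHolder (α - 1) M₀ (fun θ => ρ (O (sphericalDir θ))) :=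
    fun O => gradHolder_of_periodic h1 h2 hν (by positivity) (hO O).1 (hO O).2
      (fun θ l => by rw [sphericalDir_periodic])
  refine ⟨isClosed_starBody hr hρr hg, fun x hx => ?_⟩
  obtain ⟨hne, h0⟩ := frontier_starBody hr hρr hg hx
  have hw : x - x₀ ≠ 0 := sub_ne_zero.2 hne
  have hu := norm_inv_norm_smul hw
  have hnx : ‖x - x₀‖ = ρ (‖x - x₀‖⁻¹ • (x - x₀)) := by
    rw [radialDefect] at h0; linarith
  have hrx : r ≤ ‖x - x₀‖ := hnx ▸ hρr _ hu
  have hx1 : ‖x - x₀‖ ≤ 1 := hnx ▸ (hρle _ hu).trans hρ₀.le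
  have hr1 : r ≤ 1 := hrx.trans hx1
  obtain ⟨O, hOx, -⟩ := exists_chart_at hne
  obtain ⟨hd, hb, hh⟩ := hM _ (hg O)
  -- `x` is at distance between `r` and 1 from the centre and `r ≤ 1`; moving by `r/2` keeps the
  -- first coordinate above `r/2` and the norm below 2.
  have hreg : ∀ y ∈ Metric.ball x (r / 2), O.symm (y - x₀) ∈ chartRegion r := by
    intro y hy
    rw [Metric.mem_ball, dist_eq_norm] at hy
    have e : O.symm (y - x₀) = ‖x - x₀‖ • EuclideanSpace.single 0 (1 : ℝ) + O.symm (y - x) := by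
      rw [← hOx, ← map_add]; congr 1; abel
    have hn : ‖O.symm (y - x)‖ < r / 2 := by rwa [LinearIsometryEquiv.norm_map]
    constructor
    · have h3 : |(O.symm (y - x)) 0| ≤ ‖O.symm (y - x)‖ :=
        PiLp.norm_apply_le (O.symm (y - x)) 0
      have h4 := neg_abs_le ((O.symm (y - x)) 0)
      change r / 2 ≤ (O.symm (y - x₀)) 0
      rw [e]
      simp only [PiLp.add_apply, PiLp.smul_apply, PiLp.single_apply, smul_eq_mul]
      simp only [if_true, mul_one]
      linarith
    · rw [mem_closedBall_zero_iff, LinearIsometryEquiv.norm_map]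
      calc ‖y - x₀‖ = ‖(x - x₀) + (y - x)‖ := by congr 1; abel
        _ ≤ ‖x - x₀‖ + ‖y - x‖ := norm_add_le _ _
        _ ≤ 2 := by linarith
  have hpos : ∀ y ∈ Metric.ball x (r / 2), 0 < (O.symm (y - x₀)) 0 := by
    intro y hy
    have : r / 2 ≤ (O.symm (y - x₀)) 0 := (hreg y hy).1
    linarith
  set Φ : E3 → E3 →L[ℝ] ℝ := fun y =>
    (fderiv ℝ (fun z => ρ (O (sphericalDir (sphericalAngles z))) - ‖z‖) (O.symm (y - x₀))).comp
        (O.symm.toContinuousLinearEquiv : E3 →L[ℝ] E3) with hΦ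
  have hOn : ‖(O.symm.toContinuousLinearEquiv : E3 →L[ℝ] E3)‖ ≤ 1 := by
    refine ContinuousLinearMap.opNorm_le_bound _ zero_le_one fun z => ?_
    simp
  have hcomp : ∀ L : E3 →L[ℝ] ℝ,
      ‖L.comp (O.symm.toContinuousLinearEquiv : E3 →L[ℝ] E3)‖ ≤ ‖L‖ := fun L =>
    (L.opNorm_comp_le _).trans (mul_le_of_le_one_right (norm_nonneg _) hOn)
  have hxb : x ∈ Metric.ball x (r / 2) := Metric.mem_ball_self (by linarith)
  have hder : ∀ y ∈ Metric.ball x (r / 2), HasFDerivAt (radialDefect x₀ ρ) (Φ y) y := fun y hy =>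
    hasFDerivAt_radialDefect hg O (hpos y hy)
  -- Along a ray the direction, hence `ρ`, is constant and only the distance varies. This radial
  -- derivative gives the lower bound 1 for `‖Φ x‖`.
  have hrad : Φ x (x - x₀) = -‖x - x₀‖ := by
    have hl : HasDerivAt (fun t : ℝ => x₀ + t • (x - x₀)) (x - x₀) 1 := by
      simpa using ((hasDerivAt_id (1 : ℝ)).smul_const (x - x₀)).const_add x₀
    have hΦx : HasFDerivAt (radialDefect x₀ ρ) (Φ x) (x₀ + (1 : ℝ) • (x - x₀)) := by
      simpa using hder x hxb
    have h3 := hΦx.comp_hasDerivAt (1 : ℝ) hl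
    have h4 : HasDerivAt (fun t : ℝ => ρ (‖x - x₀‖⁻¹ • (x - x₀)) - t * ‖x - x₀‖) (-‖x - x₀‖) 1 := by
      simpa using ((hasDerivAt_id (1 : ℝ)).mul_const ‖x - x₀‖).const_sub
        (ρ (‖x - x₀‖⁻¹ • (x - x₀)))
    refine h3.unique (h4.congr_of_eventuallyEq ?_)
    filter_upwards [lt_mem_nhds (zero_lt_one (α := ℝ))] with t ht
    exact radialDefect_add_smul ht
  refine ⟨radialDefect x₀ ρ, Φ, ?_, hder, ?_, ?_, ?_, ?_⟩
  · intro y hy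
    refine mem_starBody_iff ?_
    rintro rfl
    have := hpos y hy
    simp at this
  · intro y hy
    exact (hcomp _).trans (hb _ (hreg y hy))
  · intro y hy z hz
    have e : ‖O.symm (y - x₀) - O.symm (z - x₀)‖ = ‖y - z‖ := by
      rw [← map_sub, LinearIsometryEquiv.norm_map]; congr 1; abel
    have hyz : ‖y - z‖ ≤ 1 := by
      rw [← dist_eq_norm]
      have := dist_triangle_right y z x
      rw [Metric.mem_ball] at hy hz
      linarith
    have := hh _ (hreg y hy) _ (hreg z hz) (by rwa [e])
    rw [e] at this
    rw [hΦ]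
    simp only
    rw [← ContinuousLinearMap.sub_comp]
    exact (hcomp _).trans this
  · have h3 : ‖x - x₀‖ ≤ ‖Φ x‖ * ‖x - x₀‖ := by
      have := (Φ x).le_opNorm (x - x₀)
      rwa [hrad, norm_neg, norm_norm] at this
    have h4 : 0 < ‖x - x₀‖ := norm_pos_iff.2 hw
    exact le_of_mul_le_mul_right (by linarith) h4
  · intro n hn
    set w := x - x₀
    have hw0 : ‖w‖ ≠ 0 := norm_ne_zero_iff.2 hw
    have key : ∀ h : E3, inner ℝ h n = -(Φ x h / ‖w‖) * inner ℝ w n := by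
      intro h
      -- Correcting `h` radially puts it in the kernel of `Φ x`, hence in the tangent plane; so the
      -- functional `⟨·, n⟩` is a multiple of `Φ x`.
      have h5 : inner ℝ (h + (Φ x h / ‖w‖) • w) n = 0 := by
        refine inner_eq_zero_of_isTangentPlaneNormal hr hρr hg hx (hder x hxb) hn ?_
        rw [map_add, map_smul, hrad, smul_eq_mul]
        field_simp
        ring
      rw [inner_add_left, real_inner_smul_left] at h5
      linarith
    have hwn : inner ℝ w n ≠ 0 := by
      intro h
      have := key n
      rw [h, mul_zero, inner_self_eq_zero] at this
      exact hn.2.1 this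
    refine ⟨-(‖w‖ / inner ℝ w n), fun h => ?_⟩
    rw [key h]
    field_simp

end

noncomputable section

/-! ### Planar slices of the boundary -/

/-- A `C¹` function on a square whose derivative in the second variable is at least `q` and whose
derivative along its zero line varies little is positive above and negative below a line, up to a
small error. -/
lemma exists_line_of_deriv_ge {R q A W M : ℝ} {a : ℝ} (hR : 0 < R) (hq : 0 < q) (hA : A ≤ 1)
    (ha : 0 < a) (hM : 0 ≤ M)
    {p w₀ w₁ : E3} {φ : E3 → ℝ} {φ' : E3 → E3 →L[ℝ] ℝ}
    (hd : ∀ t v : ℝ, |t| ≤ R → |v| ≤ 3 * R →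
      HasFDerivAt φ (φ' (p + t • w₀ + v • w₁)) (p + t • w₀ + v • w₁))
    (hhol : ∀ t v t' v' : ℝ, |t| ≤ R → |v| ≤ 3 * R → |t'| ≤ R → |v'| ≤ 3 * R →
      ‖φ' (p + t • w₀ + v • w₁) - φ' (p + t' • w₀ + v' • w₁)‖ ≤
        M * ‖(p + t • w₀ + v • w₁) - (p + t' • w₀ + v' • w₁)‖ ^ a)
    (hq1 : ∀ t v : ℝ, |t| ≤ R → |v| ≤ 3 * R → q ≤ φ' (p + t • w₀ + v • w₁) w₁)
    (hA0 : ∀ t v : ℝ, |t| ≤ R → |v| ≤ 3 * R → |φ' (p + t • w₀ + v • w₁) w₀| ≤ A * q)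
    (hW : ∀ c : ℝ, |c| ≤ A → ‖w₀ + c • w₁‖ ≤ W)
    {t₀ v₀ : ℝ} (ht₀ : |t₀| ≤ R) (hv₀ : |v₀| ≤ R) (hz : φ (p + t₀ • w₀ + v₀ • w₁) = 0) :
    ∃ c b : ℝ, |c| ≤ A ∧ ∀ t v : ℝ, |t| ≤ R → |v| ≤ R →
      (M * (2 * R * W) ^ (a + 1) / q < v - c * t - b → 0 < φ (p + t • w₀ + v • w₁)) ∧
      (v - c * t - b < -(M * (2 * R * W) ^ (a + 1) / q) → φ (p + t • w₀ + v • w₁) < 0) := by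
  have hv₀' : |v₀| ≤ 3 * R := by linarith
  set L := φ' (p + t₀ • w₀ + v₀ • w₁) with hL
  have hLq : q ≤ L w₁ := hq1 t₀ v₀ ht₀ hv₀'
  have hL0 : 0 < L w₁ := hq.trans_le hLq
  -- Slope of the tangent to the zero curve at the zero `(t₀, v₀)`; the direction `w` below is
  -- annihilated by the derivative there.
  set c := -(L w₀ / L w₁) with hc
  have hcA : |c| ≤ A := by
    rw [hc, abs_neg, abs_div, abs_of_pos hL0, div_le_iff₀ hL0]
    have hA0' : 0 ≤ A := by
      have := (abs_nonneg _).trans (hA0 t₀ v₀ ht₀ hv₀')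
      exact nonneg_of_mul_nonneg_left this hq
    calc |L w₀| ≤ A * q := hA0 t₀ v₀ ht₀ hv₀'
      _ ≤ A * L w₁ := by gcongr
  set b := v₀ - c * t₀ with hb
  set w := w₀ + c • w₁ with hw
  have hLw : L w = 0 := by
    rw [hw, map_add, map_smul, smul_eq_mul, hc]
    field_simp
    ring
  have hwW := hW c hcA
  have hW0 : 0 ≤ W := (norm_nonneg _).trans hwW
  -- The tangent line has slope at most 1 and passes through the square of half-width `R`, so it
  -- stays within `|v| ≤ 3R`. This is why the hypotheses cover the taller box.
  have hbox : ∀ t : ℝ, |t| ≤ R → |b + c * t| ≤ 3 * R := by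
    intro t ht
    have e : b + c * t = v₀ + c * (t - t₀) := by rw [hb]; ring
    have h1 : |c * (t - t₀)| ≤ 1 * (2 * R) := by
      rw [abs_mul]
      refine mul_le_mul (hcA.trans hA) ?_ (abs_nonneg _) zero_le_one
      exact (abs_sub t t₀).trans (by linarith)
    rw [e]
    exact (abs_add_le _ _).trans (by linarith)
  have hline : ∀ t : ℝ, p + t • w₀ + (b + c * t) • w₁ = (p + b • w₁) + t • w := by
    intro t
    rw [hw, smul_add, add_smul, smul_smul, mul_comm t c]
    abel
  have hF : ∀ t : ℝ, |t| ≤ R → HasDerivAt (fun t : ℝ => φ ((p + b • w₁) + t • w))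
      (φ' ((p + b • w₁) + t • w) w) t := by
    intro t ht
    have h1 : HasDerivAt (fun t : ℝ => (p + b • w₁) + t • w) w t := by
      simpa using ((hasDerivAt_id t).smul_const w).const_add (p + b • w₁)
    have h2 := hd t (b + c * t) ht (hbox t ht)
    rw [hline t] at h2
    exact h2.comp_hasDerivAt t h1
  have hp0 : p + t₀ • w₀ + v₀ • w₁ = (p + b • w₁) + t₀ • w := by
    rw [← hline t₀, hb]; congr 2; ring
  have hF0 : φ ((p + b • w₁) + t₀ • w) = 0 := by rw [← hp0, hz]
  -- On the tangent line `φ` vanishes at `t₀` together with its derivative along `w`, so the Hölder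
  -- bound makes `φ` of order `1 + a` in the distance travelled.
  have hsmall : ∀ t : ℝ, |t| ≤ R → |φ ((p + b • w₁) + t • w)| ≤ M * (2 * R * W) ^ (a + 1) := by
    intro t ht
    have hderiv : ∀ u ∈ Set.Icc (-R) R, ‖φ' ((p + b • w₁) + u • w) w‖ ≤
        M * (2 * R * W) ^ a * W := by
      intro u hu
      have hu' : |u| ≤ R := abs_le.2 hu
      have h3 := hhol u (b + c * u) t₀ v₀ hu' (hbox u hu') ht₀ hv₀'
      rw [hline u, ← hL] at h3
      have h4 : φ' ((p + b • w₁) + u • w) w = (φ' ((p + b • w₁) + u • w) - L) w := by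
        rw [_root_.sub_apply, hLw, sub_zero]
      rw [h4]
      refine ((φ' ((p + b • w₁) + u • w) - L).le_opNorm w).trans ?_
      have h5 : ‖(p + b • w₁) + u • w - (p + t₀ • w₀ + v₀ • w₁)‖ ≤ 2 * R * W := by
        rw [hp0, add_sub_add_left_eq_sub, ← sub_smul, norm_smul, Real.norm_eq_abs]
        gcongr
        exact (abs_sub u t₀).trans (by linarith)
      gcongr
      refine h3.trans ?_
      gcongr
    have h6 := (convex_Icc (-R) R).norm_image_sub_le_of_norm_hasDerivWithin_le
      (fun u hu => (hF u (abs_le.2 hu)).hasDerivWithinAt) hderiv (abs_le.1 ht₀) (abs_le.1 ht)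
    rw [hF0, sub_zero, Real.norm_eq_abs, Real.norm_eq_abs] at h6
    refine h6.trans ?_
    have h7 : |t - t₀| ≤ 2 * R := (abs_sub t t₀).trans (by linarith)
    calc M * (2 * R * W) ^ a * W * |t - t₀| ≤ M * (2 * R * W) ^ a * W * (2 * R) := by gcongr
      _ = M * ((2 * R * W) ^ a * (2 * R * W)) := by ring
      _ = _ := by rw [Real.rpow_add_one' (by positivity) (by linarith)]
  -- Vertical growth at rate at least `q` overcomes the error on the line once `v` is farther from
  -- it than error divided by `q`.
  have hmono : ∀ t : ℝ, |t| ≤ R → MonotoneOn (fun v : ℝ => φ (p + t • w₀ + v • w₁) - q * v)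
      (Set.Icc (-(3 * R)) (3 * R)) := by
    intro t ht
    have hder : ∀ v : ℝ, |v| ≤ 3 * R → HasDerivAt (fun v : ℝ => φ (p + t • w₀ + v • w₁) - q * v)
        (φ' (p + t • w₀ + v • w₁) w₁ - q) v := by
      intro v hv
      have h1 : HasDerivAt (fun v : ℝ => p + t • w₀ + v • w₁) w₁ v := by
        simpa using ((hasDerivAt_id v).smul_const w₁).const_add (p + t • w₀)
      refine ((hd t v ht hv).comp_hasDerivAt v h1).sub ?_
      simpa using (hasDerivAt_id v).const_mul q
    refine monotoneOn_of_hasDerivWithinAt_nonneg (convex_Icc _ _)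
      (fun v hv => (hder v (abs_le.2 hv)).continuousAt.continuousWithinAt)
      (fun v hv => (hder v (abs_le.2 (Set.mem_Icc.1 (interior_subset hv)))).hasDerivWithinAt) ?_
    intro v hv
    linarith [hq1 t v ht (abs_le.2 (Set.mem_Icc.1 (interior_subset hv)))]
  have hqm : q * (M * (2 * R * W) ^ (a + 1) / q) = M * (2 * R * W) ^ (a + 1) := by field_simp
  refine ⟨c, b, hcA, fun t v ht hv => ⟨fun h => ?_, fun h => ?_⟩⟩
  · have hτ : 0 ≤ M * (2 * R * W) ^ (a + 1) / q := by positivity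
    have h8 := hmono t ht (abs_le.1 (hbox t ht)) (abs_le.1 (hv.trans (by linarith)))
      (show b + c * t ≤ v by linarith)
    simp only [hline t] at h8
    have h9 := (abs_le.1 (hsmall t ht)).1
    have h10 := mul_lt_mul_of_pos_left h hq
    rw [hqm] at h10
    linarith
  · have hτ : 0 ≤ M * (2 * R * W) ^ (a + 1) / q := by positivity
    have h8 := hmono t ht (abs_le.1 (hv.trans (by linarith))) (abs_le.1 (hbox t ht))
      (show v ≤ b + c * t by linarith)
    simp only [hline t] at h8
    have h9 := (abs_le.1 (hsmall t ht)).2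
    have h10 := mul_lt_mul_of_pos_left h hq
    rw [mul_neg, hqm] at h10
    linarith

/-- Planar slices of a set with a defining function are half planes, up to a thin strip. -/
lemma exists_halfPlane {R q A W M : ℝ} {a : ℝ} (hR : 0 < R) (hq : 0 < q) (hA0 : 0 ≤ A)
    (hA : A ≤ 1) (ha : 0 < a) (hM : 0 ≤ M) {δ : ℝ} {B : Set E3} {x : E3}
    {p w₀ w₁ : E3} {φ : E3 → ℝ} {φ' : E3 → E3 →L[ℝ] ℝ}
    (hφ : IsDefiningFunction a M δ B x φ φ')
    (hball : ∀ t v : ℝ, |t| ≤ R → |v| ≤ 3 * R → p + t • w₀ + v • w₁ ∈ Metric.ball x δ)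
    {σ : ℝ} (hσ : σ = 1 ∨ σ = -1)
    (hq1 : ∀ t v : ℝ, |t| ≤ R → |v| ≤ 3 * R → q ≤ σ * φ' (p + t • w₀ + v • w₁) w₁)
    (hAq : ∀ t v : ℝ, |t| ≤ R → |v| ≤ 3 * R → |φ' (p + t • w₀ + v • w₁) w₀| ≤ A * q)
    (hW : ∀ c : ℝ, |c| ≤ A → ‖w₀ + c • w₁‖ ≤ W) :
    ∃ c b : ℝ, ∃ V : Set ℝ, |c| ≤ A ∧ MeasurableSet V ∧ ∀ t v : ℝ, |t| ≤ R → |v| ≤ R →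
      M * (2 * R * W) ^ (a + 1) / q < |v - c * t - b| →
      (p + t • w₀ + v • w₁ ∈ B ↔ v - c * t ∈ V) := by
  have hball' : ∀ t v : ℝ, |t| ≤ R → |v| ≤ R → p + t • w₀ + v • w₁ ∈ Metric.ball x δ :=
    fun t v ht hv => hball t v ht (by linarith)
  by_cases hz : ∃ t₀ v₀ : ℝ, |t₀| ≤ R ∧ |v₀| ≤ R ∧ φ (p + t₀ • w₀ + v₀ • w₁) = 0
  · obtain ⟨t₀, v₀, ht₀, hv₀, hz⟩ := hz
    have hσ1 : |σ| = 1 := by rcases hσ with rfl | rfl <;> simp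
    obtain ⟨c, b, hc, h⟩ := exists_line_of_deriv_ge (φ := fun y => σ * φ y)
      (φ' := fun y => σ • φ' y) hR hq hA ha hM (p := p) (w₀ := w₀) (w₁ := w₁)
      (fun t v ht hv => (hφ.hasFDerivAt _ (hball t v ht hv)).const_mul σ)
      (fun t v t' v' ht hv ht' hv' => by
        have e : ∀ L L' : E3 →L[ℝ] ℝ, σ • L - σ • L' = σ • (L - L') := fun L L' => by
          ext; simp [mul_sub]
        rw [e, norm_smul, Real.norm_eq_abs, hσ1, one_mul]
        exact hφ.norm_sub_le _ (hball t v ht hv) _ (hball t' v' ht' hv'))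
      (fun t v ht hv => by simpa using hq1 t v ht hv)
      (fun t v ht hv => by
        rw [_root_.smul_apply, smul_eq_mul, abs_mul, hσ1, one_mul]; exact hAq t v ht hv)
      hW ht₀ hv₀ (by simp [hz])
    rcases hσ with rfl | rfl
    · refine ⟨c, b, Set.Ioi b, hc, measurableSet_Ioi, fun t v ht hv hlt => ?_⟩
      obtain ⟨h1, h2⟩ := h t v ht hv
      rw [hφ.mem_iff _ (hball' t v ht hv), Set.mem_Ioi]
      simp only [one_mul] at h1 h2
      have h0 : 0 ≤ M * (2 * R * W) ^ (a + 1) / q := by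
        have : 0 ≤ W := (norm_nonneg _).trans (hW 0 (by simpa using hA0))
        positivity
      rcases lt_abs.1 hlt with h3 | h3
      · exact iff_of_true (h1 h3).le (by linarith)
      · exact iff_of_false (not_le.2 (h2 (by linarith))) (by linarith)
    · refine ⟨c, b, Set.Iio b, hc, measurableSet_Iio, fun t v ht hv hlt => ?_⟩
      obtain ⟨h1, h2⟩ := h t v ht hv
      rw [hφ.mem_iff _ (hball' t v ht hv), Set.mem_Iio]
      simp only [neg_mul, one_mul, Left.neg_pos_iff, Left.neg_neg_iff] at h1 h2
      have h0 : 0 ≤ M * (2 * R * W) ^ (a + 1) / q := by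
        have : 0 ≤ W := (norm_nonneg _).trans (hW 0 (by simpa using hA0))
        positivity
      rcases lt_abs.1 hlt with h3 | h3
      · exact iff_of_false (not_le.2 (h1 h3)) (by linarith)
      · exact iff_of_true (h2 (by linarith)).le (by linarith)
  · push Not at hz
    have hcont : ContinuousOn (fun q : ℝ × ℝ => φ (p + q.1 • w₀ + q.2 • w₁))
        (Set.Icc (-R) R ×ˢ Set.Icc (-R) R) := by
      rintro ⟨t, v⟩ ⟨ht, hv⟩
      have h1 : ContinuousAt φ (p + t • w₀ + v • w₁) :=
        (hφ.hasFDerivAt _ (hball' t v (abs_le.2 ht) (abs_le.2 hv))).continuousAt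
      have h2 : ContinuousAt (fun q : ℝ × ℝ => p + q.1 • w₀ + q.2 • w₁) (t, v) := by fun_prop
      exact (ContinuousAt.comp (f := fun q : ℝ × ℝ => p + q.1 • w₀ + q.2 • w₁) (x := (t, v))
        h1 h2).continuousWithinAt
    have hpre : IsPreconnected (Set.Icc (-R) R ×ˢ Set.Icc (-R) R) :=
      isPreconnected_Icc.prod isPreconnected_Icc
    have hmem0 : ((0 : ℝ), (0 : ℝ)) ∈ Set.Icc (-R) R ×ˢ Set.Icc (-R) R := by
      constructor <;> constructor <;> simp [hR.le]
    have hne : ∀ q ∈ Set.Icc (-R) R ×ˢ Set.Icc (-R) R, φ (p + q.1 • w₀ + q.2 • w₁) ≠ 0 :=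
      fun q hq => hz q.1 q.2 (abs_le.2 hq.1) (abs_le.2 hq.2)
    -- Without a zero the sign of `φ` is constant on the connected square, so `V` is everything or
    -- nothing, according to the sign at the centre.
    refine ⟨0, 0, {_v | 0 ≤ φ (p + (0 : ℝ) • w₀ + (0 : ℝ) • w₁)}, by simpa using hA0, by simp,
      fun t v ht hv _ => ?_⟩
    rw [hφ.mem_iff _ (hball' t v ht hv), Set.mem_ofPred_eq]
    have hmem : (t, v) ∈ Set.Icc (-R) R ×ˢ Set.Icc (-R) R := ⟨abs_le.1 ht, abs_le.1 hv⟩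
    constructor
    · intro h
      by_contra! h'
      obtain ⟨q, hq, hq0⟩ := hpre.intermediate_value hmem0 hmem hcont ⟨h'.le, h⟩
      exact hne q hq hq0
    · intro h
      by_contra! h'
      obtain ⟨q, hq, hq0⟩ := hpre.intermediate_value hmem hmem0 hcont ⟨h'.le, h⟩
      exact hne q hq hq0

end

noncomputable section

/-! ### Integrals of a smooth function times the generator over lines and planes -/

lemma GradHolder.norm_sub_sub_le {E F : Type*} [NormedAddCommGroup E] [NormedSpace ℝ E]
    [NormedAddCommGroup F] [NormedSpace ℝ F] {a M : ℝ} {g : E → F} (hg : GradHolder a M g)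
    (ha : 0 ≤ a) (hM : 0 ≤ M) {p h : E} {d : ℝ} (hd : ‖h‖ ≤ d) :
    ‖g (p + h) - g p - fderiv ℝ g p h‖ ≤ M * d ^ a * d := by
  have hd0 : 0 ≤ d := (norm_nonneg h).trans hd
  have hdiff : Differentiable ℝ g := hg.contDiff.differentiable (by norm_num)
  have := (convex_closedBall p d).norm_image_sub_le_of_norm_hasFDerivWithin_le'
    (f := g) (f' := fderiv ℝ g) (φ := fderiv ℝ g p) (C := M * d ^ a) (x := p) (y := p + h)
    (fun z _ => (hdiff z).hasFDerivAt.hasFDerivWithinAt)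
    (fun z hz => by
      refine (hg.norm_fderiv_sub_le z p).trans ?_
      have : ‖z - p‖ ≤ d := by simpa [dist_eq_norm] using hz
      gcongr)
    (Metric.mem_closedBall_self hd0) (by simpa using hd)
  rw [add_sub_cancel_left] at this
  exact this.trans (by gcongr)

/-- Taylor expansion of `g` at `p`: the constant term meets the zeroth moment, the linear term the
first moment, and the remainder of order `1 + a` is estimated by absolute values. -/
lemma norm_line_integral_le {a μ μ' R N m₀ m₁ W : ℝ} {g : E3 → ℂ} {u : ℝ → ℂ} (ha : 0 ≤ a)
    (hμ' : 0 ≤ μ') (hR : 0 ≤ R) (hgb : ∀ x, ‖g x‖ ≤ μ) (hg : GradHolder a μ' g)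
    (hu : Continuous u) (hu0 : ∀ t, R < |t| → u t = 0) (huN : ∀ t, ‖u t‖ ≤ N)
    (hm₀ : ‖∫ t, u t‖ ≤ m₀) (hm₁ : ‖∫ t : ℝ, (t : ℂ) * u t‖ ≤ m₁) (p : E3) {w : E3}
    (hw : ‖w‖ ≤ W) :
    ‖∫ t : ℝ, g (p + t • w) * u t‖ ≤
      μ * m₀ + μ' * W * m₁ + μ' * (R * W) ^ a * (R * W) * N * (2 * R) := by
  have hW0 : 0 ≤ W := (norm_nonneg w).trans hw
  have hsupp : HasCompactSupport u := by
    refine HasCompactSupport.intro (isCompact_Icc (a := -R) (b := R)) fun t ht => hu0 t ?_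
    by_contra! h
    exact ht (abs_le.1 h)
  have hgc : Continuous g := hg.contDiff.continuous
  set L := fderiv ℝ g p w with hL
  have i0 : Integrable fun t : ℝ => g p * u t :=
    (continuous_const.mul hu).integrable_of_hasCompactSupport hsupp.mul_left
  have i1 : Integrable fun t : ℝ => L * ((t : ℂ) * u t) :=
    (continuous_const.mul (Complex.continuous_ofReal.mul hu)).integrable_of_hasCompactSupport
      (hsupp.mul_left.mul_left)
  have i01 : Integrable fun t : ℝ => g p * u t + L * ((t : ℂ) * u t) := i0.add i1
  have i2 : Integrable fun t : ℝ => (g (p + t • w) - g p - (t : ℂ) * L) * u t :=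
    Continuous.integrable_of_hasCompactSupport (by fun_prop) hsupp.mul_left
  have hsplit : ∫ t : ℝ, g (p + t • w) * u t =
      g p * (∫ t, u t) + L * (∫ t : ℝ, (t : ℂ) * u t) +
        ∫ t : ℝ, (g (p + t • w) - g p - (t : ℂ) * L) * u t := by
    rw [← integral_const_mul, ← integral_const_mul, ← integral_add i0 i1,
      ← integral_add i01 i2]
    refine integral_congr_ae (Eventually.of_forall fun t => ?_)
    simp only
    ring
  have hrem : ‖∫ t : ℝ, (g (p + t • w) - g p - (t : ℂ) * L) * u t‖ ≤
      μ' * (R * W) ^ a * (R * W) * N * (2 * R) := by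
    have h4 : ∫ t : ℝ, (g (p + t • w) - g p - (t : ℂ) * L) * u t =
        ∫ t in Set.Icc (-R) R, (g (p + t • w) - g p - (t : ℂ) * L) * u t := by
      rw [setIntegral_eq_integral_of_forall_compl_eq_zero]
      intro t ht
      rw [hu0 t, mul_zero]
      by_contra! h
      exact ht (abs_le.1 h)
    rw [h4]
    refine (norm_setIntegral_le_of_norm_le_const (C := μ' * (R * W) ^ a * (R * W) * N)
        (by simp) ?_).trans ?_
    · intro t ht
      rw [norm_mul]
      have ht' : |t| ≤ R := abs_le.2 ht
      have h5 : ‖t • w‖ ≤ R * W := by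
        rw [norm_smul, Real.norm_eq_abs]; gcongr
      have h6 := hg.norm_sub_sub_le ha hμ' (p := p) h5
      rw [map_smul, Complex.real_smul] at h6
      gcongr
      exact huN t
    · simp [Measure.real, two_mul, hR]
  have hLn : ‖L‖ ≤ μ' * W := by
    refine ((fderiv ℝ g p).le_opNorm w).trans ?_
    gcongr
    exact hg.norm_fderiv_le p
  rw [hsplit]
  have hμ0 : 0 ≤ μ := (norm_nonneg _).trans (hgb p)
  refine (norm_add_le _ _).trans (add_le_add ((norm_add_le _ _).trans (add_le_add ?_ ?_)) hrem)
  · rw [norm_mul]; gcongr; exact hgb p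
  · rw [norm_mul]; gcongr

lemma measurePreserving_shear_plane (c : ℝ) :
    MeasurePreserving (fun q : ℝ × ℝ => (q.1, q.2 + c * q.1)) := by
  refine (MeasurePreserving.id (volume : Measure ℝ)).skew_product
    (g := fun t v => v + c * t) (by fun_prop) ?_
  filter_upwards with t
  exact (measurePreserving_add_right (volume : Measure ℝ) (c * t)).map_eq

lemma measurableEmbedding_shear_plane (c : ℝ) :
    MeasurableEmbedding (fun q : ℝ × ℝ => (q.1, q.2 + c * q.1)) := by
  refine Continuous.measurableEmbedding (by fun_prop) ?_
  rintro ⟨t, v⟩ ⟨t', v'⟩ h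
  simp only [Prod.mk.injEq] at h ⊢
  obtain ⟨rfl, h⟩ := h
  exact ⟨rfl, by linarith⟩

/-- The shear `v ↦ v + c t` makes the edge of the half plane parallel to the `t`-axis. The condition
`v ∈ V` then does not involve `t`, and Fubini reduces the main term to full line integrals with
cancellation; the rest lives on a strip of area `4Rτ`. -/
lemma norm_plane_integral_le {a μ μ' R N ε c b τ W : ℝ} {g η : E3 → ℂ} (hη : IsGenerator R N η)
    (ha : 0 ≤ a) (hμ' : 0 ≤ μ') (hR : 0 < R) (hN : 0 ≤ N)
    (hgb : ∀ x, ‖g x‖ ≤ μ) (hg : GradHolder a μ' g) (i : Fin 2) (s : ℝ) (p w₀ w₁ : E3)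
    (hε : 0 < ε) (hε1 : ε ≤ 1) (hc : |c| ≤ ε) (hτ : 0 ≤ τ) (hW : ‖w₀ + c • w₁‖ ≤ W)
    {B : Set E3} (hB : MeasurableSet B) {V : Set ℝ} (hV : MeasurableSet V)
    (hBV : ∀ t v : ℝ, |t| ≤ R → |v| ≤ R → τ < |v - c * t - b| →
      (p + t • w₀ + v • w₁ ∈ B ↔ v - c * t ∈ V)) :
    ‖∫ q : ℝ × ℝ, B.indicator g (p + q.1 • w₀ + q.2 • w₁) * η (axisPoint i q.1 q.2 s)‖ ≤
      (μ * (N * ε ^ 3) + μ' * W * (N * ε) + μ' * (R * W) ^ a * (R * W) * N * (2 * R)) * (4 * R) +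
        μ * N * (4 * R * τ) := by
  classical
  have hμ0 : 0 ≤ μ := (norm_nonneg _).trans (hgb 0)
  have hW0 : 0 ≤ W := (norm_nonneg _).trans hW
  have hgc : Continuous g := hg.contDiff.continuous
  have hηc := hη.continuous
  rw [← (measurePreserving_shear_plane c).integral_comp (measurableEmbedding_shear_plane c)]
  set G : ℝ × ℝ → ℂ := fun q => g (p + q.1 • w₀ + (q.2 + c * q.1) • w₁) *
    η (axisPoint i q.1 (q.2 + c * q.1) s) with hG
  have hGc : Continuous G := by
    refine Continuous.mul (by fun_prop) (hηc.comp ((continuous_axisPoint i).comp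
      (f := fun q : ℝ × ℝ => (q.1, q.2 + c * q.1, s)) (by fun_prop)))
  have hsupp : ∀ q : ℝ × ℝ, G q ≠ 0 → |q.1| ≤ R ∧ |q.2 + c * q.1| ≤ R := by
    intro q hq
    constructor
    · by_contra! h
      refine hq ?_
      rw [hG]; simp only
      rw [hη.eq_zero _ 0 (by rwa [axisPoint_zero_coord]), mul_zero]
    · by_contra! h
      refine hq ?_
      rw [hG]; simp only
      rw [hη.eq_zero _ i.succ (by rwa [axisPoint_succ_coord]), mul_zero]
  -- After the shear the support widens to `|v| ≤ 2R`, whence the factor `4R` in the main term.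
  have hsupp2 : ∀ q : ℝ × ℝ, G q ≠ 0 → |q.2| ≤ 2 * R := by
    intro q hq
    obtain ⟨h1, h2⟩ := hsupp q hq
    have h3 : |c * q.1| ≤ 1 * R := by
      rw [abs_mul]
      exact mul_le_mul (hc.trans hε1) h1 (abs_nonneg _) zero_le_one
    have h4 : q.2 = (q.2 + c * q.1) - c * q.1 := by ring
    rw [h4]
    exact (abs_sub _ _).trans (by linarith)
  have hGN : ∀ q, ‖G q‖ ≤ μ * N := fun q => by
    rw [hG]; simp only
    rw [norm_mul]
    gcongr
    · exact hgb _
    · exact hη.norm_le _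
  have hGs : HasCompactSupport G := by
    refine HasCompactSupport.intro
      ((isCompact_Icc (a := -R) (b := R)).prod (isCompact_Icc (a := -(2 * R)) (b := 2 * R)))
      fun q hq => ?_
    by_contra h
    exact hq ⟨abs_le.1 (hsupp q h).1, abs_le.1 (hsupp2 q h)⟩
  have hGi : Integrable G := hGc.integrable_of_hasCompactSupport hGs
  set S : Set (ℝ × ℝ) := {q | p + q.1 • w₀ + (q.2 + c * q.1) • w₁ ∈ B} with hS
  have hSm : MeasurableSet S := by
    have : Continuous fun q : ℝ × ℝ => p + q.1 • w₀ + (q.2 + c * q.1) • w₁ := by fun_prop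
    exact this.measurable hB
  set V' : Set (ℝ × ℝ) := {q | q.2 ∈ V} with hV'
  have hV'm : MeasurableSet V' := measurable_snd hV
  have hint : ∀ q : ℝ × ℝ, B.indicator g (p + q.1 • w₀ + (q.2 + c * q.1) • w₁) *
      η (axisPoint i q.1 (q.2 + c * q.1) s) = S.indicator G q := by
    intro q
    by_cases h : q ∈ S
    · rw [Set.indicator_of_mem h, Set.indicator_of_mem (show _ ∈ B from h)]
    · rw [Set.indicator_of_notMem h, Set.indicator_of_notMem (show _ ∉ B from h), zero_mul]
  simp_rw [hint]
  have hsplit : ∫ q, S.indicator G q =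
      (∫ q, V'.indicator G q) + ∫ q, (S.indicator G q - V'.indicator G q) := by
    have hd : Integrable fun q => S.indicator G q - V'.indicator G q :=
      (hGi.indicator hSm).sub (hGi.indicator hV'm)
    rw [← integral_add (hGi.indicator hV'm) hd]
    refine integral_congr_ae (Eventually.of_forall fun q => ?_)
    simp
  have hmain : ‖∫ q, V'.indicator G q‖ ≤ (μ * (N * ε ^ 3) + μ' * W * (N * ε) +
      μ' * (R * W) ^ a * (R * W) * N * (2 * R)) * (4 * R) := by
    rw [Measure.volume_eq_prod, integral_prod_symm _ (by exact hGi.indicator hV'm)]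
    have hline : ∀ v : ℝ, ‖∫ t, V'.indicator G (t, v)‖ ≤ μ * (N * ε ^ 3) + μ' * W * (N * ε) +
        μ' * (R * W) ^ a * (R * W) * N * (2 * R) := by
      intro v
      by_cases hv : v ∈ V
      · have h1 : ∀ t : ℝ, V'.indicator G (t, v) =
            g ((p + v • w₁) + t • (w₀ + c • w₁)) * η (axisPoint i t (v + c * t) s) := by
          intro t
          rw [Set.indicator_of_mem (show (t, v) ∈ V' from hv)]
          simp only [hG]
          congr 2
          rw [smul_add, add_smul, smul_smul, mul_comm t c]
          abel
        simp_rw [h1]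
        refine norm_line_integral_le ha hμ' hR.le hgb hg
          (hηc.comp ((continuous_axisPoint i).comp
            (f := fun t : ℝ => (t, v + c * t, s)) (by fun_prop))) ?_ (fun t => hη.norm_le _)
          (hη.moment_zero i ε c v s hε hε1 hc) (hη.moment_one i ε c v s hε hε1 hc) _ hW
        intro t ht
        change η (axisPoint i t (v + c * t) s) = 0
        exact hη.eq_zero _ 0 (by rwa [axisPoint_zero_coord])
      · have h1 : ∀ t : ℝ, V'.indicator G (t, v) = 0 := fun t =>
          Set.indicator_of_notMem (show (t, v) ∉ V' from hv) _
        simp_rw [h1]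
        rw [integral_zero, norm_zero]
        positivity
    have hz : ∀ v : ℝ, v ∉ Set.Icc (-(2 * R)) (2 * R) → ∫ t, V'.indicator G (t, v) = 0 := by
      intro v hv
      have h1 : ∀ t : ℝ, V'.indicator G (t, v) = 0 := by
        intro t
        have : G (t, v) = 0 := by
          by_contra h
          exact hv (abs_le.1 (hsupp2 _ h))
        simp [this]
      simp_rw [h1]
      exact integral_zero _ _
    rw [← setIntegral_eq_integral_of_forall_compl_eq_zero hz]
    refine (norm_setIntegral_le_of_norm_le_const (by simp) fun v _ => hline v).trans (le_of_eq ?_)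
    congr 1
    simp only [Measure.real, Real.volume_Icc]
    rw [ENNReal.toReal_ofReal (by linarith)]
    ring
  have herr : ‖∫ q, (S.indicator G q - V'.indicator G q)‖ ≤ μ * N * (4 * R * τ) := by
    have hz : ∀ q : ℝ × ℝ, q ∉ Set.Icc (-R) R ×ˢ Set.Icc (b - τ) (b + τ) →
        S.indicator G q - V'.indicator G q = 0 := by
      rintro ⟨t, v⟩ hq
      by_cases h : G (t, v) = 0
      · simp [Set.indicator_apply, h]
      · obtain ⟨h1, h2⟩ := hsupp _ h
        have h3 : τ < |v - b| := by
          by_contra! h3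
          refine hq ⟨abs_le.1 h1, ?_⟩
          have := abs_le.1 h3
          constructor <;> simp only <;> linarith
        have h4 := hBV t (v + c * t) h1 h2 (by simpa [add_sub_cancel_right] using h3)
        rw [add_sub_cancel_right] at h4
        have h5 : (t, v) ∈ S ↔ (t, v) ∈ V' := h4
        simp [Set.indicator_apply, h5]
    rw [← setIntegral_eq_integral_of_forall_compl_eq_zero hz]
    have hvol : (volume : Measure (ℝ × ℝ)) (Set.Icc (-R) R ×ˢ Set.Icc (b - τ) (b + τ)) =
        ENNReal.ofReal (2 * R) * ENNReal.ofReal (2 * τ) := by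
      rw [Measure.volume_eq_prod, Measure.prod_prod, Real.volume_Icc, Real.volume_Icc]
      congr 2 <;> ring
    refine (norm_setIntegral_le_of_norm_le_const (C := μ * N) ?_ ?_).trans (le_of_eq ?_)
    · rw [hvol]; exact ENNReal.mul_lt_top ENNReal.ofReal_lt_top ENNReal.ofReal_lt_top
    · intro q _
      by_cases h1 : q ∈ S <;> by_cases h2 : q ∈ V' <;>
        simp only [Set.indicator_apply, h1, h2, if_true, if_false, sub_self, sub_zero, zero_sub,
          norm_zero, norm_neg] <;> first | exact hGN q | positivity
    · rw [Measure.real, hvol, ENNReal.toReal_mul, ENNReal.toReal_ofReal (by linarith),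
        ENNReal.toReal_ofReal (by linarith)]
      ring
  rw [hsplit]
  exact (norm_add_le _ _).trans (add_le_add hmain herr)

end

noncomputable section

/-! ### The estimate in rescaled coordinates -/

lemma norm_integral_le_of_slices {F : E3 → ℂ} (hF : Integrable F) {R K : ℝ} (hR : 0 ≤ R)
    (i : Fin 2) (h0 : ∀ t v s : ℝ, R < |s| → F (axisPoint i t v s) = 0)
    (hK : ∀ s, ‖∫ q : ℝ × ℝ, F (axisPoint i q.1 q.2 s)‖ ≤ K) : ‖∫ x, F x‖ ≤ K * (2 * R) := by
  have hassoc : MeasurePreserving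
      (fun p : (ℝ × ℝ) × ℝ => ((p.1.1, p.1.2, p.2) : ℝ × (ℝ × ℝ))) :=
    volume_preserving_prodAssoc (α₁ := ℝ) (β₁ := ℝ) (γ₁ := ℝ)
  have hemb : MeasurableEmbedding
      (fun p : (ℝ × ℝ) × ℝ => ((p.1.1, p.1.2, p.2) : ℝ × (ℝ × ℝ))) :=
    (MeasurableEquiv.prodAssoc (α := ℝ) (β := ℝ) (γ := ℝ)).measurableEmbedding
  have hi : Integrable fun p : (ℝ × ℝ) × ℝ => F (axisPoint i p.1.1 p.1.2 p.2) :=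
    (hassoc.integrable_comp_emb hemb).2 ((integrable_axisPoint i).2 hF)
  have h1 : ∫ x, F x = ∫ p : (ℝ × ℝ) × ℝ, F (axisPoint i p.1.1 p.1.2 p.2) := by
    rw [← integral_axisPoint i, ← hassoc.integral_comp hemb]
  rw [h1, Measure.volume_eq_prod, integral_prod_symm _ (by exact hi)]
  have hz : ∀ s : ℝ, s ∉ Set.Icc (-R) R → ∫ q : ℝ × ℝ, F (axisPoint i q.1 q.2 s) = 0 := by
    intro s hs
    have : ∀ q : ℝ × ℝ, F (axisPoint i q.1 q.2 s) = 0 := fun q => h0 _ _ _ (by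
      by_contra! h; exact hs (abs_le.1 h))
    simp_rw [this]
    exact integral_zero _ _
  rw [← setIntegral_eq_integral_of_forall_compl_eq_zero hz]
  refine (norm_setIntegral_le_of_norm_le_const (by simp) fun s _ => hK s).trans (le_of_eq ?_)
  simp [Measure.real, two_mul, hR]

/-- The relations between the scale `D`, the anisotropy ratio `T` and the small parameter `ε`. -/
structure IsScale (α D T ε : ℝ) : Prop where
  D_pos : 0 < D
  D_le : D ≤ 1
  one_le_T : 1 ≤ T
  rpow_D : D ^ (α - 1) = 1 / T
  ε_pos : 0 < ε
  ε_le : ε ≤ 1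
  T_ε : 1 / T ≤ 5 * ε

section

variable {α β D T ε : ℝ}

/-- Since `(α-1)² ≤ 1` and `D ≤ 1`, `D` is at most `D^{(α-1)²}`, which is `(1/T)^{α-1}`. -/
lemma IsScale.D_le_rpow (h : IsScale α D T ε) (h1 : 1 < α) (h2 : α ≤ 2) :
    D ≤ 5 * ε ^ (α - 1) := by
  have hD := h.D_pos
  have hε := h.ε_pos
  have e1 : D ≤ (D ^ (α - 1)) ^ (α - 1) := by
    rw [← Real.rpow_mul hD.le]
    calc D = D ^ (1 : ℝ) := (Real.rpow_one D).symm
      _ ≤ D ^ ((α - 1) * (α - 1)) :=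
        Real.rpow_le_rpow_of_exponent_ge hD h.D_le (by nlinarith)
  have e2 : D ^ (α - 1) ≤ 5 * ε := h.rpow_D ▸ h.T_ε
  calc D ≤ (D ^ (α - 1)) ^ (α - 1) := e1
    _ ≤ (5 * ε) ^ (α - 1) := by gcongr
    _ = 5 ^ (α - 1) * ε ^ (α - 1) := Real.mul_rpow (by norm_num) hε.le
    _ ≤ 5 ^ (1 : ℝ) * ε ^ (α - 1) := by gcongr <;> linarith
    _ = _ := by rw [Real.rpow_one]

lemma IsScale.pow_three_le (h : IsScale α D T ε) (h2 : α ≤ 2) : ε ^ 3 ≤ ε ^ (α + 1) := by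
  rw [← Real.rpow_natCast]
  exact Real.rpow_le_rpow_of_exponent_ge h.ε_pos h.ε_le (by norm_num; linarith)

lemma IsScale.sq_mul_le (h : IsScale α D T ε) (h1 : 1 < α) (h2 : α ≤ 2) :
    ε ^ 2 * D ≤ 5 * ε ^ (α + 1) := by
  have hε := h.ε_pos
  calc ε ^ 2 * D ≤ ε ^ 2 * (5 * ε ^ (α - 1)) := by gcongr; exact h.D_le_rpow h1 h2
    _ = 5 * (ε ^ (α - 1) * ε ^ (2 : ℝ)) := by rw [Real.rpow_two]; ring
    _ = _ := by rw [← Real.rpow_add hε]; congr 2; ring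

lemma IsScale.rpow_mul_le (h : IsScale α D T ε) (hαβ : α ≤ β) :
    (ε * D) ^ (β - 1) * (ε * D) ≤ 5 * ε ^ (α + 1) := by
  have hε := h.ε_pos
  have hD := h.D_pos
  have hεD1 : ε * D ≤ 1 := mul_le_one₀ h.ε_le hD.le h.D_le
  calc (ε * D) ^ (β - 1) * (ε * D) ≤ (ε * D) ^ (α - 1) * (ε * D) := by
        gcongr ?_ * _
        exact Real.rpow_le_rpow_of_exponent_ge (by positivity) hεD1 (by linarith)
    _ = (ε ^ (α - 1) * ε) * (D ^ (α - 1) * D) := by rw [Real.mul_rpow hε.le hD.le]; ring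
    _ ≤ (ε ^ (α - 1) * ε) * (5 * ε * 1) := by
        gcongr
        · rw [h.rpow_D]; exact h.T_ε
        · exact h.D_le
    _ = 5 * (ε ^ (α - 1) * ε ^ (2 : ℝ)) := by rw [Real.rpow_two]; ring
    _ = _ := by rw [← Real.rpow_add hε]; congr 2; ring

/-- The strip width from `exists_halfPlane`: `D^{α-1} = 1/T` makes every power of `D` and `T`
cancel, so only `ε^{α+1}` survives. -/
lemma IsScale.strip_eq (h : IsScale α D T ε) {M R Q : ℝ} (hR : 0 ≤ R)
    (hQ : 0 ≤ Q) :
    M * (2 * R * (Q * (ε * D))) ^ (α - 1 + 1) / (1 / 24 * (D / (T * ε))) =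
      24 * M * (2 * R * Q) ^ α * ε ^ (α + 1) := by
  have hε := h.ε_pos
  have hD := h.D_pos
  have hT := one_pos.trans_le h.one_le_T
  have e1 : (2 * R * (Q * (ε * D))) ^ (α - 1 + 1) = (2 * R * Q) ^ α * (ε ^ α * (D / T)) := by
    rw [sub_add_cancel, show 2 * R * (Q * (ε * D)) = (2 * R * Q) * (ε * D) by ring,
      Real.mul_rpow (by positivity) (by positivity), Real.mul_rpow hε.le hD.le]
    have : D ^ α = D ^ (α - 1) * D := by
      rw [← Real.rpow_add_one hD.ne']; congr 1; ring
    rw [this, h.rpow_D]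
    ring
  rw [e1, Real.rpow_add_one hε.ne']
  field_simp

/-- The total size of the line integrals, in terms of the small parameter. -/
lemma IsScale.line_bound (h : IsScale α D T ε) (h1 : 1 < α) (h2 : α ≤ 2) (hαβ : α ≤ β)
    {μ μ' N P Q R : ℝ} (hμ : 0 ≤ μ) (hμ' : 0 ≤ μ') (hN : 0 ≤ N) (hP : 0 ≤ P) (hQ : 0 ≤ Q)
    (hR : 0 ≤ R) :
    μ * (N * (P * ε) ^ 3) + μ' * (Q * (ε * D)) * (N * (P * ε)) +
        μ' * (R * (Q * (ε * D))) ^ (β - 1) * (R * (Q * (ε * D))) * N * (2 * R) ≤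
      (μ * N * P ^ 3 + 5 * μ' * Q * N * P +
        5 * μ' * (R * Q) ^ (β - 1) * (R * Q) * N * (2 * R)) * ε ^ (α + 1) := by
  have hε := h.ε_pos
  have hD := h.D_pos
  have e1 : (R * (Q * (ε * D))) ^ (β - 1) = (R * Q) ^ (β - 1) * (ε * D) ^ (β - 1) := by
    rw [← Real.mul_rpow (by positivity) (by positivity)]; congr 1; ring
  have hRQ : 0 ≤ (R * Q) ^ (β - 1) := Real.rpow_nonneg (by positivity) _
  calc _ = μ * N * P ^ 3 * ε ^ 3 + μ' * Q * N * P * (ε ^ 2 * D) +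
        μ' * (R * Q) ^ (β - 1) * (R * Q) * N * (2 * R) * ((ε * D) ^ (β - 1) * (ε * D)) := by
        rw [e1]; ring
    _ ≤ μ * N * P ^ 3 * ε ^ (α + 1) + μ' * Q * N * P * (5 * ε ^ (α + 1)) +
        μ' * (R * Q) ^ (β - 1) * (R * Q) * N * (2 * R) * (5 * ε ^ (α + 1)) := by
        exact add_le_add (add_le_add
          (mul_le_mul_of_nonneg_left (h.pow_three_le h2) (by positivity))
          (mul_le_mul_of_nonneg_left (h.sq_mul_le h1 h2) (by positivity)))
          (mul_le_mul_of_nonneg_left (h.rpow_mul_le hαβ) (by positivity))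
    _ = _ := by ring

end

/-- The linear part of the change of variables: `e₀ ↦ (D / T) e₀` and
`e_{i + 1} ↦ D (e_{i + 1} - κ_i e₀)` with `|κ_i| ≤ 2`. -/
structure IsShearScaling (D T : ℝ) (κ : Fin 2 → ℝ) (X : E3 →ₗ[ℝ] E3) : Prop where
  map_zero_axis : X (EuclideanSpace.single 0 1) = (D / T) • EuclideanSpace.single 0 (1 : ℝ)
  map_succ_axis : ∀ i : Fin 2, X (EuclideanSpace.single i.succ 1) =
    D • (EuclideanSpace.single i.succ (1 : ℝ) - κ i • EuclideanSpace.single 0 (1 : ℝ))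
  abs_le : ∀ i, |κ i| ≤ 2

namespace IsShearScaling

variable {D T : ℝ} {κ : Fin 2 → ℝ} {X : E3 →ₗ[ℝ] E3}

lemma norm_zero_axis (hX : IsShearScaling D T κ X) (hD : 0 ≤ D) (hT : 0 ≤ T) :
    ‖X (EuclideanSpace.single 0 1)‖ = D / T := by
  rw [hX.map_zero_axis, norm_smul]
  simp [abs_of_nonneg hD, abs_of_nonneg hT]

lemma norm_succ_axis (hX : IsShearScaling D T κ X) (hD : 0 ≤ D) (i : Fin 2) :
    ‖X (EuclideanSpace.single i.succ 1)‖ ≤ 3 * D := by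
  rw [hX.map_succ_axis, norm_smul, Real.norm_of_nonneg hD]
  have : ‖(EuclideanSpace.single i.succ (1 : ℝ) - κ i • EuclideanSpace.single 0 (1 : ℝ) : E3)‖ ≤
      1 + 2 := by
    refine (norm_sub_le _ _).trans (add_le_add (by simp) ?_)
    rw [norm_smul]
    simpa using hX.abs_le i
  nlinarith

lemma apply_axisPoint (X : E3 →ₗ[ℝ] E3) (i : Fin 2) (t v s : ℝ) :
    X (axisPoint i t v s) = s • X (EuclideanSpace.single i.rev.succ 1) +
      t • X (EuclideanSpace.single 0 1) + v • X (EuclideanSpace.single i.succ 1) := by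
  simp only [axisPoint, map_add, map_smul]
  abel

/-- The ranges are those of a difference: a point with `|t|, |s| ≤ R`, `|v| ≤ 3R` minus a base point
with coordinates at most `R`. -/
lemma norm_apply_le (hX : IsShearScaling D T κ X) (hD : 0 ≤ D) (hT : 1 ≤ T) (i : Fin 2)
    {R : ℝ} {t v s : ℝ} (ht : |t| ≤ 2 * R) (hv : |v| ≤ 4 * R) (hs : |s| ≤ 2 * R) :
    ‖X (axisPoint i t v s)‖ ≤ 20 * R * D := by
  have hT0 : 0 ≤ T := by linarith
  have hR : 0 ≤ R := by linarith [abs_nonneg t]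
  rw [apply_axisPoint]
  have h0 : ‖X (EuclideanSpace.single 0 1)‖ ≤ D := by
    rw [hX.norm_zero_axis hD hT0]; exact div_le_self hD hT
  calc _ ≤ |s| * ‖X (EuclideanSpace.single i.rev.succ 1)‖ + |t| * ‖X (EuclideanSpace.single 0 1)‖ +
        |v| * ‖X (EuclideanSpace.single i.succ 1)‖ := by
        refine (norm_add_le _ _).trans (add_le_add ((norm_add_le _ _).trans (add_le_add ?_ ?_)) ?_)
          <;> rw [norm_smul, Real.norm_eq_abs]
    _ ≤ (2 * R) * (3 * D) + (2 * R) * D + (4 * R) * (3 * D) := by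
        gcongr
        · exact hX.norm_succ_axis hD _
        · exact hX.norm_succ_axis hD _
    _ = 20 * R * D := by ring

end IsShearScaling
end

/-! ### Half-plane slices and cancellation after rescaling -/

noncomputable section

lemma axisPoint_sub (i : Fin 2) (t v s t' v' s' : ℝ) :
    axisPoint i t v s - axisPoint i t' v' s' = axisPoint i (t - t') (v - v') (s - s') := by
  simp only [axisPoint, sub_smul]
  abel

lemma axisPoint_eq_add (i : Fin 2) (x : E3) (X : E3 →ₗ[ℝ] E3) (t v s t' v' s' : ℝ) :
    x + X (axisPoint i t v s - axisPoint i t' v' s') =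
      (x + X (axisPoint i 0 0 s - axisPoint i t' v' s')) +
        t • X (EuclideanSpace.single 0 1) + v • X (EuclideanSpace.single i.succ 1) := by
  have : axisPoint i t v s = axisPoint i 0 0 s + t • EuclideanSpace.single 0 (1 : ℝ) +
      v • EuclideanSpace.single i.succ (1 : ℝ) := by
    simp only [axisPoint, zero_smul, zero_add]
    abel
  rw [this]
  simp only [map_sub, map_add, map_smul]
  abel

section

variable {α β D T ε M R δ : ℝ} {κ : Fin 2 → ℝ} {X : E3 →ₗ[ℝ] E3} {B : Set E3} {x : E3}
  {φ : E3 → ℝ} {φ' : E3 → E3 →L[ℝ] ℝ}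

/-- `hlow` bounds the derivative along axis `i + 1` at `x` only; `hc3` says that it varies over the
box by at most half of that bound, so `q = (1/24) D/(Tε)` survives everywhere. `hc2` keeps the box
where `φ` is defined, and `hc1` makes the slope at most 1. -/
lemma exists_halfPlane_rescaled (h1 : 1 < α) (hR : 0 < R) (hM : 1 ≤ M)
    (hφ : IsDefiningFunction (α - 1) M δ B x φ φ') (hs : IsScale α D T ε)
    (hX : IsShearScaling D T κ X) (i : Fin 2) {t' v' s' : ℝ} (ht' : |t'| ≤ R) (hv' : |v'| ≤ R)
    (hs' : |s'| ≤ R)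
    (hlow : 1 / 12 * (D / (T * ε)) ≤ |φ' x (X (EuclideanSpace.single i.succ 1))|)
    (hc1 : 24 * M * ε ≤ 1) (hc2 : 20 * R * D < δ)
    (hc3 : M * (20 * R * D) ^ (α - 1) * (3 * D) ≤ 1 / 24 * (D / (T * ε)))
    {s : ℝ} (hsR : |s| ≤ R) :
    ∃ c b : ℝ, ∃ V : Set ℝ, |c| ≤ 24 * M * ε ∧ MeasurableSet V ∧ ∀ t v : ℝ, |t| ≤ R → |v| ≤ R →
      24 * M * (2 * R * (5 + 72 * M)) ^ α * ε ^ (α + 1) < |v - c * t - b| →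
      (x + X (axisPoint i 0 0 s - axisPoint i t' v' s') + t • X (EuclideanSpace.single 0 1) +
        v • X (EuclideanSpace.single i.succ 1) ∈ B ↔ v - c * t ∈ V) := by
  have hε := hs.ε_pos
  have hD := hs.D_pos
  have hT := one_pos.trans_le hs.one_le_T
  set w₀ := X (EuclideanSpace.single 0 1) with hw₀
  set w₁ := X (EuclideanSpace.single i.succ 1) with hw₁
  set p := x + X (axisPoint i 0 0 s - axisPoint i t' v' s') with hp
  have hn₀ : ‖w₀‖ = D / T := hX.norm_zero_axis hD.le hT.le
  have hn₁ : ‖w₁‖ ≤ 3 * D := hX.norm_succ_axis hD.le i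
  set q := 1 / 24 * (D / (T * ε)) with hq
  have hq0 : 0 < q := by positivity
  have hdist : ∀ t v : ℝ, |t| ≤ R → |v| ≤ 3 * R → ‖p + t • w₀ + v • w₁ - x‖ ≤ 20 * R * D := by
    intro t v ht hv
    rw [hp, hw₀, hw₁, ← axisPoint_eq_add, add_sub_cancel_left, axisPoint_sub]
    refine hX.norm_apply_le hD.le hs.one_le_T i ?_ ?_ ?_
    · exact (abs_sub _ _).trans (by linarith)
    · exact (abs_sub _ _).trans (by linarith)
    · exact (abs_sub _ _).trans (by linarith)
  have hball : ∀ t v : ℝ, |t| ≤ R → |v| ≤ 3 * R → p + t • w₀ + v • w₁ ∈ Metric.ball x δ := by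
    intro t v ht hv
    rw [Metric.mem_ball, dist_eq_norm]
    exact (hdist t v ht hv).trans_lt hc2
  have hxball : x ∈ Metric.ball x δ :=
    Metric.mem_ball_self ((by positivity : 0 ≤ 20 * R * D).trans_lt hc2)
  obtain ⟨σ, hσ, hσq⟩ : ∃ σ : ℝ, (σ = 1 ∨ σ = -1) ∧ σ * φ' x w₁ = |φ' x w₁| := by
    rcases le_total 0 (φ' x w₁) with h | h
    · exact ⟨1, Or.inl rfl, by rw [one_mul, abs_of_nonneg h]⟩
    · exact ⟨-1, Or.inr rfl, by rw [neg_one_mul, abs_of_nonpos h]⟩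
  have hσ1 : |σ| = 1 := by rcases hσ with rfl | rfl <;> simp
  have hq1 : ∀ t v : ℝ, |t| ≤ R → |v| ≤ 3 * R → q ≤ σ * φ' (p + t • w₀ + v • w₁) w₁ := by
    intro t v ht hv
    set y := p + t • w₀ + v • w₁ with hy
    have e1 : |σ * φ' y w₁ - σ * φ' x w₁| ≤ q := by
      rw [← mul_sub, abs_mul, hσ1, one_mul, ← _root_.sub_apply, ← Real.norm_eq_abs]
      refine ((φ' y - φ' x).le_opNorm w₁).trans (le_trans ?_ hc3)
      have h3 := hφ.norm_sub_le y (hball t v ht hv) x hxball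
      have h4 := hdist t v ht hv
      gcongr
      refine h3.trans ?_
      gcongr
    have e2 := (abs_le.1 e1).1
    have e3 : 2 * q ≤ σ * φ' x w₁ := by
      rw [hσq]
      refine le_trans (le_of_eq ?_) hlow
      rw [hq]; ring
    linarith
  -- The derivative along the first axis is at most `M D/T`, which fixes the slope bound `A = 24Mε`.
  -- Accordingly `W` collects `D/T ≤ 5εD` and `A · 3D`.
  have hqA : 24 * M * ε * q = M * (D / T) := by
    rw [hq]; field_simp
  obtain ⟨c, b, V, hc, hV, h⟩ := exists_halfPlane (A := 24 * M * ε)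
    (W := (5 + 72 * M) * (ε * D)) hR hq0 (by positivity) hc1 (by linarith) (by linarith) hφ hball
    hσ hq1
    (fun t v ht hv => by
      rw [hqA, ← hn₀, ← Real.norm_eq_abs]
      exact ((φ' _).le_opNorm w₀).trans (by gcongr; exact hφ.norm_le _ (hball t v ht hv)))
    (fun c hc => by
      calc ‖w₀ + c • w₁‖ ≤ ‖w₀‖ + |c| * ‖w₁‖ := by
            refine (norm_add_le _ _).trans ?_
            rw [norm_smul, Real.norm_eq_abs]
        _ ≤ D * (5 * ε) + 24 * M * ε * (3 * D) := by
            rw [hn₀, div_eq_mul_one_div]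
            gcongr
            exact hs.T_ε
        _ = _ := by ring)
  refine ⟨c, b, V, hc, hV, fun t v ht hv hlt => h t v ht hv ?_⟩
  rwa [hq, hs.strip_eq hR.le (by positivity)]

end

section

variable {α β μ μ' R N M : ℝ} {η : E3 → ℂ}

lemma IsGenerator.integrable (hη : IsGenerator R N η) (hR : 0 ≤ R) : Integrable η := by
  have hηs : HasCompactSupport η := by
    refine HasCompactSupport.intro (isCompact_closedBall (0 : E3) (3 * R)) fun y hy => ?_
    by_contra h
    have hle : ∀ l, |y l| ≤ R := fun l => by
      by_contra! hl; exact h (hη.eq_zero y l hl)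
    refine hy ?_
    rw [mem_closedBall_zero_iff]
    have h3 : ‖y‖ ^ 2 ≤ (3 * R) ^ 2 := by
      rw [norm_sq_eq_sum_three]
      have e : ∀ l, y l ^ 2 ≤ R ^ 2 := fun l => by
        rw [← sq_abs]; exact pow_le_pow_left₀ (abs_nonneg _) (hle l) 2
      nlinarith [e 0, e 1, e 2]
    exact (abs_le_of_sq_le_sq' h3 (by positivity)).2
  exact hη.continuous.integrable_of_hasCompactSupport hηs

lemma integrable_rescaled (hη : IsGenerator R N η) (hR : 0 ≤ R) {g : E3 → ℂ}
    {μ : ℝ} (hgb : ∀ x, ‖g x‖ ≤ μ) (hgc : Continuous g) {B : Set E3} (hB : MeasurableSet B)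
    (X : E3 →ₗ[ℝ] E3) (x y₀ : E3) :
    Integrable fun y => B.indicator g (x + X (y - y₀)) * η y := by
  have hXc : Continuous fun y => x + X (y - y₀) := by
    have := LinearMap.continuous_of_finiteDimensional X
    fun_prop
  have hηi := hη.integrable hR
  refine hηi.bdd_mul (c := μ) ?_ (Eventually.of_forall fun y => ?_)
  · have h1 : Measurable fun y => B.indicator g (x + X (y - y₀)) :=
      (hgc.measurable.indicator hB).comp hXc.measurable
    exact h1.aestronglyMeasurable
  · exact (norm_indicator_le_norm_self _ _).trans (hgb _)

/-- The estimate for the discontinuous part at small parameter. -/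
lemma norm_rescaled_integral_le (h1 : 1 < α) (h2 : α ≤ 2) (hαβ : α ≤ β)
    (hη : IsGenerator R N η) (hR : 0 < R) (hN : 0 ≤ N) (hM : 1 ≤ M) (hμ : 0 ≤ μ) (hμ' : 0 ≤ μ')
    {g : E3 → ℂ} (hgb : ∀ x, ‖g x‖ ≤ μ) (hg : GradHolder (β - 1) μ' g)
    {D T ε τ : ℝ} (hs : IsScale α D T ε) (hc1 : 24 * M * ε ≤ 1) (hτ : 0 ≤ τ)
    {κ : Fin 2 → ℝ} {X : E3 →ₗ[ℝ] E3} (hX : IsShearScaling D T κ X) (i : Fin 2) (x : E3)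
    (t' v' s' : ℝ) {B : Set E3} (hB : MeasurableSet B)
    (hBV : ∀ s : ℝ, |s| ≤ R → ∃ c b : ℝ, ∃ V : Set ℝ, |c| ≤ 24 * M * ε ∧ MeasurableSet V ∧
      ∀ t v : ℝ, |t| ≤ R → |v| ≤ R → τ < |v - c * t - b| →
      (x + X (axisPoint i 0 0 s - axisPoint i t' v' s') + t • X (EuclideanSpace.single 0 1) +
        v • X (EuclideanSpace.single i.succ 1) ∈ B ↔ v - c * t ∈ V)) :
    ‖∫ y, B.indicator g (x + X (y - axisPoint i t' v' s')) * η y‖ ≤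
      (((μ * N * (24 * M) ^ 3 + 5 * μ' * (5 + 72 * M) * N * (24 * M) +
        5 * μ' * (R * (5 + 72 * M)) ^ (β - 1) * (R * (5 + 72 * M)) * N * (2 * R)) *
          ε ^ (α + 1)) * (4 * R) + μ * N * (4 * R * τ)) * (2 * R) := by
  have hε := hs.ε_pos
  have hD := hs.D_pos
  have hT := one_pos.trans_le hs.one_le_T
  refine norm_integral_le_of_slices
    (integrable_rescaled hη hR.le hgb hg.contDiff.continuous hB X x _) hR.le i ?_ ?_
  · intro t v s hsR
    rw [hη.eq_zero _ i.rev.succ (by rwa [axisPoint_rev_coord]), mul_zero]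
  · intro s
    have hline := hs.line_bound h1 h2 hαβ hμ hμ' hN (P := 24 * M) (Q := 5 + 72 * M)
      (by positivity) (by positivity) hR.le
    by_cases hsR : |s| ≤ R
    · obtain ⟨c, b, V, hc, hV, h⟩ := hBV s hsR
      rw [integral_congr_ae (Eventually.of_forall fun q : ℝ × ℝ => by
        rw [axisPoint_eq_add i x X q.1 q.2 s t' v' s'])]
      have hW : ‖X (EuclideanSpace.single 0 1) + c • X (EuclideanSpace.single i.succ 1)‖ ≤
          (5 + 72 * M) * (ε * D) := by
        calc _ ≤ ‖X (EuclideanSpace.single 0 1)‖ +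
              |c| * ‖X (EuclideanSpace.single i.succ 1)‖ := by
              refine (norm_add_le _ _).trans ?_
              rw [norm_smul, Real.norm_eq_abs]
          _ ≤ D * (5 * ε) + 24 * M * ε * (3 * D) := by
              rw [hX.norm_zero_axis hD.le hT.le, div_eq_mul_one_div]
              gcongr
              · exact hs.T_ε
              · exact hX.norm_succ_axis hD.le i
          _ = _ := by ring
      -- The moments are taken at parameter `24Mε`, the actual bound for the slope of the lines.
      refine (norm_plane_integral_le (a := β - 1) (ε := 24 * M * ε) hη (by linarith) hμ' hR hN hgb
        hg i s _ _ _ (by positivity) hc1 hc hτ hW hB hV h).trans ?_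
      gcongr
    · push Not at hsR
      have : ∀ q : ℝ × ℝ, η (axisPoint i q.1 q.2 s) = 0 := fun q =>
        hη.eq_zero _ i.rev.succ (by rwa [axisPoint_rev_coord])
      simp_rw [this, mul_zero]
      rw [integral_zero, norm_zero]
      have : 0 ≤ (R * (5 + 72 * M)) ^ (β - 1) := Real.rpow_nonneg (by positivity) _
      positivity

end

end

/-! ### The rescaled estimate for all parameters -/

noncomputable section

/-- The estimate of the coefficient in rescaled coordinates, in terms of the derivative of a
defining function in one of the shear directions. -/
lemma exists_norm_rescaled_integral_le {α β μ μ' R N M r : ℝ} {η : E3 → ℂ} (h1 : 1 < α)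
    (h2 : α ≤ 2) (hαβ : α ≤ β) (hη : IsGenerator R N η) (hR : 0 < R) (hN : 0 ≤ N) (hM : 1 ≤ M)
    (hμ : 0 ≤ μ) (hμ' : 0 ≤ μ') (hr : 0 < r) :
    ∃ C : ℝ, 0 < C ∧ ∀ (f₀ f₁ : E3 → ℂ), (∀ x, ‖f₀ x‖ ≤ μ) → (∀ x, ‖f₁ x‖ ≤ μ) →
      GradHolder (β - 1) μ' f₀ → GradHolder (β - 1) μ' f₁ →
      ∀ (B : Set E3) (x : E3) (φ : E3 → ℝ) (φ' : E3 → E3 →L[ℝ] ℝ), IsClosed B →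
      IsDefiningFunction (α - 1) M (r / 2) B x φ φ' →
      ∀ (D T ε : ℝ) (κ : Fin 2 → ℝ) (X : E3 →ₗ[ℝ] E3) (i : Fin 2) (y₀ : E3),
      IsScale α D T ε → IsShearScaling D T κ X → (∀ l, |y₀ l| ≤ R) →
      (ε ≤ 1 / 24 → 1 / 12 * (D / (T * ε)) ≤ |φ' x (X (EuclideanSpace.single i.succ 1))|) →
      ‖∫ y, (f₀ + B.indicator f₁) (x + X (y - y₀)) * η y‖ ≤ C * ε ^ (α + 1) := by
  have hηi := hη.integrable hR.le
  have hM0 : 0 < M := by linarith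
  have hRα : 0 < (20 * R) ^ (α - 1) := Real.rpow_pos_of_pos (by positivity) _
  have hrα : 0 < (r / (80 * R)) ^ (α - 1) := Real.rpow_pos_of_pos (by positivity) _
  -- The three thresholds guarantee, in order, slope at most 1, small variation of `φ'` over the
  -- box, and a box inside the ball of radius `r/2` (through `D^{α-1} = 1/T ≤ 5ε`).
  set ε₀ := min (1 / (24 * M)) (min (1 / (72 * M * (20 * R) ^ (α - 1)))
    ((r / (80 * R)) ^ (α - 1) / 5)) with hε₀
  have hε₀0 : 0 < ε₀ := lt_min (by positivity) (lt_min (by positivity) (by positivity))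
  set K := μ * N * (24 * M) ^ 3 + 5 * μ' * (5 + 72 * M) * N * (24 * M) +
        5 * μ' * (R * (5 + 72 * M)) ^ (β - 1) * (R * (5 + 72 * M)) * N * (2 * R) with hK
  have hK0 : 0 ≤ K := by
    have : 0 ≤ (R * (5 + 72 * M)) ^ (β - 1) := Real.rpow_nonneg (by positivity) _
    positivity
  set S := 24 * M * (2 * R * (5 + 72 * M)) ^ α with hS
  have hS0 : 0 ≤ S := by
    have : 0 ≤ (2 * R * (5 + 72 * M)) ^ α := Real.rpow_nonneg (by positivity) _
    positivity
  set I := ∫ y, 2 * μ * ‖η y‖ with hI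
  have hI0 : 0 ≤ I := integral_nonneg fun y => by positivity
  have hε₀α : 0 < ε₀ ^ (α + 1) := Real.rpow_pos_of_pos hε₀0 _
  -- Contributions of `f₀`, of `f₁` on `B` including its strip, and of the trivial bound used when
  -- `ε ≥ ε₀`; the final 1 only ensures positivity.
  refine ⟨(K * (4 * R)) * (2 * R) + (K * (4 * R) + μ * N * (4 * R * S)) * (2 * R) +
    I / ε₀ ^ (α + 1) + 1, by positivity, ?_⟩
  intro f₀ f₁ hb₀ hb₁ hf₀ hf₁ B x φ φ' hB hφ D T ε κ X i y₀ hs hX hy₀ hlow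
  have hε := hs.ε_pos
  have hD := hs.D_pos
  have hT := one_pos.trans_le hs.one_le_T
  have hεα : 0 < ε ^ (α + 1) := Real.rpow_pos_of_pos hε _
  rcases le_total ε ε₀ with hle | hle
  · have hle1 : ε ≤ 1 / (24 * M) := hle.trans (min_le_left _ _)
    have hle2 : ε ≤ 1 / (72 * M * (20 * R) ^ (α - 1)) :=
      hle.trans ((min_le_right _ _).trans (min_le_left _ _))
    have hle3 : ε ≤ (r / (80 * R)) ^ (α - 1) / 5 :=
      hle.trans ((min_le_right _ _).trans (min_le_right _ _))
    have hc1 : 24 * M * ε ≤ 1 := by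
      rw [le_div_iff₀ (by positivity)] at hle1
      linarith
    have hc2 : 20 * R * D < r / 2 := by
      have e1 : D ^ (α - 1) ≤ (r / (80 * R)) ^ (α - 1) := by
        rw [hs.rpow_D]
        linarith [hs.T_ε]
      have e2 : D ≤ r / (80 * R) :=
        (Real.rpow_le_rpow_iff hD.le (by positivity) (by linarith)).1 e1
      rw [le_div_iff₀ (by positivity)] at e2
      linarith
    have hc3 : M * (20 * R * D) ^ (α - 1) * (3 * D) ≤ 1 / 24 * (D / (T * ε)) := by
      rw [le_div_iff₀ (by positivity)] at hle2
      rw [Real.mul_rpow (by positivity) hD.le, hs.rpow_D,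
        show 1 / 24 * (D / (T * ε)) = (1 / 24 * D) / (T * ε) by ring, le_div_iff₀ (by positivity)]
      calc M * ((20 * R) ^ (α - 1) * (1 / T)) * (3 * D) * (T * ε)
          = (ε * (72 * M * (20 * R) ^ (α - 1))) * (1 / 24 * D) := by field_simp; ring
        _ ≤ 1 * (1 / 24 * D) := by gcongr
        _ = _ := one_mul _
    have hlow := hlow (hle1.trans (one_div_le_one_div_of_le (by norm_num) (by linarith)))
    have hy : y₀ = axisPoint i (y₀ 0) (y₀ i.succ) (y₀ i.rev.succ) := (axisPoint_surj i y₀).symm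
    -- The smooth part `f₀` is the case of the whole space, which has no boundary and hence a strip
    -- of width 0.
    have b₀ := norm_rescaled_integral_le h1 h2 hαβ hη hR hN hM hμ hμ' hb₀ hf₀ hs hc1 le_rfl hX i x
      (y₀ 0) (y₀ i.succ) (y₀ i.rev.succ) MeasurableSet.univ
      (fun s _ => ⟨0, 0, Set.univ, by simp only [abs_zero]; positivity, MeasurableSet.univ,
        fun t v _ _ _ => by simp⟩)
    have b₁ := norm_rescaled_integral_le h1 h2 hαβ hη hR hN hM hμ hμ' hb₁ hf₁ hs hc1
      (τ := S * ε ^ (α + 1)) (by positivity) hX i x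
      (y₀ 0) (y₀ i.succ) (y₀ i.rev.succ) hB.measurableSet
      (fun s hsR => exists_halfPlane_rescaled h1 hR hM hφ hs hX i (hy₀ 0) (hy₀ _) (hy₀ _) hlow
        hc1 hc2 hc3 hsR)
    rw [← hy] at b₀ b₁
    have i₀ := integrable_rescaled hη hR.le hb₀ hf₀.contDiff.continuous MeasurableSet.univ X x y₀
    have i₁ := integrable_rescaled hη hR.le hb₁ hf₁.contDiff.continuous hB.measurableSet X x y₀
    have hsplit : ∫ y, (f₀ + B.indicator f₁) (x + X (y - y₀)) * η y =
        (∫ y, Set.univ.indicator f₀ (x + X (y - y₀)) * η y) +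
          ∫ y, B.indicator f₁ (x + X (y - y₀)) * η y := by
      rw [← integral_add i₀ i₁]
      refine integral_congr_ae (Eventually.of_forall fun y => ?_)
      simp only [Pi.add_apply, Set.indicator_univ]
      ring
    rw [hsplit]
    refine (norm_add_le _ _).trans ((add_le_add b₀ b₁).trans ?_)
    have : 0 ≤ (I / ε₀ ^ (α + 1) + 1) * ε ^ (α + 1) := by positivity
    linarith
  · have htriv : ‖∫ y, (f₀ + B.indicator f₁) (x + X (y - y₀)) * η y‖ ≤ I := by
      refine norm_integral_le_of_norm_le (hηi.norm.const_mul (2 * μ)) (Eventually.of_forall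
        fun y => ?_)
      rw [norm_mul]
      gcongr
      refine (norm_add_le _ _).trans ?_
      have := (norm_indicator_le_norm_self (s := B) f₁ (x + X (y - y₀))).trans (hb₁ _)
      linarith [hb₀ (x + X (y - y₀))]
    have hpow : ε₀ ^ (α + 1) ≤ ε ^ (α + 1) :=
      Real.rpow_le_rpow hε₀0.le hle (by linarith)
    have e1 : I ≤ I / ε₀ ^ (α + 1) * ε ^ (α + 1) := by
      rw [div_mul_eq_mul_div, le_div_iff₀ hε₀α]
      gcongr
    refine htriv.trans (e1.trans ?_)
    gcongr
    have : 0 ≤ (K * (4 * R)) * (2 * R) + (K * (4 * R) + μ * N * (4 * R * S)) * (2 * R) := by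
      positivity
    linarith

end

noncomputable section

/-! ### The change of variables -/

/-- The argument `S_k A_{2^j} x` of the generator. -/
def shearletMap (α : ℝ) (j : ℕ) (k : Fin 2 → ℤ) : E3 →ₗ[ℝ] E3 :=
  Matrix.toEuclideanLin (shearMatrix k * scalingMatrix α j)

/-- The inverse of `shearletMap`, in terms of `D = 2^{-j/2}` and `T = 2^{j(α-1)/2}`. -/
def shearletInv (D T : ℝ) (k : Fin 2 → ℤ) : E3 →ₗ[ℝ] E3 :=
  Matrix.toEuclideanLin !![D / T, -(D * (k 0 / T)), -(D * (k 1 / T)); 0, D, 0; 0, 0, D]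

section

variable (α : ℝ) (j : ℕ)

lemma two_rpow_relations :
    (2 : ℝ) ^ ((j : ℝ) * α / 2) * ((2 : ℝ) ^ (-((j : ℝ) / 2)) / 2 ^ ((j : ℝ) * (α - 1) / 2)) = 1 ∧
    (2 : ℝ) ^ ((j : ℝ) / 2) * (2 : ℝ) ^ (-((j : ℝ) / 2)) = 1 := by
  have h2 : (0 : ℝ) < 2 := two_pos
  rw [← Real.rpow_sub h2, ← Real.rpow_add h2, ← Real.rpow_add h2]
  constructor
  · rw [show (j : ℝ) * α / 2 + (-((j : ℝ) / 2) - (j : ℝ) * (α - 1) / 2) = 0 by ring, Real.rpow_zero]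
  · rw [add_neg_cancel, Real.rpow_zero]

lemma shearletMap_shearletInv (k : Fin 2 → ℤ) (y : E3) :
    shearletMap α j k (shearletInv ((2 : ℝ) ^ (-((j : ℝ) / 2))) (2 ^ ((j : ℝ) * (α - 1) / 2)) k y) =
      y := by
  obtain ⟨e1, e2⟩ := two_rpow_relations α j
  set D := (2 : ℝ) ^ (-((j : ℝ) / 2))
  set T := (2 : ℝ) ^ ((j : ℝ) * (α - 1) / 2)
  ext l
  fin_cases l
  · simp [shearletMap, shearletInv, shearMatrix, scalingMatrix, Matrix.mulVec, dotProduct,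
      Fin.sum_univ_three, Matrix.vecMul_diagonal]
    linear_combination (y 0 - k 0 * y 1 - k 1 * y 2) * e1 + (k 0 * y 1 + k 1 * y 2) * e2
  · simp [shearletMap, shearletInv, shearMatrix, scalingMatrix, Matrix.mulVec, dotProduct,
      Fin.sum_univ_three, Matrix.vecMul_diagonal]
    linear_combination y 1 * e2
  · simp [shearletMap, shearletInv, shearMatrix, scalingMatrix, Matrix.mulVec, dotProduct,
      Fin.sum_univ_three, Matrix.vecMul_diagonal]
    linear_combination y 2 * e2

lemma isShearScaling_shearletInv {D T : ℝ} {k : Fin 2 → ℤ} (hk : ∀ i, |(k i : ℝ) / T| ≤ 2) :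
    IsShearScaling D T (fun i => k i / T) (shearletInv D T k) := by
  refine ⟨?_, fun i => ?_, hk⟩
  · ext l
    fin_cases l <;> simp [shearletInv, Matrix.mulVec, dotProduct, Fin.sum_univ_three]
  · ext l
    fin_cases i <;> fin_cases l <;>
      simp [shearletInv, Matrix.mulVec, dotProduct, Fin.sum_univ_three]

lemma det_shearletInv (D T : ℝ) (k : Fin 2 → ℤ) :
    LinearMap.det (shearletInv D T k) = D / T * D * D := by
  rw [shearletInv, Matrix.toEuclideanLin, Matrix.toLpLin_eq_toLin, LinearMap.det_toLin, Matrix.det_fin_three]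
  simp

lemma isScale_two_rpow {α : ℝ} (h1 : 1 < α) {ε : ℝ} (hε : 0 < ε) (hε1 : ε ≤ 1)
    (h : 1 / (2 : ℝ) ^ ((j : ℝ) * (α - 1) / 2) ≤ 5 * ε) :
    IsScale α ((2 : ℝ) ^ (-((j : ℝ) / 2))) (2 ^ ((j : ℝ) * (α - 1) / 2)) ε := by
  have hj : (0 : ℝ) ≤ j := j.cast_nonneg
  refine ⟨by positivity, ?_, ?_, ?_, hε, hε1, h⟩
  · exact Real.rpow_le_one_of_one_le_of_nonpos (by norm_num) (by linarith)
  · exact Real.one_le_rpow (by norm_num) (div_nonneg (mul_nonneg hj (by linarith)) (by norm_num))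
  · rw [← Real.rpow_mul two_pos.le, one_div, ← Real.rpow_neg two_pos.le]
    congr 1; ring

end

lemma integral_comp_shearletInv {D T : ℝ} (hD : 0 < D) (hT : 0 < T) (k : Fin 2 → ℤ) (x y₀ : E3)
    (F : E3 → ℂ) :
    ∫ y, F y = ((D / T * D * D : ℝ) : ℂ) * ∫ y, F (x + shearletInv D T k (y - y₀)) := by
  set X := shearletInv D T k with hX
  have hdet : LinearMap.det X = D / T * D * D := det_shearletInv D T k
  have hdet0 : LinearMap.det X ≠ 0 := by rw [hdet]; positivity
  set Xe := LinearMap.equivOfDetNeZero X hdet0 with hXe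
  have hXe' : ∀ y, Xe y = X y := fun y => rfl
  have hbij : Function.Bijective fun y => x + X (y - y₀) := by
    refine ⟨fun y y' h => ?_, fun z => ⟨Xe.symm (z - x) + y₀, ?_⟩⟩
    · have h : x + X (y - y₀) = x + X (y' - y₀) := h
      have h3 : Xe (y - y₀) = Xe (y' - y₀) := by
        rw [hXe', hXe']; exact add_left_cancel h
      exact sub_left_injective (Xe.injective h3)
    · simp only [add_sub_cancel_right]
      rw [← hXe', LinearEquiv.apply_symm_apply]
      abel
  have hder : ∀ y ∈ (Set.univ : Set E3), HasFDerivWithinAt (fun y => x + X (y - y₀))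
      (LinearMap.toContinuousLinearMap X) Set.univ y := by
    intro y _
    have h1 : HasFDerivAt (fun y => LinearMap.toContinuousLinearMap X (y - y₀))
        (LinearMap.toContinuousLinearMap X) y :=
      (LinearMap.toContinuousLinearMap X).hasFDerivAt.comp y ((hasFDerivAt_id y).sub_const y₀)
    exact (h1.const_add x).hasFDerivWithinAt
  have h := integral_image_eq_integral_abs_det_fderiv_smul volume MeasurableSet.univ hder
    hbij.injective.injOn F
  rw [Set.image_univ, hbij.surjective.range_eq, setIntegral_univ, setIntegral_univ] at h
  rw [h, ← integral_const_mul]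
  refine integral_congr_ae (Eventually.of_forall fun y => ?_)
  have hd : (LinearMap.toContinuousLinearMap X).det = D / T * D * D := by
    rw [LinearMap.det_toContinuousLinearMap]; exact hdet
  simp only [hd]
  rw [abs_of_pos (by positivity), Complex.real_smul]

lemma shearlet_eq (α : ℝ) (ψ : E3 → ℂ) (j : ℕ) (k : Fin 2 → ℤ) (m x : E3) :
    shearlet α ψ j k m x = (((2 : ℝ) ^ ((j : ℝ) * (α + 2) / 4) : ℝ) : ℂ) *
      ψ (shearletMap α j k x - m) := rfl

lemma mem_tsupport_of_mem_tsupport_shearlet {α : ℝ} {ψ : E3 → ℂ} {j : ℕ} {k : Fin 2 → ℤ}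
    {m x : E3} (hx : x ∈ tsupport (shearlet α ψ j k m)) :
    shearletMap α j k x - m ∈ tsupport ψ := by
  have hc : Continuous fun x => shearletMap α j k x - m := by
    have := LinearMap.continuous_of_finiteDimensional (shearletMap α j k)
    fun_prop
  have h1 : x ∈ tsupport (ψ ∘ fun x => shearletMap α j k x - m) :=
    tsupport_mul_subset_right (f := fun _ => (((2 : ℝ) ^ ((j : ℝ) * (α + 2) / 4) : ℝ) : ℂ))
      (g := ψ ∘ fun x => shearletMap α j k x - m) hx
  exact tsupport_comp_subset_preimage ψ hc h1

/-- The Jacobian `D³/T` times the normalisation `2^{j(α+2)/4}` is the stated power of 2. Anchoring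
the substitution at the boundary point `x` places its image `y₀` in the support of `ψ`, so the
rescaled picture stays in a bounded box. -/
lemma norm_coeff_eq {α : ℝ} {ψ η : E3 → ℂ} (hη : (fun x => conj (ψ x)) =ᵐ[volume] η) (f : E3 → ℂ)
    (j : ℕ) (k : Fin 2 → ℤ) (m x : E3) :
    ‖coeff f (shearlet α ψ j k m)‖ = (2 : ℝ) ^ (-(j : ℝ) * (α / 4 + 1 / 2)) *
      ‖∫ y, f (x + shearletInv ((2 : ℝ) ^ (-((j : ℝ) / 2))) (2 ^ ((j : ℝ) * (α - 1) / 2)) k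
        (y - (shearletMap α j k x - m))) * η y‖ := by
  have hinv := shearletMap_shearletInv α j k
  have hfac : (2 : ℝ) ^ (-((j : ℝ) / 2)) / 2 ^ ((j : ℝ) * (α - 1) / 2) * 2 ^ (-((j : ℝ) / 2)) *
      2 ^ (-((j : ℝ) / 2)) * 2 ^ ((j : ℝ) * (α + 2) / 4) =
      (2 : ℝ) ^ (-(j : ℝ) * (α / 4 + 1 / 2)) := by
    rw [← Real.rpow_sub two_pos, ← Real.rpow_add two_pos, ← Real.rpow_add two_pos,
      ← Real.rpow_add two_pos]
    congr 1; ring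
  have hD : (0 : ℝ) < (2 : ℝ) ^ (-((j : ℝ) / 2)) := by positivity
  have hT : (0 : ℝ) < (2 : ℝ) ^ ((j : ℝ) * (α - 1) / 2) := by positivity
  set D := (2 : ℝ) ^ (-((j : ℝ) / 2))
  set T := (2 : ℝ) ^ ((j : ℝ) * (α - 1) / 2)
  set y₀ := shearletMap α j k x - m with hy₀
  have h1 : ∀ y, f (x + shearletInv D T k (y - y₀)) *
      conj (shearlet α ψ j k m (x + shearletInv D T k (y - y₀))) =
      (((2 : ℝ) ^ ((j : ℝ) * (α + 2) / 4) : ℝ) : ℂ) *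
        (f (x + shearletInv D T k (y - y₀)) * conj (ψ y)) := by
    intro y
    have e : shearletMap α j k (x + shearletInv D T k (y - y₀)) - m = y := by
      rw [map_add, hinv, hy₀]; abel
    rw [shearlet_eq, e, map_mul, Complex.conj_ofReal]
    ring
  have h2 : ∫ y, f (x + shearletInv D T k (y - y₀)) * conj (ψ y) =
      ∫ y, f (x + shearletInv D T k (y - y₀)) * η y := by
    refine integral_congr_ae ?_
    filter_upwards [hη] with y hy
    rw [← hy]
  rw [coeff, integral_comp_shearletInv hD hT k x y₀]
  simp_rw [h1]
  rw [integral_const_mul, h2, ← mul_assoc, norm_mul, ← Complex.ofReal_mul, Complex.norm_real, hfac,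
    Real.norm_of_nonneg (by positivity)]

end

noncomputable section

/-! ### The three cases for the tangent plane -/

/-- For the normal `(-1, s₁, s₂)` the value is `(D/T)(k_i + T s_i)`: this is where the denominator
of (i) comes from. -/
lemma inner_shearletInv_succ (D T : ℝ) (k : Fin 2 → ℤ) (i : Fin 2) (n₀ n₁ n₂ : ℝ) :
    inner ℝ (shearletInv D T k (EuclideanSpace.single i.succ 1)) (!₂[n₀, n₁, n₂] : E3) =
      D * (![n₁, n₂] i - k i / T * n₀) := by
  rw [PiLp.inner_apply, Fin.sum_univ_three]
  fin_cases i <;> simp [shearletInv, Matrix.mulVec, dotProduct, Fin.sum_univ_three] <;> ring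

lemma norm_sq_vec_three (a b c : ℝ) : ‖(!₂[a, b, c] : E3)‖ ^ 2 = a ^ 2 + b ^ 2 + c ^ 2 := by
  rw [norm_sq_eq_sum_three]; simp

/-- Converts the lower bound on the gradient into one on the factor `c` relating it to a normal that
is not normalised. -/
lemma one_le_of_normal {L : E3 →L[ℝ] ℝ} (hL : 1 ≤ ‖L‖) {c : ℝ} {n : E3}
    (h : ∀ y, L y = c * inner ℝ y n) : 1 ≤ |c| * ‖n‖ := by
  refine hL.trans (L.opNorm_le_bound (by positivity) fun y => ?_)
  rw [h, norm_mul, Real.norm_eq_abs, mul_assoc]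
  gcongr
  rw [mul_comm]
  exact norm_inner_le_norm y n

lemma abs_le_add_one_of_abs_le_ceil {T : ℝ} {k : ℤ} (h : |k| ≤ ⌈T⌉) : |(k : ℝ)| ≤ T + 1 := by
  have h1 : ((|k| : ℤ) : ℝ) ≤ (⌈T⌉ : ℝ) := by exact_mod_cast h
  rw [Int.cast_abs] at h1
  exact h1.trans (Int.ceil_lt_add_one T).le

/-- A plane whose normal is far from the first axis meets one of the sheared axes transversally. -/
lemma exists_transversal_axis {L : E3 →L[ℝ] ℝ} (hL : 1 ≤ ‖L‖) {c n₀ : ℝ} {s : Fin 2 → ℝ}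
    (h : ∀ y, L y = c * inner ℝ y (!₂[n₀, s 0, s 1] : E3)) (hn : ∃ i, 3 / 2 * |n₀| ≤ |s i|) {D T : ℝ}
    (hD : 0 < D) {k : Fin 2 → ℤ} (hk : ∀ i, |(k i : ℝ)| ≤ T + 1) (hT : 24 ≤ T) :
    ∃ i : Fin 2, 1 / 12 * D ≤ |L (shearletInv D T k (EuclideanSpace.single i.succ 1))| := by
  -- Taking the larger of the two slopes bounds the whole normal by `2|s_i|`.
  obtain ⟨i, hi, hmax⟩ : ∃ i, 3 / 2 * |n₀| ≤ |s i| ∧ ∀ l, |s l| ≤ |s i| := by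
    obtain ⟨i, hi⟩ := hn
    obtain ⟨l, hl⟩ := Finite.exists_max fun l => |s l|
    exact ⟨l, hi.trans (hl i), hl⟩
  refine ⟨i, ?_⟩
  have hT0 : 0 < T := by linarith
  have h1 := one_le_of_normal hL h
  have hnorm : ‖(!₂[n₀, s 0, s 1] : E3)‖ ≤ 2 * |s i| := by
    refine (abs_le_of_sq_le_sq' ?_ (by positivity)).2
    rw [norm_sq_vec_three, mul_pow, ← sq_abs n₀, ← sq_abs (s 0), ← sq_abs (s 1)]
    have e0 := pow_le_pow_left₀ (abs_nonneg _) (hmax 0) 2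
    have e1 := pow_le_pow_left₀ (abs_nonneg _) (hmax 1) 2
    have e2 := pow_le_pow_left₀ (by positivity) hi 2
    rw [mul_pow] at e2
    nlinarith [sq_nonneg |n₀|]
  have hcs : 1 ≤ |c| * (2 * |s i|) := h1.trans (by gcongr)
  rw [h, inner_shearletInv_succ]
  have hsi : (![s 0, s 1] : Fin 2 → ℝ) i = s i := by fin_cases i <;> rfl
  rw [hsi, abs_mul, abs_mul, abs_of_pos hD]
  have hkT : |(k i : ℝ) / T| ≤ 25 / 24 := by
    rw [abs_div, abs_of_pos hT0, div_le_iff₀ hT0]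
    linarith [hk i]
  -- `T ≥ 24` gives `|k_i|/T ≤ 25/24`, below the threshold `3/2`, so the shear cannot cancel `s_i`:
  -- `1 - (25/24)(2/3) = 11/36`.
  have hlow : 11 / 36 * |s i| ≤ |s i - k i / T * n₀| := by
    have e3 : |(k i : ℝ) / T * n₀| ≤ 25 / 24 * (2 / 3 * |s i|) := by
      rw [abs_mul]
      gcongr
      linarith
    have e4 := abs_sub_abs_le_abs_sub (s i) ((k i : ℝ) / T * n₀)
    linarith
  calc 1 / 12 * D ≤ (|c| * (2 * |s i|)) * (11 / 72) * D := by
        gcongr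
        linarith
    _ = |c| * (D * (11 / 36 * |s i|)) := by ring
    _ ≤ _ := by gcongr

/-- The minimum in (i) is expressed as a bound for each `i` separately, and a zero denominator, read
as `+∞`, imposes no bound. -/
theorem mainTheorem10 (α β ν μ r c₁ c₂ : ℝ)
    (hα : 1 < α) (hαβ : α ≤ β) (hβ : β ≤ 2) (hν : 0 < ν) (hμ : 0 < μ) (hr : 0 < r)
    (hc₁ : 0 < c₁) (hc₂ : 0 < c₂)
    (ψ : E3 → ℂ) (hψL2 : MemLp ψ 2 volume) (hψsupp : HasCompactSupport ψ)
    (hψ : DecayConditions ψ) :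
    ∃ C : ℝ, 0 < C ∧
      ∀ (B : Set E3) (f : E3 → ℂ), IsCartoon α β ν μ r B f →
      ∀ (j : ℕ) (p : Fin 3 → ℤ) (k : Fin 2 → ℤ) (z : Fin 3 → ℤ),
        (∀ i, |k i| ≤ ⌈(2 : ℝ) ^ ((j : ℝ) * (α - 1) / 2)⌉) →
      ∀ x : E3,
        x ∈ interior (dyadicCube j p) ∩
          interior (tsupport (shearlet α ψ j k (latticePoint c₁ c₂ z))) ∩ frontier B →
        (∀ s : Fin 2 → ℝ, IsTangentPlaneNormal (frontier B) x !₂[-1, s 0, s 1] →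
          (∀ i, |s i| ≤ 3) →
          ∀ i, (k i : ℝ) + (2 : ℝ) ^ ((j : ℝ) * (α - 1) / 2) * s i ≠ 0 →
            ‖coeff f (shearlet α ψ j k (latticePoint c₁ c₂ z))‖ ≤
              C * ((2 : ℝ) ^ (-(j : ℝ) * (α / 4 + 1 / 2)) /
                |(k i : ℝ) + (2 : ℝ) ^ ((j : ℝ) * (α - 1) / 2) * s i| ^ (α + 1))) ∧
        (∀ s : Fin 2 → ℝ, IsTangentPlaneNormal (frontier B) x !₂[-1, s 0, s 1] →
          (∃ i, 3 / 2 ≤ |s i|) →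
            ‖coeff f (shearlet α ψ j k (latticePoint c₁ c₂ z))‖ ≤
              C * (2 : ℝ) ^ (-(j : ℝ) * (α / 2 + 1 / 4) * α)) ∧
        (∀ s : Fin 2 → ℝ, IsTangentPlaneNormal (frontier B) x !₂[0, s 0, s 1] →
            ‖coeff f (shearlet α ψ j k (latticePoint c₁ c₂ z))‖ ≤
              C * (2 : ℝ) ^ (-(j : ℝ) * (α / 2 + 1 / 4) * α)) := by
  obtain ⟨R, N, η, hR, hN, hη, hsupp, hae⟩ := exists_isGenerator hψL2 hψsupp hψ
  obtain ⟨M, hM, hstar⟩ := exists_isDefiningFunction hα (hαβ.trans hβ) hν.le hr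
  set μ' : ℝ := (3 : ℕ) * ((3 : ℕ) * μ) with hμ'
  have hμ'0 : 0 ≤ μ' := by positivity
  obtain ⟨C, hC, hcore⟩ := exists_norm_rescaled_integral_le hα (hαβ.trans hβ) hαβ hη hR hN.le hM
    hμ.le hμ'0 hr
  refine ⟨C, hC, ?_⟩
  rintro B f ⟨hB, f₀, f₁, rfl, -, ⟨hd₀, hn₀⟩, ⟨hd₁, hn₁⟩⟩ j p k z hk x ⟨⟨-, hxs⟩, hxB⟩
  obtain ⟨hb₀, hg₀⟩ := gradHolder_of_holderNorm_le (hα.trans_le hαβ) hβ hμ.le hd₀ hn₀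
  obtain ⟨hb₁, hg₁⟩ := gradHolder_of_holderNorm_le (hα.trans_le hαβ) hβ hμ.le hd₁ hn₁
  obtain ⟨hBc, hφ⟩ := hstar B hB
  obtain ⟨φ, φ', hφ⟩ := hφ x hxB
  set m := latticePoint c₁ c₂ z
  have hy₀ : ∀ l, |(shearletMap α j k x - m) l| ≤ R :=
    hsupp _ (mem_tsupport_of_mem_tsupport_shearlet (interior_subset hxs))
  rw [norm_coeff_eq hae _ j k m x]
  have hscale : ∀ ε : ℝ, 0 < ε → ε ≤ 1 → 1 / (2 : ℝ) ^ ((j : ℝ) * (α - 1) / 2) ≤ 5 * ε →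
      IsScale α ((2 : ℝ) ^ (-((j : ℝ) / 2))) (2 ^ ((j : ℝ) * (α - 1) / 2)) ε :=
    fun ε h1 h2 h3 => isScale_two_rpow j hα h1 h2 h3
  -- With `ε = 1/T` the general bound becomes exactly the rate of (ii) and (iii).
  have hpow : (2 : ℝ) ^ (-(j : ℝ) * (α / 4 + 1 / 2)) *
      (1 / (2 : ℝ) ^ ((j : ℝ) * (α - 1) / 2)) ^ (α + 1) =
      (2 : ℝ) ^ (-(j : ℝ) * (α / 2 + 1 / 4) * α) := by
    rw [one_div (_ ^ _), ← Real.rpow_neg two_pos.le, ← Real.rpow_mul two_pos.le, ← Real.rpow_add two_pos]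
    congr 1; ring
  have hT1 : 1 ≤ (2 : ℝ) ^ ((j : ℝ) * (α - 1) / 2) :=
    Real.one_le_rpow (by norm_num)
      (div_nonneg (mul_nonneg j.cast_nonneg (by linarith)) (by norm_num))
  have hD : (0 : ℝ) < (2 : ℝ) ^ (-((j : ℝ) / 2)) := by positivity
  have hP : (0 : ℝ) < (2 : ℝ) ^ (-(j : ℝ) * (α / 4 + 1 / 2)) := by positivity
  set T := (2 : ℝ) ^ ((j : ℝ) * (α - 1) / 2) with hT
  set D := (2 : ℝ) ^ (-((j : ℝ) / 2)) with hDdef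
  set P := (2 : ℝ) ^ (-(j : ℝ) * (α / 4 + 1 / 2)) with hPdef
  have hT0 : 0 < T := by linarith
  have hkT : ∀ i, |(k i : ℝ)| ≤ T + 1 := fun i => abs_le_add_one_of_abs_le_ceil (hk i)
  have hX : IsShearScaling D T (fun i => k i / T) (shearletInv D T k) := by
    refine isShearScaling_shearletInv fun i => ?_
    rw [abs_div, abs_of_pos hT0, div_le_iff₀ hT0]
    linarith [hkT i]
  have hmain : ∀ (ε : ℝ) (i : Fin 2), 0 < ε → ε ≤ 1 → 1 / T ≤ 5 * ε →
      (ε ≤ 1 / 24 → 1 / 12 * (D / (T * ε)) ≤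
        |φ' x (shearletInv D T k (EuclideanSpace.single i.succ 1))|) →
      P * ‖∫ y, (f₀ + B.indicator f₁) (x + shearletInv D T k
        (y - (shearletMap α j k x - m))) * η y‖ ≤ C * (P * ε ^ (α + 1)) := by
    intro ε i hε hε1 hTε hlow
    have := hcore f₀ f₁ hb₀ hb₁ hg₀ hg₁ B x φ φ' hBc hφ D T ε _ _ i _ (hscale ε hε hε1 hTε) hX hy₀
      hlow
    calc _ ≤ P * (C * ε ^ (α + 1)) := by gcongr
      _ = _ := by ring
  have hsteep : ∀ (n₀ : ℝ) (s : Fin 2 → ℝ),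
      IsTangentPlaneNormal (frontier B) x !₂[n₀, s 0, s 1] → (∃ i, 3 / 2 * |n₀| ≤ |s i|) →
      P * ‖∫ y, (f₀ + B.indicator f₁) (x + shearletInv D T k
        (y - (shearletMap α j k x - m))) * η y‖ ≤
        C * (2 : ℝ) ^ (-(j : ℝ) * (α / 2 + 1 / 4) * α) := by
    intro n₀ s hs hn
    obtain ⟨c, hc⟩ := hφ.normal _ hs
    have hTε : 1 / T ≤ 5 * (1 / T) := by
      have : 0 ≤ 1 / T := by positivity
      linarith
    have hT1' : 1 / T ≤ 1 := by rw [div_le_one hT0]; exact hT1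
    rw [← hpow]
    by_cases hT24 : 24 ≤ T
    · obtain ⟨i, hi⟩ := exists_transversal_axis hφ.one_le_norm hc hn hD hkT hT24
      refine hmain (1 / T) i (by positivity) hT1' hTε fun _ => ?_
      rwa [mul_one_div_cancel hT0.ne', div_one]
    -- For `T < 24` the lower bound on the derivative is not required, as `ε = 1/T` exceeds `1/24`;
    -- any axis will do.
    · refine hmain (1 / T) 0 (by positivity) hT1' hTε fun h => ?_
      rw [one_div_le_one_div hT0 (by norm_num)] at h
      exact absurd h hT24
  refine ⟨fun s hs hs3 i hκ => ?_, fun s hs hsi => ?_, fun s hs => ?_⟩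
  · obtain ⟨c, hc⟩ := hφ.normal _ hs
    set K := |(k i : ℝ) + T * s i| with hK
    have hK0 : 0 < K := abs_pos.2 hκ
    -- This uses `|s_i| ≤ 3` and `|k_i| ≤ T + 1`, and is the source of the factor 5 in `IsScale`.
    have hK5 : K ≤ 5 * T := by
      calc K ≤ |(k i : ℝ)| + |T * s i| := abs_add_le _ _
        _ ≤ (T + 1) + T * 3 := by
            rw [abs_mul, abs_of_pos hT0]
            gcongr
            · exact hkT i
            · exact hs3 i
        _ ≤ 5 * T := by linarith
    have hεpos : 0 < min 1 (1 / K) := lt_min one_pos (by positivity)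
    have hTε : 1 / T ≤ 5 * min 1 (1 / K) := by
      rw [mul_min_of_nonneg _ _ (by norm_num)]
      refine le_min ?_ ?_
      · rw [mul_one, div_le_iff₀ hT0]; linarith
      · rw [mul_one_div, div_le_div_iff₀ hT0 hK0]; linarith
    refine (hmain (min 1 (1 / K)) i hεpos (min_le_left _ _) hTε fun h => ?_).trans ?_
    -- The lower bound is needed only for `ε ≤ 1/24`, where the cap at 1 is inactive and `ε = 1/K`.
    · have hmin : min 1 (1 / K) = 1 / K := by
        refine min_eq_right ?_
        by_contra! hlt
        rw [min_eq_left hlt.le] at h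
        norm_num at h
      have h1 := one_le_of_normal hφ.one_le_norm hc
      have hnorm : ‖(!₂[-1, s 0, s 1] : E3)‖ ≤ 5 := by
        refine (abs_le_of_sq_le_sq' ?_ (by positivity)).2
        rw [norm_sq_vec_three, ← sq_abs (s 0), ← sq_abs (s 1)]
        have e0 := pow_le_pow_left₀ (abs_nonneg _) (hs3 0) 2
        have e1 := pow_le_pow_left₀ (abs_nonneg _) (hs3 1) 2
        linarith
      have hc5 : 1 ≤ |c| * 5 := h1.trans (by gcongr)
      have hsi : (![s 0, s 1] : Fin 2 → ℝ) i = s i := by fin_cases i <;> rfl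
      have e2 : s i - k i / T * -1 = (k i + T * s i) / T := by field_simp; ring
      rw [hmin, hc, inner_shearletInv_succ, hsi, e2, abs_mul, abs_mul, abs_div, abs_of_pos hD,
        abs_of_pos hT0, ← hK]
      calc 1 / 12 * (D / (T * (1 / K))) = 1 / 12 * (D * (K / T)) := by field_simp
        _ ≤ |c| * (D * (K / T)) := by
            gcongr
            linarith
    · rw [div_eq_mul_one_div P]
      refine mul_le_mul_of_nonneg_left (mul_le_mul_of_nonneg_left ?_ hP.le) hC.le
      calc (min 1 (1 / K)) ^ (α + 1) ≤ (1 / K) ^ (α + 1) := by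
            gcongr
            exact min_le_right _ _
        _ = _ := by rw [Real.div_rpow one_pos.le hK0.le, Real.one_rpow]
  · refine hsteep (-1) s hs ?_
    simpa using hsi
  · exact hsteep 0 s hs ⟨0, by simp⟩

end
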